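/- Let $M$ be a smooth (Hausdorff, second countable, finite-dimensional) simply connected manifold and let $\nabla$ be a smooth connection on $TM$. Denote again by $\nabla$ the induced connection on the bundle $W\subseteq T^*M\otimes T^*M$ of symmetric covariant two-tensors, and by $R$ its curvature. For a family $S=(S_x)_{x\in M}$ of linear subspaces $S_x\subseteq W_x$, let $\mathcal S(S)$ be the set of all $w\in S$ that are values of some smooth local section of $W$ with values in $S$. Put $$V^{(0)}=\{w\in W: R(\cdot,\cdot)w=0\},\qquad W^{(i)}=\mathcal S(V^{(i)}),\qquad V^{(i+1)}=\ker\alpha_{W^{(i)}},$$ where $\ker\alpha_{W^{(i)}}$ consists of all $w\in W^{(i)}_x$, $x\in M$, for which there is a smooth local section $X$ with values in $W^{(i)}$ such that $X(x)=w$ and $\nabla_vX\in W^{(i)}_x$ for all $v\in T_xM$. Let $\widetilde W=\bigcap_i W^{(i)}$ be the terminal subset of the decreasing sequence $W^{(0)}\supseteq W^{(1)}\supseteq\cdots$ (which is $W^{(k)}$ if the sequence is stationary from the $k$-th step on). Suppose that $\nabla$ is regular, that is, $\widetilde W$ is a smooth vector subbundle of $W$, and that $\nabla$ is locally metric, that is,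 every point of $M$ has an open neighbourhood $U$ carrying a smooth Riemannian metric $g$ with $\nabla g=0$ on $U$. Then $\nabla$ is metric: there is a smooth Riemannian metric $g$ on all of $M$ with $\nabla g=0$. Furthermore, the dimension of $\widetilde W_x$ does not depend on $x\in M$, and if $r=\operatorname{rank}\widetilde W$ denotes this dimension, then there are $r$ parallel Riemannian metrics on $M$ that are linearly independent at every point of $M$. -/

import Mathlib

open Bundle Set Module
open scoped Manifold ContDiff Topology

noncomputable section

section Flag

variable {E : Type*} [NormedAddCommGroup E] [NormedSpace ℝ E]
  {H : Type*} [TopologicalSpace H] {I : ModelWithCorners ℝ E H}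
  {M : Type*} [TopologicalSpace M] [ChartedSpace H M]
  [IsManifold I ∞ M]
  {F : Type*} [NormedAddCommGroup F] [NormedSpace ℝ F]
  {V : M → Type*} [TopologicalSpace (TotalSpace F V)]
  [∀ x, AddCommGroup (V x)] [∀ x, Module ℝ (V x)]
  [∀ x : M, TopologicalSpace (V x)]
  [FiberBundle F V]

variable (I F) in
/-- The section `σ` of the vector bundle `V` is smooth on the set `U`. -/
def SmoothSectionOn (σ : Π x : M, V x) (U : Set M) : Prop :=
  ContMDiffOn I (I.prod 𝓘(ℝ, F)) ∞ (fun y => TotalSpace.mk' F y (σ y)) U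

variable [∀ x, IsTopologicalAddGroup (V x)] [∀ x, ContinuousSMul ℝ (V x)]

/-- `R(X, Y)σ = ∇_X ∇_Y σ - ∇_Y ∇_X σ - ∇_[X, Y] σ`. -/
def CovariantDerivative.curvatureOp (cov : CovariantDerivative I F V)
    (X Y : Π x : M, TangentSpace I x) (σ : Π x : M, V x) (x : M) : V x :=
  cov (fun y => cov σ y (Y y)) x (X x) - cov (fun y => cov σ y (X y)) x (Y x)
    - cov σ x (VectorField.mlieBracket I X Y x)

/-- The vectors `w` of `V x` that are annihilated by the curvature tensor: `R(X, Y)w = 0` for all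
tangent vectors, evaluated through local smooth extensions of the vectors involved. -/
def CovariantDerivative.curvatureKernel (cov : CovariantDerivative I F V) (x : M) : Set (V x) :=
  {w | ∀ (U : Set M) (X Y : Π x : M, TangentSpace I x) (σ : Π x : M, V x), IsOpen U → x ∈ U →
    SmoothSectionOn I E X U → SmoothSectionOn I E Y U → SmoothSectionOn I F σ U →
    σ x = w → cov.curvatureOp X Y σ x = 0}

variable (I F) in
/-- `𝒮(S)`: the elements of `S` that are values of a smooth local section with values in `S`. -/
def sectionPart (S : Π x : M, Set (V x)) (x : M) : Set (V x) :=
  {w | ∃ (U : Set M) (σ : Π x : M, V x), IsOpen U ∧ x ∈ U ∧ SmoothSectionOn I F σ U ∧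
    (∀ y ∈ U, σ y ∈ S y) ∧ σ x = w}

/-- The kernel of the second fundamental 1-form `w ↦ ∇σ mod S` of `S`, where `σ` is a smooth local
section of `S` through `w`: the vectors `w` such that `∇_v σ` lies in `S` for all tangent vectors
`v`. -/
def CovariantDerivative.secondFundamentalKernel (cov : CovariantDerivative I F V)
    (S : Π x : M, Set (V x)) (x : M) : Set (V x) :=
  {w | ∃ (U : Set M) (σ : Π x : M, V x), IsOpen U ∧ x ∈ U ∧ SmoothSectionOn I F σ U ∧
    (∀ y ∈ U, σ y ∈ S y) ∧ σ x = w ∧ ∀ v : TangentSpace I x, cov σ x v ∈ S x}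

/-- The derived flag `W^(0) ⊇ W^(1) ⊇ ⋯` of a family `W` of fibrewise subspaces of `V` (a subbundle
that is preserved by the connection): `W^(i) = 𝒮(V^(i))` where `V^(0)` is the set of elements of `W`
that are annihilated by the curvature and `V^(i+1)` is the kernel of the second fundamental
1-form of `W^(i)`. -/
def CovariantDerivative.derivedFlag (cov : CovariantDerivative I F V) (W : Π x : M, Set (V x)) :
    ℕ → Π x : M, Set (V x)
  | 0 => sectionPart I F (fun x => W x ∩ cov.curvatureKernel x)
  | i + 1 => sectionPart I F (cov.secondFundamentalKernel (cov.derivedFlag W i))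

/-- The terminal subset of the derived flag. The flag is decreasing, so this is `W^(k)` as soon as
the flag is stationary from the `k`-th step on. -/
def CovariantDerivative.terminalSubset (cov : CovariantDerivative I F V) (W : Π x : M, Set (V x))
    (x : M) : Set (V x) :=
  ⋂ i, cov.derivedFlag W i x

theorem CovariantDerivative.derivedFlag_succ_subset (cov : CovariantDerivative I F V)
    (W : Π x : M, Set (V x)) (i : ℕ) (x : M) :
    cov.derivedFlag W (i + 1) x ⊆ cov.derivedFlag W i x := by
  rintro w ⟨U, σ, -, hx, -, hS, rfl⟩
  obtain ⟨U', τ, -, hx', -, hτ, h, -⟩ := hS x hx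
  exact h ▸ hτ x hx'

/-- If the flag is stationary from the `k`-th step on, the terminal subset is its `k`-th step. -/
theorem CovariantDerivative.terminalSubset_eq (cov : CovariantDerivative I F V)
    (W : Π x : M, Set (V x)) (k : ℕ) (hk : ∀ l, k ≤ l → cov.derivedFlag W l = cov.derivedFlag W k) :
    cov.terminalSubset W = cov.derivedFlag W k := by
  funext x
  refine Subset.antisymm (iInter_subset _ k) (subset_iInter fun i => ?_)
  rcases le_total k i with h | h
  · rw [hk i h]
  · exact antitone_nat_of_succ_le (f := fun i => cov.derivedFlag W i x)
      (fun i => cov.derivedFlag_succ_subset W i x) h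

variable (I F) in
/-- Over some neighbourhood of `x`, the family `S` of subsets of the fibres of `V` is a smooth
subbundle: it is spanned by a smooth frame. -/
def IsSubbundleAt (S : Π x : M, Set (V x)) (x : M) : Prop :=
  ∃ (U : Set M) (r : ℕ) (e : Fin r → Π x : M, V x), IsOpen U ∧ x ∈ U ∧
    (∀ i, SmoothSectionOn I F (e i) U) ∧
    ∀ y ∈ U, LinearIndependent ℝ (fun i => e i y) ∧
      S y = (Submodule.span ℝ (range fun i => e i y) : Set (V y))

end Flag

section Metric

variable {E : Type*} [NormedAddCommGroup E] [NormedSpace ℝ E]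
  {H : Type*} [TopologicalSpace H] (I : ModelWithCorners ℝ E H)
  {M : Type*} [TopologicalSpace M] [ChartedSpace H M]

/-- The continuous bilinear forms on the tangent space at `x`, the fibre of `T*M ⊗ T*M`. -/
abbrev TangentBilin (x : M) : Type _ :=
  TangentSpace I x →L[ℝ] TangentSpace I x →L[ℝ] ℝ

/-- The symmetric elements of `T*M ⊗ T*M`. -/
def symmetricForms (x : M) : Set (TangentBilin I x) :=
  {h | ∀ v w, h v w = h w v}

instance (x : M) : IsTopologicalAddGroup (TangentSpace I x →L[ℝ] ℝ) :=
  ContinuousLinearMap.topologicalAddGroup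

instance (x : M) : ContinuousAdd (TangentSpace I x →L[ℝ] ℝ) :=
  IsTopologicalAddGroup.toContinuousAdd

instance (x : M) : AddCommGroup (TangentBilin I x) :=
  ContinuousLinearMap.addCommGroup

instance (x : M) : IsTopologicalAddGroup (TangentBilin I x) :=
  ContinuousLinearMap.topologicalAddGroup

instance (x : M) : ContinuousAdd (TangentBilin I x) :=
  IsTopologicalAddGroup.toContinuousAdd

instance (x : M) : ContinuousSMul ℝ (TangentSpace I x →L[ℝ] ℝ) :=
  ContinuousLinearMap.continuousSMul

instance (x : M) : Module ℝ (TangentBilin I x) :=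
  ContinuousLinearMap.module

instance (x : M) : ContinuousSMul ℝ (TangentBilin I x) :=
  ContinuousLinearMap.continuousSMul

variable {I} [IsManifold I ∞ M]

/-- `v(h(Y, Z)) - h(∇_v Y, Z) - h(Y, ∇_v Z)`. -/
def CovariantDerivative.bilinAux (cov : CovariantDerivative I E (TangentSpace I : M → Type _))
    (h : Π x : M, TangentBilin I x) (x : M) (v : TangentSpace I x)
    (Y Z : Π x : M, TangentSpace I x) : ℝ :=
  mvfderiv I (fun y => h y (Y y) (Z y)) x v - h x (cov Y x v) (Z x) - h x (Y x) (cov Z x v)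

variable (I) in
/-- The section `h` of `T*M ⊗ T*M` is differentiable at `x`. -/
def BilinMDiffAt (h : Π x : M, TangentBilin I x) (x : M) : Prop :=
  MDifferentiableAt I (I.prod 𝓘(ℝ, E →L[ℝ] E →L[ℝ] ℝ))
    (fun y => TotalSpace.mk' (E →L[ℝ] E →L[ℝ] ℝ) y (h y)) x

theorem BilinMDiffAt.apply {h : Π x : M, TangentBilin I x} {x : M}
    {Y Z : Π x : M, TangentSpace I x} (hh : BilinMDiffAt I h x)
    (hY : MDiffAt (T% Y) x) (hZ : MDiffAt (T% Z) x) :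
    MDifferentiableAt I 𝓘(ℝ) (fun y => h y (Y y) (Z y)) x := by
  have : MDifferentiableAt I (I.prod 𝓘(ℝ))
      (fun m ↦ TotalSpace.mk' ℝ (E := Bundle.Trivial M ℝ) m (h m (Y m) (Z m))) x := by
    exact MDifferentiableAt.clm_bundle_apply₂ (F₁ := E) (F₂ := E) hh hY hZ
  simp only [mdifferentiableAt_totalSpace] at this
  exact this.2

variable (cov : CovariantDerivative I E (TangentSpace I : M → Type _))

theorem CovariantDerivative.bilinAux_tensorial_left {h : Π x : M, TangentBilin I x} {x : M}
    (hh : BilinMDiffAt I h x) (v : TangentSpace I x) (Z : Π x : M, TangentSpace I x)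
    (hZ : MDiffAt (T% Z) x) : TensorialAt I E (fun Y => cov.bilinAux h x v Y Z) x where
  smul {f Y} hf hY := by
    simp [bilinAux, mvfderiv_fun_mul hf (hh.apply hY hZ),
      cov.isCovariantDerivativeOn.leibniz hY hf]
    ring
  add {Y Y'} hY hY' := by
    simp [bilinAux, mvfderiv_fun_add (hh.apply hY hZ) (hh.apply hY' hZ),
      cov.isCovariantDerivativeOn.add hY hY']
    ring

theorem CovariantDerivative.bilinAux_tensorial_right {h : Π x : M, TangentBilin I x} {x : M}
    (hh : BilinMDiffAt I h x) (v : TangentSpace I x) (Y : Π x : M, TangentSpace I x)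
    (hY : MDiffAt (T% Y) x) : TensorialAt I E (fun Z => cov.bilinAux h x v Y Z) x where
  smul {f Z} hf hZ := by
    simp [bilinAux, mvfderiv_fun_mul hf (hh.apply hY hZ),
      cov.isCovariantDerivativeOn.leibniz hZ hf]
    ring
  add {Z Z'} hZ hZ' := by
    simp [bilinAux, mvfderiv_fun_add (hh.apply hY hZ) (hh.apply hY hZ'),
      cov.isCovariantDerivativeOn.add hZ hZ']
    ring

variable [FiniteDimensional ℝ E]

open scoped Classical in
/-- The bilinear form `(Y, Z) ↦ v(h(Y, Z)) - h(∇_v Y, Z) - h(Y, ∇_v Z)` at `x`; the irrelevant value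
`0` is chosen if `h` is not differentiable at `x`. -/
def CovariantDerivative.bilinDeriv (h : Π x : M, TangentBilin I x) (x : M)
    (v : TangentSpace I x) : TangentBilin I x :=
  if hh : BilinMDiffAt I h x then
    TensorialAt.mkHom₂ (cov.bilinAux h x v) x (fun Z hZ => cov.bilinAux_tensorial_left hh v Z hZ)
      (fun Y hY => cov.bilinAux_tensorial_right hh v Y hY)
  else 0

theorem CovariantDerivative.bilinDeriv_apply {h : Π x : M, TangentBilin I x} {x : M}
    (hh : BilinMDiffAt I h x) (v : TangentSpace I x) {Y Z : Π x : M, TangentSpace I x}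
    (hY : MDiffAt (T% Y) x) (hZ : MDiffAt (T% Z) x) :
    cov.bilinDeriv h x v (Y x) (Z x) =
      mvfderiv I (fun y => h y (Y y) (Z y)) x v - h x (cov Y x v) (Z x) - h x (Y x) (cov Z x v) := by
  rw [bilinDeriv, dif_pos hh]
  exact TensorialAt.mkHom₂_apply _ _ hY hZ

theorem CovariantDerivative.bilinDeriv_eq_extend {h : Π x : M, TangentBilin I x} {x : M}
    (hh : BilinMDiffAt I h x) (v y z : TangentSpace I x) :
    cov.bilinDeriv h x v y z =
      cov.bilinAux h x v (FiberBundle.extend E y) (FiberBundle.extend E z) := by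
  rw [bilinDeriv, dif_pos hh]
  exact TensorialAt.mkHom₂_apply_eq_extend _ _ y z

/-- The connection induced on `T*M ⊗ T*M` by a connection `∇` on `M`:
`(∇_v h)(Y, Z) = v(h(Y, Z)) - h(∇_v Y, Z) - h(Y, ∇_v Z)`. -/
def CovariantDerivative.bilin :
    CovariantDerivative I (E →L[ℝ] E →L[ℝ] ℝ) (fun x : M => TangentBilin I x) where
  toFun h x :=
    haveI : FiniteDimensional ℝ (TangentSpace I x) := inferInstanceAs (FiniteDimensional ℝ E)
    haveI : T2Space (TangentSpace I x) := inferInstanceAs (T2Space E)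
    LinearMap.toContinuousLinearMap
    { toFun := cov.bilinDeriv h x
      map_add' v w := by
        by_cases hh : BilinMDiffAt I h x
        · ext y z
          simp only [_root_.add_apply, cov.bilinDeriv_eq_extend hh, bilinAux, map_add]
          ring
        · simp [bilinDeriv, hh]
      map_smul' c v := by
        by_cases hh : BilinMDiffAt I h x
        · ext y z
          simp only [_root_.smul_apply, cov.bilinDeriv_eq_extend hh, bilinAux, map_smul,
            smul_eq_mul, RingHom.id_apply]
          ring
        · simp [bilinDeriv, hh] }
  isCovariantDerivativeOnUniv :=
    { add := by
        intro h h' x hh hh' _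
        replace hh : BilinMDiffAt I h x := hh
        replace hh' : BilinMDiffAt I h' x := hh'
        have hs : BilinMDiffAt I (h + h') x := mdifferentiableAt_add_section hh hh'
        ext v y z
        have hy := FiberBundle.mdifferentiableAt_extend I E y
        have hz := FiberBundle.mdifferentiableAt_extend I E z
        change cov.bilinDeriv (h + h') x v y z = cov.bilinDeriv h x v y z + cov.bilinDeriv h' x v y z
        rw [cov.bilinDeriv_eq_extend hs, cov.bilinDeriv_eq_extend hh, cov.bilinDeriv_eq_extend hh']
        simp [bilinAux, mvfderiv_fun_add (hh.apply hy hz) (hh'.apply hy hz)]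
        ring
      leibniz := by
        intro h g x hh hg _
        replace hh : BilinMDiffAt I h x := hh
        have hs : BilinMDiffAt I (g • h) x := hg.smul_section hh
        ext v y z
        have hy := FiberBundle.mdifferentiableAt_extend I E y
        have hz := FiberBundle.mdifferentiableAt_extend I E z
        change cov.bilinDeriv (g • h) x v y z
          = g x * cov.bilinDeriv h x v y z + mvfderiv I g x v * h x y z
        rw [cov.bilinDeriv_eq_extend hs, cov.bilinDeriv_eq_extend hh]
        set Y := FiberBundle.extend E y with hY
        set Z := FiberBundle.extend E z with hZ
        have e : mvfderiv I (fun y => (g • h) y (Y y) (Z y)) x v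
            = g x * mvfderiv I (fun y => h y (Y y) (Z y)) x v
              + h x (Y x) (Z x) * mvfderiv I g x v :=
          congr($(mvfderiv_fun_mul hg (hh.apply hy hz)) v)
        have e' : cov.bilinAux (g • h) x v Y Z
            = mvfderiv I (fun y => (g • h) y (Y y) (Z y)) x v
              - g x * h x (cov Y x v) (Z x) - g x * h x (Y x) (cov Z x v) := rfl
        rw [e', e, bilinAux]
        simp only [hY, hZ, FiberBundle.extend_apply_self]
        ring }

theorem CovariantDerivative.bilin_apply {h : Π x : M, TangentBilin I x} {x : M}
    (hh : BilinMDiffAt I h x) (v : TangentSpace I x) {Y Z : Π x : M, TangentSpace I x}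
    (hY : MDiffAt (T% Y) x) (hZ : MDiffAt (T% Z) x) :
    cov.bilin h x v (Y x) (Z x) =
      mvfderiv I (fun y => h y (Y y) (Z y)) x v - h x (cov Y x v) (Z x) - h x (Y x) (cov Z x v) :=
  cov.bilinDeriv_apply hh v hY hZ

/-- The terminal subset of the derived flag of the bundle of symmetric covariant two-tensors with
the connection induced by `∇`. -/
def CovariantDerivative.maximalFlatSubset (x : M) : Set (TangentBilin I x) :=
  cov.bilin.terminalSubset (symmetricForms I) x

/-- `∇` is regular: the terminal subset of the derived flag is a vector bundle over `M`. -/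
def CovariantDerivative.IsRegular : Prop :=
  ∀ x : M, IsSubbundleAt I (E →L[ℝ] E →L[ℝ] ℝ) cov.maximalFlatSubset x

/-- On the open set `U`, the two-tensor `g` is a smooth Riemannian metric that is parallel with
respect to `∇`. -/
structure CovariantDerivative.IsParallelMetricOn (g : Π x : M, TangentBilin I x) (U : Set M) :
    Prop where
  smooth : SmoothSectionOn I (E →L[ℝ] E →L[ℝ] ℝ) g U
  symm : ∀ x ∈ U, ∀ v w, g x v w = g x w v
  pos : ∀ x ∈ U, ∀ v, v ≠ 0 → 0 < g x v v
  parallel : ∀ x ∈ U, cov.bilin g x = 0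

/-- `∇` is metric: there is a parallel metric on `M`. -/
def CovariantDerivative.IsMetric : Prop :=
  ∃ g : Π x : M, TangentBilin I x, cov.IsParallelMetricOn g univ

/-- `∇` is locally metric: every point has a neighbourhood with a parallel metric. -/
def CovariantDerivative.IsLocallyMetric : Prop :=
  ∀ x : M, ∃ (U : Set M) (g : Π x : M, TangentBilin I x),
    IsOpen U ∧ x ∈ U ∧ cov.IsParallelMetricOn g U

end Metric

end

/-! A parallel symmetric form lies in every step of the derived flag, hence in the terminal subset
`W̃` (`mem_terminalSubset_of_parallel`). Conversely, where `W̃` is a subbundle, the induced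
connection preserves it (`mem_span_of_terminalSubset_eq`). The delicate point is that the flag
becomes stationary at an index depending on the point; a Baire argument finds enough open sets on
which one index serves.

Since `W̃` lies in the kernel of the curvature, the connection restricted to `W̃` is flat. In a
chart and a frame of `W̃`, parallel sections are the solutions of `df = -Ω f`, where `dΩ + Ω ∧ Ω =
0` (`connectionForm_flat`), and the Frobenius theorem `exists_solution_of_flat` solves this equation
for every initial value. So `W̃` is a local system: its rank is constant because `M` is connected,
and it has no monodromy because `M` is simply connected. Every element of a fibre of `W̃` is
therefore the value of a global parallel section (`exists_section_of_localSystem`,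
`exists_isGlobalParallel`).

Fix a point `x₀`. The value there of a local parallel metric is a positive definite element of `W̃`.
Parallel transport preserves the values `h(v, v)` of a parallel form, so a parallel form that is
positive definite at one point is so everywhere (`pos_of_parallel`), and the global extension is a
metric. As positive definiteness is an open condition, the fibre of `W̃` at `x₀` has a basis of
positive definite forms. Their extensions are `r` parallel metrics, independent at every point
because a global parallel section with one zero vanishes identically (`IsGlobalParallel.eq_zero`).
-/

set_option linter.unusedSectionVars false

/-! ### Linear ordinary differential equations with small coefficients -/

section LinearODE

variable {G : Type*} [NormedAddCommGroup G] [NormedSpace ℝ G]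

/-- A linear differential equation on `[0, 1]` with small coefficients has a solution for each
initial value, and the solution stays close to the initial value. -/
theorem exists_linearODE_solution [CompleteSpace G] (A : ℝ → G →L[ℝ] G)
    (hA : ContinuousOn A (Icc 0 1)) (hbound : ∀ t ∈ Icc (0 : ℝ) 1, ‖A t‖ ≤ 1 / 4) (a : G) :
    ∃ v : ℝ → G, v 0 = a ∧
      (∀ t ∈ Icc (0 : ℝ) 1, HasDerivWithinAt v (A t (v t)) (Icc 0 1) t) ∧
      ∀ t ∈ Icc (0 : ℝ) 1, ‖v t - a‖ ≤ ‖a‖ / 2 := by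
  -- Vectors in the ball of radius `‖a‖` around `a` have norm at most `2‖a‖`, so the field is
  -- bounded there by `‖a‖ / 2` and a solution cannot leave the ball within unit time.
  have hpl : IsPicardLindelof (fun t x => A t x) (tmin := 0) (tmax := 1)
      ⟨0, by simp⟩ a ‖a‖₊ 0 (‖a‖₊ / 2) 1 := by
    refine ⟨fun t ht => ?_, fun x _ => hA.clm_apply continuousOn_const, fun t ht x hx => ?_, ?_⟩
    · refine ((A t).lipschitz.weaken ?_).lipschitzOnWith
      exact_mod_cast (hbound t ht).trans (by norm_num)
    · have h1 : ‖x‖ ≤ 2 * ‖a‖ := by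
        have h2 := norm_sub_norm_le x a
        have h3 : ‖x - a‖ ≤ ‖a‖ := by simpa [dist_eq_norm] using hx
        linarith
      have h4 := (A t).le_opNorm x
      have h5 : ‖A t‖ * ‖x‖ ≤ 1 / 4 * (2 * ‖a‖) :=
        mul_le_mul (hbound t ht) h1 (norm_nonneg _) (by norm_num)
      have : ((‖a‖₊ / 2 : NNReal) : ℝ) = ‖a‖ / 2 := by simp
      rw [this]
      linarith
    · have : ((‖a‖₊ / 2 : NNReal) : ℝ) = ‖a‖ / 2 := by simp
      rw [this]
      simp
  obtain ⟨v, hv0, hv⟩ := hpl.exists_eq_forall_mem_Icc_hasDerivWithinAt₀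
  have hv0 : v 0 = a := hv0
  refine ⟨v, hv0, hv, ?_⟩
  have hcont : ContinuousOn v (Icc 0 1) := fun t ht => (hv t ht).continuousWithinAt
  have hderiv : ∀ t ∈ Ico (0 : ℝ) 1, HasDerivWithinAt (fun s => v s - a) (A t (v t)) (Ici t) t := by
    intro t ht
    exact ((hv t ⟨ht.1, ht.2.le⟩).mono_of_mem_nhdsWithin
      (Filter.mem_of_superset (Icc_mem_nhdsGE ht.2) (Icc_subset_Icc_left ht.1))).sub_const a
  -- From `‖A v‖ ≤ (‖v - a‖ + ‖a‖) / 4`, Grönwall gives `‖v t - a‖ ≤ ‖a‖ (exp (t / 4) - 1)`. The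
  -- resulting bound `‖a‖ / 2` keeps solutions with `a ≠ 0` away from zero.
  have key := norm_le_gronwallBound_of_norm_deriv_right_le (f := fun s => v s - a) (δ := 0)
    (K := 1 / 4) (ε := ‖a‖ / 4) (hcont.sub continuousOn_const) hderiv (by simp [hv0]) (by
      intro t ht
      have h1 := (A t).le_opNorm (v t)
      have h2 : ‖v t‖ ≤ ‖v t - a‖ + ‖a‖ := by simpa using norm_add_le (v t - a) a
      have h3 := mul_le_mul (hbound t ⟨ht.1, ht.2.le⟩) h2 (norm_nonneg _) (by norm_num)
      linarith)
  intro t ht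
  refine (key t ht).trans ?_
  rw [gronwallBound_of_K_ne_0 (by norm_num)]
  have he : Real.exp (1 / 4 * (t - 0)) ≤ 3 / 2 := by
    have h1 : Real.exp (1 / 4 * (t - 0)) ≤ Real.exp (1 / 4) :=
      Real.exp_le_exp.2 (by linarith [ht.2])
    have h2 := Real.exp_bound_div_one_sub_of_interval (x := 1 / 4) (by norm_num) (by norm_num)
    exact h1.trans (h2.trans (by norm_num))
  have : (‖a‖ / 4 / (1 / 4)) = ‖a‖ := by ring
  rw [this]
  nlinarith [norm_nonneg a]

end LinearODE

/-! ### Frobenius theorem for flat linear total differential equations -/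

section Frobenius

set_option maxSynthPendingDepth 3

variable {E : Type*} [NormedAddCommGroup E] [NormedSpace ℝ E]
  {G : Type*} [NormedAddCommGroup G] [NormedSpace ℝ G]

theorem hasFDerivAt_of_norm_sub_le_sq {f : E → G} {f' : E →L[ℝ] G} {x : E} {C δ : ℝ} (hδ : 0 < δ)
    (h : ∀ y, ‖y - x‖ < δ → ‖f y - f x - f' (y - x)‖ ≤ C * ‖y - x‖ ^ 2) : HasFDerivAt f f' x := by
  rw [hasFDerivAt_iff_isLittleO]
  have hO : (fun y => f y - f x - f' (y - x)) =O[𝓝 x] fun y => ‖y - x‖ ^ 2 := by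
    refine Asymptotics.IsBigO.of_bound C ?_
    filter_upwards [Metric.ball_mem_nhds x hδ] with y hy
    simpa using h y (by simpa [dist_eq_norm] using hy)
  refine hO.trans_isLittleO ?_
  have : Filter.Tendsto (fun y => ‖y - x‖) (𝓝 x) (𝓝 0) := by
    have : Continuous fun y => ‖y - x‖ := by fun_prop
    simpa using this.tendsto x
  have h2 : (fun y => ‖y - x‖ * ‖y - x‖) =o[𝓝 x] fun y => (1 : ℝ) * ‖y - x‖ :=
    ((Asymptotics.isLittleO_one_iff ℝ).2 this).mul_isBigO (Asymptotics.isBigO_refl _ _)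
  simpa [sq] using h2.norm_right

/-- The difference between a parallel section along a ray, corrected to first order in `h`, and a
parallel section along the ray through `x + h`: algebraic form. -/
theorem norm_flat_defect_le {Ω Ω' : E →L[ℝ] G →L[ℝ] G} {D : E →L[ℝ] E →L[ℝ] G →L[ℝ] G} {x h : E}
    {u : G} {t C K b : ℝ} (hC : 0 ≤ C) (ht : t ∈ Icc (0 : ℝ) 1)
    (hΩ : ‖Ω‖ ≤ C) (hD : ‖D‖ ≤ C) (hK : ‖Ω' - Ω - t • D h‖ ≤ K * ‖h‖ ^ 2)
    (hx : ‖x + h‖ ≤ 1) (hh : ‖h‖ ≤ 1) (hu : ‖u‖ ≤ b)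
    (hflat : D x h - D h x + (Ω x).comp (Ω h) - (Ω h).comp (Ω x) = 0) :
    ‖-(Ω x u) - (Ω h u + t • (D x h u + Ω h (-(Ω x u)))) + Ω' (x + h) (u - t • Ω h u)‖
      ≤ (K * (1 + C) + C + C * C + C * C) * b * ‖h‖ ^ 2 := by
  have hb : 0 ≤ b := (norm_nonneg u).trans hu
  have hK0 : 0 ≤ K * ‖h‖ ^ 2 := (norm_nonneg _).trans hK
  -- Flatness trades `D x h` for `D h x`, so that only derivatives of the form in the small
  -- direction `h` remain.
  have hfl : D x h u = D h x u - Ω x (Ω h u) + Ω h (Ω x u) := by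
    have := congrArg (fun T : G →L[ℝ] G => T u) hflat
    simp at this
    linear_combination (norm := module) this
  -- The terms of first order in `h` have cancelled: the first summand contains the Taylor remainder
  -- of `Ω`, the other three contain `h` twice.
  have e : -(Ω x u) - (Ω h u + t • (D x h u + Ω h (-(Ω x u)))) + Ω' (x + h) (u - t • Ω h u)
      = (Ω' - Ω - t • D h) (x + h) (u - t • Ω h u) + t • D h h u - t • Ω h (Ω h u)
        - (t * t) • D h (x + h) (Ω h u) := by
    rw [hfl]
    simp only [map_add, map_sub, map_neg, map_smul, _root_.add_apply, _root_.sub_apply,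
      _root_.smul_apply, smul_add, smul_sub, smul_neg, mul_smul]
    module
  have hht : |t| ≤ 1 := by rw [abs_of_nonneg ht.1]; exact ht.2
  have n1 : ‖Ω h u‖ ≤ C * ‖h‖ * b := by
    calc _ ≤ ‖Ω h‖ * ‖u‖ := (Ω h).le_opNorm u
      _ ≤ (C * ‖h‖) * b := by
        gcongr
        exact (Ω.le_opNorm h).trans (by gcongr)
  have n2 : ‖u - t • Ω h u‖ ≤ (1 + C) * b := by
    calc _ ≤ ‖u‖ + |t| * ‖Ω h u‖ := by simpa [norm_smul] using norm_sub_le u (t • Ω h u)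
      _ ≤ b + 1 * (C * 1 * b) := by
        gcongr
        exact n1.trans (by gcongr)
      _ = _ := by ring
  have t1 : ‖(Ω' - Ω - t • D h) (x + h) (u - t • Ω h u)‖ ≤ K * ‖h‖ ^ 2 * 1 * ((1 + C) * b) := by
    calc _ ≤ ‖(Ω' - Ω - t • D h) (x + h)‖ * ‖u - t • Ω h u‖ := ContinuousLinearMap.le_opNorm _ _
      _ ≤ _ := by
        gcongr
        exact (ContinuousLinearMap.le_opNorm _ _).trans (by gcongr)
  have nD : ∀ y : E, ‖D h y‖ ≤ C * ‖h‖ * ‖y‖ := fun y =>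
    ((D h).le_opNorm y).trans (by gcongr; exact (D.le_opNorm h).trans (by gcongr))
  have t2 : ‖t • D h h u‖ ≤ C * ‖h‖ * ‖h‖ * b := by
    rw [norm_smul]
    calc _ ≤ 1 * (‖D h h‖ * ‖u‖) := by gcongr; exacts [hht, ContinuousLinearMap.le_opNorm _ _]
      _ ≤ _ := by rw [one_mul]; gcongr; exact nD h
  have t3 : ‖t • Ω h (Ω h u)‖ ≤ C * ‖h‖ * (C * ‖h‖ * b) := by
    rw [norm_smul]
    calc _ ≤ 1 * (‖Ω h‖ * ‖Ω h u‖) := by gcongr; exacts [hht, ContinuousLinearMap.le_opNorm _ _]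
      _ ≤ _ := by rw [one_mul]; gcongr; exact (Ω.le_opNorm h).trans (by gcongr)
  have t4 : ‖(t * t) • D h (x + h) (Ω h u)‖ ≤ C * ‖h‖ * 1 * (C * ‖h‖ * b) := by
    rw [norm_smul]
    have : ‖t * t‖ ≤ 1 := by
      rw [norm_mul]; exact mul_le_one₀ hht (abs_nonneg _) hht
    calc _ ≤ 1 * (‖D h (x + h)‖ * ‖Ω h u‖) := by
          gcongr; exact ContinuousLinearMap.le_opNorm _ _
      _ ≤ _ := by rw [one_mul]; gcongr; exact (nD _).trans (by gcongr)
  rw [e]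
  calc _ ≤ ‖(Ω' - Ω - t • D h) (x + h) (u - t • Ω h u)‖ + ‖t • D h h u‖ + ‖t • Ω h (Ω h u)‖
        + ‖(t * t) • D h (x + h) (Ω h u)‖ :=
      (norm_sub_le _ _).trans (by gcongr; exact (norm_sub_le _ _).trans (by
        gcongr; exact norm_add_le _ _))
    _ ≤ K * ‖h‖ ^ 2 * 1 * ((1 + C) * b) + C * ‖h‖ * ‖h‖ * b + C * ‖h‖ * (C * ‖h‖ * b)
        + C * ‖h‖ * 1 * (C * ‖h‖ * b) := by gcongr
    _ = _ := by ring

/-- The mean value inequality on the segment from `p` to `q`, along which the derivative moves by at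
most `K ‖q - p‖`. It supplies the Taylor remainder in `norm_flat_defect_le`. -/
theorem norm_sub_sub_fderiv_le {F : Type*} [NormedAddCommGroup F] [NormedSpace ℝ F] {f : E → F}
    {z₀ : E} {δ : ℝ} {K : NNReal} (hf : DifferentiableOn ℝ f (Metric.ball z₀ δ))
    (hK : LipschitzOnWith K (fderiv ℝ f) (Metric.ball z₀ δ)) {p q : E}
    (hp : p ∈ Metric.ball z₀ δ) (hq : q ∈ Metric.ball z₀ δ) :
    ‖f q - f p - fderiv ℝ f p (q - p)‖ ≤ K * ‖q - p‖ ^ 2 := by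
  have hseg : segment ℝ p q ⊆ Metric.ball z₀ δ := (convex_ball z₀ δ).segment_subset hp hq
  have := (convex_segment p q).norm_image_sub_le_of_norm_hasFDerivWithin_le' (f := f)
    (f' := fderiv ℝ f) (φ := fderiv ℝ f p) (C := K * ‖q - p‖) (x := p) (y := q)
    (fun z hz => ((hf z (hseg hz)).differentiableAt
      (Metric.isOpen_ball.mem_nhds (hseg hz))).hasFDerivAt.hasFDerivWithinAt)
    (fun z hz => ?_) (left_mem_segment ℝ p q) (right_mem_segment ℝ p q)
  · linarith [this, sq (‖q - p‖), mul_assoc (K : ℝ) ‖q - p‖ ‖q - p‖]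
  · refine (hK.norm_sub_le (hseg hz) hp).trans ?_
    gcongr
    obtain ⟨t, ht, rfl⟩ := (segment_eq_image' ℝ p q ▸ hz : z ∈ _)
    rw [add_sub_cancel_left, norm_smul, Real.norm_eq_abs, abs_of_nonneg ht.1]
    exact mul_le_of_le_one_left (norm_nonneg _) ht.2

/-- Solutions along rays of a flat linear total differential equation solve the equation. -/
theorem hasFDerivAt_of_flat_rays {Ω : E → E →L[ℝ] G →L[ℝ] G} {z₀ : E} {δ C : ℝ} {K : NNReal}
    (hC : 0 ≤ C) (hδ : δ ≤ 1) (hCδ : C * δ ≤ 1 / 4)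
    (hΩ : DifferentiableOn ℝ Ω (Metric.ball z₀ δ))
    (hK : LipschitzOnWith K (fderiv ℝ Ω) (Metric.ball z₀ δ))
    (hΩC : ∀ z ∈ Metric.ball z₀ δ, ‖Ω z‖ ≤ C) (hDC : ∀ z ∈ Metric.ball z₀ δ, ‖fderiv ℝ Ω z‖ ≤ C)
    (hflat : ∀ z ∈ Metric.ball z₀ δ, ∀ v w, fderiv ℝ Ω z v w - fderiv ℝ Ω z w v
      + (Ω z v).comp (Ω z w) - (Ω z w).comp (Ω z v) = 0)
    {a : G} {u : E → ℝ → G} (hu0 : ∀ x ∈ Metric.ball (0 : E) δ, u x 0 = a)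
    (hu : ∀ x ∈ Metric.ball (0 : E) δ, ∀ t ∈ Icc (0 : ℝ) 1,
      HasDerivWithinAt (u x) (-(Ω (z₀ + t • x) x (u x t))) (Icc 0 1) t)
    (hub : ∀ x ∈ Metric.ball (0 : E) δ, ∀ t ∈ Icc (0 : ℝ) 1, ‖u x t‖ ≤ 2 * ‖a‖)
    {z : E} (hz : z ∈ Metric.ball z₀ δ) :
    HasFDerivAt (fun z => u (z - z₀) 1) (-(Ω z).flip (u (z - z₀) 1)) z := by
  set x := z - z₀ with hxdef
  have hx : ‖x‖ < δ := by simpa [dist_eq_norm] using hz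
  have hmem : ∀ y : E, ‖y‖ < δ → ∀ t ∈ Icc (0 : ℝ) 1, z₀ + t • y ∈ Metric.ball z₀ δ := by
    intro y hy t ht
    rw [Metric.mem_ball, dist_eq_norm, add_sub_cancel_left, norm_smul, Real.norm_eq_abs,
      abs_of_nonneg ht.1]
    exact (mul_le_of_le_one_left (norm_nonneg _) ht.2).trans_lt hy
  have hIci : ∀ {f : ℝ → G} {f' : G} {t : ℝ}, t ∈ Ico (0 : ℝ) 1 →
      HasDerivWithinAt f f' (Icc 0 1) t → HasDerivWithinAt f f' (Ici t) t := fun ht h =>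
    h.mono_of_mem_nhdsWithin
      (Filter.mem_of_superset (Icc_mem_nhdsGE ht.2) (Icc_subset_Icc_left ht.1))
  refine hasFDerivAt_of_norm_sub_le_sq (δ := δ - ‖x‖)
    (C := (K * (1 + C) + C + C * C + C * C) * (2 * ‖a‖) * (Real.exp 1 - 1)) (by linarith)
    fun y hy => ?_
  set h := y - z with hh
  have hyx : y - z₀ = x + h := by rw [hh, hxdef]; abel
  have hxh : ‖x + h‖ < δ := (norm_add_le _ _).trans_lt (by linarith)
  have hx' : x ∈ Metric.ball (0 : E) δ := by simpa using hx
  have hxh' : x + h ∈ Metric.ball (0 : E) δ := by simpa using hxh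
  set ε := (K * (1 + C) + C + C * C + C * C) * (2 * ‖a‖) * ‖h‖ ^ 2 with hε
  -- First-order prediction of the solution along the ray through `x + h`; at `t = 1` it is `u x 1`
  -- plus the candidate derivative applied to `h`. It satisfies the equation of that ray up to the
  -- error `ε = O(‖h‖ ^ 2)`, so Grönwall bounds its distance from `u (x + h)`.
  let w : ℝ → G := fun t => u x t - t • Ω (z₀ + t • x) h (u x t)
  let w' : ℝ → G := fun t => -(Ω (z₀ + t • x) x (u x t)) - (Ω (z₀ + t • x) h (u x t) +
    t • (fderiv ℝ Ω (z₀ + t • x) x h (u x t)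
      + Ω (z₀ + t • x) h (-(Ω (z₀ + t • x) x (u x t)))))
  have hw : ∀ t ∈ Icc (0 : ℝ) 1, HasDerivWithinAt w (w' t) (Icc 0 1) t := by
    intro t ht
    have hγ : HasDerivWithinAt (fun t : ℝ => z₀ + t • x) x (Icc 0 1) t := by
      simpa using (((hasDerivAt_id t).smul_const x).const_add z₀).hasDerivWithinAt
    have hΩt : HasDerivWithinAt (fun t : ℝ => Ω (z₀ + t • x)) (fderiv ℝ Ω (z₀ + t • x) x)
        (Icc 0 1) t :=
      ((hΩ _ (hmem x hx t ht)).differentiableAt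
        (Metric.isOpen_ball.mem_nhds (hmem x hx t ht))).hasFDerivAt.comp_hasDerivWithinAt t hγ
    have hΩh : HasDerivWithinAt (fun t : ℝ => Ω (z₀ + t • x) h)
        (fderiv ℝ Ω (z₀ + t • x) x h) (Icc 0 1) t := by
      simpa using hΩt.clm_apply (hasDerivWithinAt_const t _ h)
    have h1 := (hasDerivWithinAt_id t (Icc (0 : ℝ) 1)).smul (hΩh.clm_apply (hu x hx' t ht))
    refine ((hu x hx' t ht).sub h1).congr_deriv ?_
    simp only [w', id, one_smul]
    abel
  -- The field is set to zero outside `[0, 1]` because the Lipschitz bound is required at all times.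
  -- The constant `1` is generous, as `C * δ ≤ 1 / 4`.
  have key := dist_le_of_approx_trajectories_ODE (a := 0) (b := 1)
    (v := fun t p => if t ∈ Icc (0 : ℝ) 1 then -(Ω (z₀ + t • (x + h)) (x + h) p) else 0)
    (K := 1) (f := u (x + h)) (f' := fun t => -(Ω (z₀ + t • (x + h)) (x + h) (u (x + h) t)))
    (g := w) (g' := w') (εf := 0) (εg := ε) (δ := 0) (fun t => ?_)
    (fun t ht => (hu _ hxh' t ht).continuousWithinAt)
    (fun t ht => hIci ht (hu _ hxh' t ⟨ht.1, ht.2.le⟩)) (fun t ht => ?_)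
    (fun t ht => (hw t ht).continuousWithinAt) (fun t ht => hIci ht (hw t ⟨ht.1, ht.2.le⟩))
    (fun t ht => ?_) (by simp [w, hu0 _ hx', hu0 _ hxh']) 1 (by simp)
  · rw [gronwallBound_of_K_ne_0 (by norm_num)] at key
    simp only [NNReal.coe_one, sub_zero, mul_one, zero_mul, zero_add, div_one] at key
    rw [hyx]
    have e : u (x + h) 1 - u x 1 - (-(Ω z).flip (u x 1)) h = u (x + h) 1 - w 1 := by
      simp [w, hxdef]
      abel
    rw [e, ← dist_eq_norm]
    refine key.trans (le_of_eq ?_)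
    rw [hε]
    ring
  · by_cases ht : t ∈ Icc (0 : ℝ) 1
    · simp only [if_pos ht]
      refine (((Ω (z₀ + t • (x + h)) (x + h)).lipschitz.weaken ?_).neg)
      have : ‖Ω (z₀ + t • (x + h)) (x + h)‖ ≤ 1 := by
        refine ((Ω (z₀ + t • (x + h))).le_opNorm _).trans ?_
        have := mul_le_mul (hΩC _ (hmem _ hxh t ht)) hxh.le (norm_nonneg _) hC
        linarith
      exact_mod_cast this
    · simp only [if_neg ht]
      exact LipschitzWith.const' 0
  · simp [show t ∈ Icc (0 : ℝ) 1 from ⟨ht.1, ht.2.le⟩]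
  · have ht' : t ∈ Icc (0 : ℝ) 1 := ⟨ht.1, ht.2.le⟩
    rw [if_pos ht', dist_eq_norm, sub_neg_eq_add]
    have hpx := hmem x hx t ht'
    have hpy := hmem _ hxh t ht'
    refine norm_flat_defect_le (b := 2 * ‖a‖) hC ht' (hΩC _ hpx) (hDC _ hpx) ?_
      (hxh.le.trans hδ) ?_ (hub x hx' t ht') (hflat _ hpx x h)
    · have := norm_sub_sub_fderiv_le hΩ hK hpx hpy
      have e : z₀ + t • (x + h) - (z₀ + t • x) = t • h := by rw [smul_add]; abel
      rw [e, map_smul] at this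
      refine this.trans ?_
      rw [norm_smul, Real.norm_eq_abs, abs_of_nonneg ht'.1]
      gcongr
      · exact mul_nonneg ht'.1 (norm_nonneg h)
      · exact mul_le_of_le_one_left (norm_nonneg h) ht'.2
    · linarith [norm_nonneg x]

/-- Bootstrapping: if `f` is `C^n`, then so is its derivative `-Ω f`, hence `f` is `C^(n+1)`. -/
theorem contDiffOn_of_hasFDerivAt_linear {Ω : E → E →L[ℝ] G →L[ℝ] G} {V : Set E} (hV : IsOpen V)
    (hΩ : ContDiffOn ℝ ∞ Ω V) {f : E → G}
    (hf : ∀ z ∈ V, HasFDerivAt f (-(Ω z).flip (f z)) z) : ContDiffOn ℝ ∞ f V := by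
  rw [contDiffOn_infty]
  intro n
  induction n with
  | zero =>
    exact contDiffOn_zero.2 fun z hz => (hf z hz).continuousAt.continuousWithinAt
  | succ n ih =>
    have hflip : ContDiffOn ℝ n (fun z => -(Ω z).flip (f z)) V := by
      have h1 : ContDiffOn ℝ n (fun z => (Ω z).flip) V :=
        (ContinuousLinearMap.flipₗᵢ ℝ E G G).contDiff.comp_contDiffOn
          (hΩ.of_le (by exact_mod_cast le_top))
      exact (h1.clm_apply ih).neg
    rw [Nat.cast_succ]
    refine (contDiffOn_succ_iff_fderiv_of_isOpen hV).2
      ⟨fun z hz => (hf z hz).differentiableAt.differentiableWithinAt, ?_, ?_⟩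
    · exact fun hω => absurd hω (WithTop.coe_ne_top (a := ((n : ℕ) : ℕ∞)))
    · exact hflip.congr fun z hz => (hf z hz).fderiv

/-- **Frobenius theorem** for flat linear total differential equations: the equation
`df = -Ω f` with `dΩ + Ω ∧ Ω = 0` has a local solution for each initial value. -/
theorem exists_solution_of_flat [CompleteSpace G] {Ω : E → E →L[ℝ] G →L[ℝ] G} {U : Set E}
    {z₀ : E} (hU : IsOpen U) (hz₀ : z₀ ∈ U) (hΩ : ContDiffOn ℝ ∞ Ω U)
    (hflat : ∀ z ∈ U, ∀ v w, fderiv ℝ Ω z v w - fderiv ℝ Ω z w v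
      + (Ω z v).comp (Ω z w) - (Ω z w).comp (Ω z v) = 0) (a : G) :
    ∃ (V : Set E) (f : E → G), IsOpen V ∧ z₀ ∈ V ∧ V ⊆ U ∧ f z₀ = a ∧ ContDiffOn ℝ ∞ f V ∧
      ∀ z ∈ V, HasFDerivAt f (-(Ω z).flip (f z)) z := by
  have hat : ContDiffAt ℝ ∞ Ω z₀ := hΩ.contDiffAt (hU.mem_nhds hz₀)
  obtain ⟨K, s, hs, hK⟩ :=
    ((hat.fderiv_right (m := 1) (by norm_cast)).exists_lipschitzOnWith)
  have hcD : ContinuousAt (fderiv ℝ Ω) z₀ :=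
    (hat.fderiv_right (m := 0) (by norm_cast)).continuousAt
  set C := max (‖Ω z₀‖ + 1) (‖fderiv ℝ Ω z₀‖ + 1) with hCdef
  have hC : 0 ≤ C := le_max_of_le_left (by positivity)
  have ev1 : ∀ᶠ z in 𝓝 z₀, ‖Ω z‖ ≤ C :=
    (hat.continuousAt.norm.eventually_lt_const (lt_add_one _)).mono fun z hz =>
      hz.le.trans (le_max_left _ _)
  have ev2 : ∀ᶠ z in 𝓝 z₀, ‖fderiv ℝ Ω z‖ ≤ C :=
    (hcD.norm.eventually_lt_const (lt_add_one _)).mono fun z hz => hz.le.trans (le_max_right _ _)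
  obtain ⟨δ₀, hδ₀, hball⟩ := Metric.eventually_nhds_iff_ball.1
    ((hU.eventually_mem hz₀).and ((Filter.eventually_mem_set.2 hs).and (ev1.and ev2)))
  -- On rays of length less than `δ` the coefficients `Ω x` have norm at most `C * δ ≤ 1 / 4`, so
  -- `exists_linearODE_solution` applies on the whole of `[0, 1]`.
  set δ := min δ₀ (min 1 (1 / (4 * (C + 1)))) with hδdef
  have hδpos : 0 < δ := by positivity
  have hδ1 : δ ≤ 1 := (min_le_right _ _).trans (min_le_left _ _)
  have hδC : C * δ ≤ 1 / 4 := by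
    have h1 : δ ≤ 1 / (4 * (C + 1)) := (min_le_right _ _).trans (min_le_right _ _)
    have h2 : C * δ ≤ C * (1 / (4 * (C + 1))) := by gcongr
    refine h2.trans ?_
    rw [mul_one_div, div_le_div_iff₀ (by positivity) (by norm_num)]
    linarith
  have hB : ∀ z ∈ Metric.ball z₀ δ, z ∈ U ∧ z ∈ s ∧ ‖Ω z‖ ≤ C ∧ ‖fderiv ℝ Ω z‖ ≤ C :=
    fun z hz => hball z (Metric.ball_subset_ball (min_le_left _ _) hz)
  have hΩd : DifferentiableOn ℝ Ω (Metric.ball z₀ δ) :=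
    (hΩ.differentiableOn (by simp)).mono fun z hz => (hB z hz).1
  have hmem : ∀ y : E, ‖y‖ < δ → ∀ t ∈ Icc (0 : ℝ) 1, z₀ + t • y ∈ Metric.ball z₀ δ := by
    intro y hy t ht
    rw [Metric.mem_ball, dist_eq_norm, add_sub_cancel_left, norm_smul, Real.norm_eq_abs,
      abs_of_nonneg ht.1]
    exact (mul_le_of_le_one_left (norm_nonneg _) ht.2).trans_lt hy
  have hex : ∀ x : E, ‖x‖ < δ → ∃ v : ℝ → G, v 0 = a ∧
      (∀ t ∈ Icc (0 : ℝ) 1, HasDerivWithinAt v (-(Ω (z₀ + t • x) x (v t))) (Icc 0 1) t) ∧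
      ∀ t ∈ Icc (0 : ℝ) 1, ‖v t - a‖ ≤ ‖a‖ / 2 := by
    intro x hx
    refine exists_linearODE_solution (fun t => -(Ω (z₀ + t • x) x)) ?_ (fun t ht => ?_) a
    · have h1 : ContinuousOn (fun t : ℝ => Ω (z₀ + t • x)) (Icc 0 1) :=
        hΩd.continuousOn.comp (by fun_prop) fun t ht => hmem x hx t ht
      exact (h1.clm_apply continuousOn_const).neg
    · rw [norm_neg]
      refine ((Ω (z₀ + t • x)).le_opNorm _).trans ?_
      exact (mul_le_mul (hB _ (hmem x hx t ht)).2.2.1 hx.le (norm_nonneg _) hC).trans hδC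
  choose! u hu0 hu hub using hex
  have hder : ∀ z ∈ Metric.ball z₀ δ,
      HasFDerivAt (fun z => u (z - z₀) 1) (-(Ω z).flip (u (z - z₀) 1)) z := fun z hz =>
    hasFDerivAt_of_flat_rays hC hδ1 hδC hΩd (hK.mono fun z hz => (hB z hz).2.1)
      (fun z hz => (hB z hz).2.2.1) (fun z hz => (hB z hz).2.2.2)
      (fun z hz => hflat z (hB z hz).1) (a := a) (u := u)
      (fun x hx => hu0 x (by simpa using hx)) (fun x hx => hu x (by simpa using hx))
      (fun x hx t ht => by
        have h1 := hub x (by simpa using hx) t ht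
        have h2 : ‖u x t‖ ≤ ‖u x t - a‖ + ‖a‖ := by simpa using norm_add_le (u x t - a) a
        linarith [norm_nonneg a]) hz
  refine ⟨Metric.ball z₀ δ, fun z => u (z - z₀) 1, Metric.isOpen_ball, Metric.mem_ball_self hδpos,
    fun z hz => (hB z hz).1, ?_, contDiffOn_of_hasFDerivAt_linear Metric.isOpen_ball
      (hΩ.mono fun z hz => (hB z hz).1) hder, hder⟩
  -- The ray to the centre is constant and its equation reads `v' = 0`, which gives the initial
  -- value.
  have h0 : ‖(0 : E)‖ < δ := by simpa using hδpos
  have := (convex_Icc (0 : ℝ) 1).norm_image_sub_le_of_norm_hasDerivWithin_le (C := 0)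
    (hu 0 h0) (by simp) (left_mem_Icc.2 zero_le_one) (right_mem_Icc.2 zero_le_one)
  simp only [zero_mul, norm_le_zero_iff, sub_eq_zero] at this
  simp only [sub_self]
  rw [this, hu0 0 h0]

end Frobenius

/-! ### Local systems on simply connected spaces -/

section Monodromy

/-- The fibre bundle with discrete fibre `K` glued from locally constant coordinate changes. -/
def discreteBundleCore {X K : Type*} [TopologicalSpace X] [TopologicalSpace K] [DiscreteTopology K]
    {T : X → Type*} (U : X → Set X) (hU : ∀ i, IsOpen (U i)) (hmem : ∀ x, x ∈ U x)
    (ψ : X → ∀ y, T y → K) (φ : X → ∀ y, K → T y)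
    (hφψ : ∀ i, ∀ y ∈ U i, ∀ t, φ i y (ψ i y t) = t)
    (hψφ : ∀ i, ∀ y ∈ U i, ∀ k, ψ i y (φ i y k) = k)
    (hloc : ∀ i j, ∀ y ∈ U i ∩ U j, ∀ k, ∀ᶠ z in 𝓝 y, ψ j z (φ i z k) = ψ j y (φ i y k)) :
    FiberBundleCore X X K where
  baseSet := U
  isOpen_baseSet := hU
  indexAt := id
  mem_baseSet_at := hmem
  coordChange i j y k := ψ j y (φ i y k)
  coordChange_self i y hy k := hψφ i y hy k
  continuousOn_coordChange i j := by
    rintro ⟨y, k⟩ ⟨hy, -⟩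
    refine ContinuousAt.continuousWithinAt ?_
    -- Since `K` is discrete, a neighbourhood of `(y, k)` may fix the second coordinate, and local
    -- constancy in the point is all that is needed.
    refine (continuousAt_const (y := ψ j y (φ i y k))).congr ?_
    rw [nhds_prod_eq, nhds_discrete K, Filter.EventuallyEq]
    refine (Filter.eventually_prod_iff).2 ⟨_, hloc i j y hy k, (· = k), by simp, ?_⟩
    rintro z hz _ rfl
    exact hz.symm
  coordChange_comp i j k y hy v := by rw [hφψ j y hy.1.2]

/-- On a simply connected space, a local system has global sections through each of its points. -/
theorem exists_section_of_localSystem {X K : Type*} [TopologicalSpace X] [SimplyConnectedSpace X]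
    [LocallyPathConnectedSpace X] {T : X → Type*} (U : X → Set X) (hU : ∀ i, IsOpen (U i))
    (hmem : ∀ x, x ∈ U x) (ψ : X → ∀ y, T y → K) (φ : X → ∀ y, K → T y)
    (hφψ : ∀ i, ∀ y ∈ U i, ∀ t, φ i y (ψ i y t) = t)
    (hψφ : ∀ i, ∀ y ∈ U i, ∀ k, ψ i y (φ i y k) = k)
    (hloc : ∀ i j, ∀ y ∈ U i ∩ U j, ∀ k, ∀ᶠ z in 𝓝 y, ψ j z (φ i z k) = ψ j y (φ i y k))
    (x₀ : X) (t₀ : T x₀) :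
    ∃ s : ∀ y, T y, s x₀ = t₀ ∧ ∀ i, ∀ y ∈ U i, ∀ᶠ z in 𝓝 y, ψ i z (s z) = ψ i y (s y) := by
  let : TopologicalSpace K := ⊥
  have : DiscreteTopology K := ⟨rfl⟩
  let Z := discreteBundleCore U hU hmem ψ φ hφψ hψφ hloc
  have hcov : IsCoveringMap (π K Z.Fiber) := FiberBundle.isCoveringMap
  -- A bundle with discrete fibre is a covering. The base is simply connected and locally path
  -- connected, so its identity map lifts through the prescribed point: a global section.
  obtain ⟨S, ⟨hS₀, hS⟩, -⟩ := hcov.existsUnique_continuousMap_lifts (ContinuousMap.id X) x₀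
    (⟨x₀, ψ x₀ x₀ t₀⟩ : Z.TotalSpace) rfl
  have hproj : ∀ y, (S y).1 = y := fun y => congrFun hS y
  let c : X → K := fun y => (S y).2
  refine ⟨fun y => φ y y (c y), ?_, fun i y hy => ?_⟩
  · have : c x₀ = ψ x₀ x₀ t₀ := by
      simp only [c]
      rw [hS₀]
    change φ x₀ x₀ (c x₀) = t₀
    rw [this, hφψ _ _ (hmem x₀)]
  · have hval : ∀ z, (Z.localTriv i (S z)).2 = ψ i z (φ z z (c z)) := by
      intro z
      rw [FiberBundleCore.localTriv_apply]
      change ψ i (S z).1 (φ (S z).1 (S z).1 (c z)) = _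
      rw [hproj]
    have hcont : ContinuousAt (fun z => (Z.localTriv i (S z)).2) y := by
      refine continuousAt_snd.comp (ContinuousAt.comp (g := Z.localTriv i) ?_ S.continuous.continuousAt)
      refine (Z.localTriv i).continuousOn.continuousAt
        ((Z.localTriv i).open_source.mem_nhds ?_)
      change (S y).1 ∈ U i
      rwa [hproj]
    -- Singletons of `K` are open, so continuity in a trivialization is local constancy.
    have := hcont.eventually_mem (s := {(Z.localTriv i (S y)).2}) (by simp)
    filter_upwards [this] with z hz
    rw [← hval, ← hval]
    exact hz

end Monodromy

/-! ### Functions and vector fields in charts, coordinate fields -/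

section Coordinates

variable {E : Type*} [NormedAddCommGroup E] [NormedSpace ℝ E]
  {M : Type*} [TopologicalSpace M] [ChartedSpace E M] [IsManifold 𝓘(ℝ, E) ∞ M]
  {G : Type*} [NormedAddCommGroup G] [NormedSpace ℝ G]

/-- The expression of a function on a manifold in the chart at `x₀`. -/
noncomputable abbrev inChart (x₀ : M) (f : M → G) : E → G := f ∘ (extChartAt 𝓘(ℝ, E) x₀).symm

omit [IsManifold 𝓘(ℝ, E) ∞ M] in
theorem mvfderiv_congr {f g : M → G} {y : M} (h : f =ᶠ[𝓝 y] g) :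
    mvfderiv 𝓘(ℝ, E) f y = mvfderiv 𝓘(ℝ, E) g y := by
  ext w
  exact congrArg (fun T => T w) (h.mfderiv_eq (I := 𝓘(ℝ, E)) (I' := 𝓘(ℝ, G)))

theorem mdifferentiableAt_inChart {f : M → G} {x₀ y : M} (hy : y ∈ (chartAt E x₀).source)
    (hf : MDifferentiableAt 𝓘(ℝ, E) 𝓘(ℝ, G) f y) :
    DifferentiableAt ℝ (inChart x₀ f) (extChartAt 𝓘(ℝ, E) x₀ y) := by
  have hy' : y ∈ (extChartAt 𝓘(ℝ, E) x₀).source := by rwa [extChartAt_source]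
  have h1 : MDifferentiableAt 𝓘(ℝ, E) 𝓘(ℝ, E) (extChartAt 𝓘(ℝ, E) x₀).symm
      (extChartAt 𝓘(ℝ, E) x₀ y) := by
    have := mdifferentiableWithinAt_extChartAt_symm (I := 𝓘(ℝ, E))
      ((extChartAt 𝓘(ℝ, E) x₀).map_source hy')
    rwa [ModelWithCorners.range_eq_univ, mdifferentiableWithinAt_univ] at this
  have h2 : MDifferentiableAt 𝓘(ℝ, E) 𝓘(ℝ, G) f
      ((extChartAt 𝓘(ℝ, E) x₀).symm (extChartAt 𝓘(ℝ, E) x₀ y)) := by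
    rwa [(extChartAt 𝓘(ℝ, E) x₀).left_inv hy']
  exact (h2.comp _ h1).differentiableAt

theorem mvfderiv_eq_fderiv_inChart {f : M → G} {x₀ y : M} (hy : y ∈ (chartAt E x₀).source)
    (hf : MDifferentiableAt 𝓘(ℝ, E) 𝓘(ℝ, G) f y) (w : TangentSpace 𝓘(ℝ, E) y) :
    mvfderiv 𝓘(ℝ, E) f y w = fderiv ℝ (inChart x₀ f) (extChartAt 𝓘(ℝ, E) x₀ y)
      (mvfderiv 𝓘(ℝ, E) (extChartAt 𝓘(ℝ, E) x₀) y w) := by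
  have hy' : y ∈ (extChartAt 𝓘(ℝ, E) x₀).source := by rwa [extChartAt_source]
  have he : f =ᶠ[𝓝 y] inChart x₀ f ∘ extChartAt 𝓘(ℝ, E) x₀ := by
    filter_upwards [(isOpen_extChartAt_source (I := 𝓘(ℝ, E)) x₀).mem_nhds hy'] with z hz
    rw [Function.comp_apply, inChart, Function.comp_apply, (extChartAt 𝓘(ℝ, E) x₀).left_inv hz]
  have h1 : mfderiv 𝓘(ℝ, E) 𝓘(ℝ, G) f y
      = mfderiv 𝓘(ℝ, E) 𝓘(ℝ, G) (inChart x₀ f ∘ extChartAt 𝓘(ℝ, E) x₀) y := he.mfderiv_eq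
  have h2 := mfderiv_comp_apply y
    (mdifferentiableAt_inChart hy hf).mdifferentiableAt (mdifferentiableAt_extChartAt hy) w
  rw [mfderiv_eq_fderiv] at h2
  exact (congrArg (fun T => T w) h1).trans h2

theorem contDiffOn_inChart {f : M → G} {U : Set M} {x₀ : M}
    (hf : ContMDiffOn 𝓘(ℝ, E) 𝓘(ℝ, G) ∞ f U) :
    ContDiffOn ℝ ∞ (inChart x₀ f)
      ((extChartAt 𝓘(ℝ, E) x₀).target ∩ (extChartAt 𝓘(ℝ, E) x₀).symm ⁻¹' U) := by
  rw [← contMDiffOn_iff_contDiffOn]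
  exact hf.comp ((contMDiffOn_extChartAt_symm x₀).mono inter_subset_left) inter_subset_right

omit [IsManifold 𝓘(ℝ, E) ∞ M] in
theorem isOpen_inChart {U : Set M} (hU : IsOpen U) (x₀ : M) :
    IsOpen ((extChartAt 𝓘(ℝ, E) x₀).target ∩ (extChartAt 𝓘(ℝ, E) x₀).symm ⁻¹' U) :=
  (continuousOn_extChartAt_symm x₀).isOpen_inter_preimage (isOpen_extChartAt_target x₀) hU

omit [IsManifold 𝓘(ℝ, E) ∞ M] in
theorem mem_inChart {U : Set M} {x₀ y : M} (hy : y ∈ (chartAt E x₀).source) (hyU : y ∈ U) :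
    extChartAt 𝓘(ℝ, E) x₀ y
      ∈ (extChartAt 𝓘(ℝ, E) x₀).target ∩ (extChartAt 𝓘(ℝ, E) x₀).symm ⁻¹' U := by
  have hy' : y ∈ (extChartAt 𝓘(ℝ, E) x₀).source := by rwa [extChartAt_source]
  refine ⟨(extChartAt 𝓘(ℝ, E) x₀).map_source hy', ?_⟩
  rwa [mem_preimage, (extChartAt 𝓘(ℝ, E) x₀).left_inv hy']

variable (x₀ : M)

/-- The vector field with constant coefficients `v` in the chart at `x₀`. -/
noncomputable def coordField (v : E) (y : M) : TangentSpace 𝓘(ℝ, E) y :=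
  (trivializationAt E (TangentSpace 𝓘(ℝ, E)) x₀).symmL ℝ y v

theorem coordField_add (v w : E) (y : M) :
    coordField x₀ (v + w) y = coordField x₀ v y + coordField x₀ w y := map_add _ _ _

theorem coordField_smul (c : ℝ) (v : E) (y : M) :
    coordField x₀ (c • v) y = c • coordField x₀ v y := map_smul _ _ _

theorem smooth_coordField (v : E) :
    SmoothSectionOn 𝓘(ℝ, E) E (coordField x₀ v) (chartAt E x₀).source := by
  have := (trivializationAt E (TangentSpace 𝓘(ℝ, E)) x₀).contMDiffOn_symmL (IB := 𝓘(ℝ, E)) (n := ∞)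
  have h2 : ContMDiffOn 𝓘(ℝ, E) (𝓘(ℝ, E).prod 𝓘(ℝ, E)) ∞
      (fun y => TotalSpace.mk' E (E := Bundle.Trivial M E) y v) (chartAt E x₀).source := by
    intro y _
    exact contMDiffWithinAt_totalSpace.2 ⟨contMDiffWithinAt_id, contMDiffWithinAt_const⟩
  exact this.clm_bundle_apply h2

theorem mvfderiv_extChartAt_coordField (v : E) {y : M} (hy : y ∈ (chartAt E x₀).source) :
    mvfderiv 𝓘(ℝ, E) (extChartAt 𝓘(ℝ, E) x₀) y (coordField x₀ v y) = v := by
  have hy' : y ∈ (extChartAt 𝓘(ℝ, E) x₀).source := by rwa [extChartAt_source]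
  have := mfderiv_extChartAt_comp_mfderivWithin_extChartAt_symm' (I := 𝓘(ℝ, E)) hy'
  rw [coordField, TangentBundle.symmL_trivializationAt hy]
  exact congrArg (fun T => T v) this

theorem coordField_mvfderiv_extChartAt {y : M} (hy : y ∈ (chartAt E x₀).source)
    (w : TangentSpace 𝓘(ℝ, E) y) :
    coordField x₀ (mvfderiv 𝓘(ℝ, E) (extChartAt 𝓘(ℝ, E) x₀) y w) y = w := by
  have hy' : y ∈ (extChartAt 𝓘(ℝ, E) x₀).source := by rwa [extChartAt_source]
  have := mfderivWithin_extChartAt_symm_comp_mfderiv_extChartAt' (I := 𝓘(ℝ, E)) hy'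
  rw [coordField, TangentBundle.symmL_trivializationAt hy]
  exact congrArg (fun T => T w) this

theorem mvfderiv_coordField {f : M → G} {y : M} (hy : y ∈ (chartAt E x₀).source)
    (hf : MDifferentiableAt 𝓘(ℝ, E) 𝓘(ℝ, G) f y) (v : E) :
    mvfderiv 𝓘(ℝ, E) f y (coordField x₀ v y)
      = fderiv ℝ (inChart x₀ f) (extChartAt 𝓘(ℝ, E) x₀ y) v := by
  rw [mvfderiv_eq_fderiv_inChart hy hf, mvfderiv_extChartAt_coordField x₀ v hy]

/-- The expression of a vector field in the chart at `x₀`. -/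
noncomputable def fieldInChart (X : Π y : M, TangentSpace 𝓘(ℝ, E) y) : E → E :=
  VectorField.mpullbackWithin 𝓘(ℝ, E) 𝓘(ℝ, E) (extChartAt 𝓘(ℝ, E) x₀).symm X (range 𝓘(ℝ, E))

theorem mvfderiv_extChartAt_eq_fieldInChart (X : Π y : M, TangentSpace 𝓘(ℝ, E) y) {z : E}
    (hz : z ∈ (extChartAt 𝓘(ℝ, E) x₀).target) :
    mvfderiv 𝓘(ℝ, E) (extChartAt 𝓘(ℝ, E) x₀) ((extChartAt 𝓘(ℝ, E) x₀).symm z)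
        (X ((extChartAt 𝓘(ℝ, E) x₀).symm z))
      = fieldInChart x₀ X z := by
  rw [fieldInChart, VectorField.mpullbackWithin_apply, ContinuousLinearMap.inverse_eq
    (mfderivWithin_extChartAt_symm_comp_mfderiv_extChartAt hz)
    (mfderiv_extChartAt_comp_mfderivWithin_extChartAt_symm hz)]
  rfl

variable [CompleteSpace E]

/-- The derivative of a function along a Lie bracket is the commutator of the derivatives. -/
theorem mvfderiv_mlieBracket {f : M → G} {U : Set M} {x : M} (hU : IsOpen U) (hx : x ∈ U)
    (hf : ContMDiffOn 𝓘(ℝ, E) 𝓘(ℝ, G) ∞ f U) {X Y : Π y : M, TangentSpace 𝓘(ℝ, E) y}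
    (hX : SmoothSectionOn 𝓘(ℝ, E) E X U) (hY : SmoothSectionOn 𝓘(ℝ, E) E Y U) :
    mvfderiv 𝓘(ℝ, E) f x (VectorField.mlieBracket 𝓘(ℝ, E) X Y x)
      = mvfderiv 𝓘(ℝ, E) (fun y => mvfderiv 𝓘(ℝ, E) f y (Y y)) x (X x)
        - mvfderiv 𝓘(ℝ, E) (fun y => mvfderiv 𝓘(ℝ, E) f y (X y)) x (Y x) := by
  have hxs : x ∈ (chartAt E x).source := mem_chart_source E x
  have hxe : x ∈ (extChartAt 𝓘(ℝ, E) x).source := mem_extChartAt_source x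
  set φ := extChartAt 𝓘(ℝ, E) x with hφ
  set V := φ.target ∩ φ.symm ⁻¹' U with hV
  have hVo : IsOpen V := isOpen_inChart hU x
  have hxV : φ x ∈ V := mem_inChart hxs hx
  have hfV : ContDiffOn ℝ ∞ (inChart x f) V := contDiffOn_inChart hf
  have hfx : ContDiffAt ℝ ∞ (inChart x f) (φ x) := hfV.contDiffAt (hVo.mem_nhds hxV)
  have hmd : ∀ y ∈ U, MDifferentiableAt 𝓘(ℝ, E) 𝓘(ℝ, G) f y := fun y hy =>
    (hf.contMDiffAt (hU.mem_nhds hy)).mdifferentiableAt (by simp)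
  -- In the chart, `X f` is `f'(X)`, with derivative `f''(w, X) + f'(X' w)` in the direction `w`. In
  -- the commutator the terms with `f''` cancel by symmetry, and `f'` of the bracket of the chart
  -- expressions remains.
  have key : ∀ X : Π y : M, TangentSpace 𝓘(ℝ, E) y, SmoothSectionOn 𝓘(ℝ, E) E X U →
      DifferentiableAt ℝ (fieldInChart x X) (φ x) ∧ ∀ w, mvfderiv 𝓘(ℝ, E) (fun y => mvfderiv 𝓘(ℝ, E) f y (X y)) x w
      = fderiv ℝ (fderiv ℝ (inChart x f)) (φ x) (mvfderiv 𝓘(ℝ, E) φ x w)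
          (mvfderiv 𝓘(ℝ, E) φ x (X x))
        + fderiv ℝ (inChart x f) (φ x) (fderiv ℝ (fieldInChart x X) (φ x)
          (mvfderiv 𝓘(ℝ, E) φ x w)) := by
    intro X hX
    set Xh : E → E := fieldInChart x X with hXh
    have hdX : DifferentiableAt ℝ Xh (φ x) := by
      have hXx : MDifferentiableWithinAt 𝓘(ℝ, E) (𝓘(ℝ, E).prod 𝓘(ℝ, E))
          (fun y => (X y : TangentBundle 𝓘(ℝ, E) M)) univ x :=
        ((hX.contMDiffAt (hU.mem_nhds hx)).mdifferentiableAt (by simp)).mdifferentiableWithinAt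
      have : IsManifold 𝓘(ℝ, E) 2 M := .of_le (n := ∞) (WithTop.coe_le_coe.2 le_top)
      have := hXx.differentiableWithinAt_mpullbackWithin_vectorField
      rw [preimage_univ, univ_inter] at this
      exact DifferentiableWithinAt.differentiableAt this (by simp)
    have hXx : Xh (φ x) = mvfderiv 𝓘(ℝ, E) φ x (X x) := by
      rw [hXh, ← mvfderiv_extChartAt_eq_fieldInChart x X (φ.map_source hxe), φ.left_inv hxe]
    have hev : ∀ z ∈ V, inChart x (fun y => mvfderiv 𝓘(ℝ, E) f y (X y)) z
        = fderiv ℝ (inChart x f) z (Xh z) := by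
      intro z hz
      have hzs : φ.symm z ∈ (chartAt E x).source := by
        have := φ.map_target hz.1
        rwa [extChartAt_source] at this
      change mvfderiv 𝓘(ℝ, E) f (φ.symm z) (X (φ.symm z)) = _
      rw [mvfderiv_eq_fderiv_inChart hzs (hmd _ hz.2), mvfderiv_extChartAt_eq_fieldInChart x X hz.1,
        ← hφ, φ.right_inv hz.1]
    have hD : HasFDerivAt (fun z => fderiv ℝ (inChart x f) z (Xh z))
        ((fderiv ℝ (inChart x f) (φ x)).comp (fderiv ℝ Xh (φ x))
          + (fderiv ℝ (fderiv ℝ (inChart x f)) (φ x)).flip (Xh (φ x))) (φ x) :=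
      ((hfx.fderiv_right (m := 1) (by norm_cast)).differentiableAt
        (by simp)).hasFDerivAt.clm_apply hdX.hasFDerivAt
    have hmdX : MDifferentiableAt 𝓘(ℝ, E) 𝓘(ℝ, G) (fun y => mvfderiv 𝓘(ℝ, E) f y (X y)) x := by
      have h1 : MDifferentiableAt 𝓘(ℝ, E) 𝓘(ℝ, G)
          ((fun z => fderiv ℝ (inChart x f) z (Xh z)) ∘ φ) x :=
        hD.differentiableAt.mdifferentiableAt.comp x (mdifferentiableAt_extChartAt hxs)
      refine h1.congr_of_eventuallyEq ?_
      filter_upwards [(isOpen_extChartAt_source (I := 𝓘(ℝ, E)) x).mem_nhds hxe,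
        hU.mem_nhds hx] with y hy hyU
      have := hev (φ y) ⟨φ.map_source hy, by rwa [mem_preimage, φ.left_inv hy]⟩
      rw [Function.comp_apply, ← this, inChart, Function.comp_apply, ← hφ, φ.left_inv hy]
    refine ⟨hdX, fun w => ?_⟩
    rw [mvfderiv_eq_fderiv_inChart hxs hmdX,
      (Filter.eventuallyEq_of_mem (hVo.mem_nhds hxV) hev).fderiv_eq, hD.fderiv, hXx, ← hφ]
    simp only [_root_.add_apply, ContinuousLinearMap.comp_apply, ContinuousLinearMap.flip_apply]
    rw [add_comm]
  obtain ⟨-, hX2⟩ := key X hX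
  obtain ⟨-, hY2⟩ := key Y hY
  rw [hX2, hY2, mvfderiv_eq_fderiv_inChart hxs (hmd x hx)]
  have hb : mvfderiv 𝓘(ℝ, E) φ x (VectorField.mlieBracket 𝓘(ℝ, E) X Y x)
      = VectorField.lieBracket ℝ (fieldInChart x X) (fieldInChart x Y) (φ x) := by
    rw [← VectorField.mlieBracketWithin_univ, VectorField.mlieBracketWithin_apply]
    have hinv := isInvertible_mfderiv_extChartAt (I := 𝓘(ℝ, E)) hxe
    let b : E := VectorField.lieBracketWithin ℝ (fieldInChart x X) (fieldInChart x Y)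
      (φ.symm ⁻¹' univ ∩ range 𝓘(ℝ, E)) (φ x)
    have := congrArg (fun T => T b) hinv.self_comp_inverse
    refine this.trans ?_
    change b = _
    simp only [b]
    rw [preimage_univ, univ_inter, ModelWithCorners.range_eq_univ,
      VectorField.lieBracketWithin_univ]
  have hsymm : IsSymmSndFDerivAt ℝ (inChart x f) (φ x) :=
    hfx.isSymmSndFDerivAt (by
    rw [minSmoothness_of_isRCLikeNormedField]
    exact WithTop.coe_le_coe.2 le_top)
  have e1 := mvfderiv_extChartAt_eq_fieldInChart x X (φ.map_source hxe)
  have e2 := mvfderiv_extChartAt_eq_fieldInChart x Y (φ.map_source hxe)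
  rw [← hφ, φ.left_inv hxe] at e1 e2
  have hl : VectorField.lieBracket ℝ (fieldInChart x X) (fieldInChart x Y) (φ x)
      = fderiv ℝ (fieldInChart x Y) (φ x) (fieldInChart x X (φ x))
        - fderiv ℝ (fieldInChart x X) (φ x) (fieldInChart x Y (φ x)) := rfl
  rw [← hφ, hb, hl, map_sub, e1, e2, hsymm.eq]
  abel

/-- The derivative of the chart map along a coordinate field is constant, so by
`mvfderiv_mlieBracket` its derivative along the bracket vanishes; the differential of the chart is
injective. -/
theorem mlieBracket_coordField (v w : E) {y : M} (hy : y ∈ (chartAt E x₀).source) :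
    VectorField.mlieBracket 𝓘(ℝ, E) (coordField x₀ v) (coordField x₀ w) y = 0 := by
  have hopen : IsOpen (chartAt E x₀).source := (chartAt E x₀).open_source
  have h := mvfderiv_mlieBracket (f := extChartAt 𝓘(ℝ, E) x₀) hopen hy (contMDiffOn_extChartAt)
    (smooth_coordField x₀ v) (smooth_coordField x₀ w)
  have hc : ∀ u u' : E, mvfderiv 𝓘(ℝ, E) (fun z => mvfderiv 𝓘(ℝ, E) (extChartAt 𝓘(ℝ, E) x₀) z
      (coordField x₀ u z)) y (coordField x₀ u' y) = 0 := by
    intro u u'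
    have he : (fun z => mvfderiv 𝓘(ℝ, E) (extChartAt 𝓘(ℝ, E) x₀) z (coordField x₀ u z))
        =ᶠ[𝓝 y] fun _ : M => u := by
      filter_upwards [hopen.mem_nhds hy] with z hz
      exact mvfderiv_extChartAt_coordField x₀ u hz
    rw [mvfderiv_congr he, mvfderiv_const]
    rfl
  rw [hc, hc, sub_zero] at h
  rw [← coordField_mvfderiv_extChartAt x₀ hy (VectorField.mlieBracket 𝓘(ℝ, E) _ _ y), h]
  exact map_zero _

end Coordinates

/-! ### Covariant derivatives of smooth local sections, tensoriality of the curvature -/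

section Sections

variable {E : Type*} [NormedAddCommGroup E] [NormedSpace ℝ E]
  {M : Type*} [TopologicalSpace M] [ChartedSpace E M] [IsManifold 𝓘(ℝ, E) ∞ M]
  {G : Type*} [NormedAddCommGroup G] [NormedSpace ℝ G]

theorem contMDiffOn_mvfderiv_apply {f : M → G} {U : Set M} (hU : IsOpen U)
    (hf : ContMDiffOn 𝓘(ℝ, E) 𝓘(ℝ, G) ∞ f U) {X : Π y : M, TangentSpace 𝓘(ℝ, E) y}
    (hX : SmoothSectionOn 𝓘(ℝ, E) E X U) :
    ContMDiffOn 𝓘(ℝ, E) 𝓘(ℝ, G) ∞ (fun y => mvfderiv 𝓘(ℝ, E) f y (X y)) U := by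
  have h1 := hf.contMDiffOn_tangentMapWithin (m := ∞) (by simp) hU.uniqueMDiffOn
  have h2 : ContMDiffOn 𝓘(ℝ, E) (𝓘(ℝ, G).prod 𝓘(ℝ, G)) ∞
      (fun y => tangentMapWithin 𝓘(ℝ, E) 𝓘(ℝ, G) f U ⟨y, X y⟩) U := h1.comp hX fun y hy => hy
  have h3 := (contMDiff_snd_tangentBundle_modelSpace (n := ∞) G 𝓘(ℝ, G)).comp_contMDiffOn h2
  refine h3.congr fun y hy => ?_
  have : mfderivWithin 𝓘(ℝ, E) 𝓘(ℝ, G) f U y = mfderiv 𝓘(ℝ, E) 𝓘(ℝ, G) f y :=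
    mfderivWithin_of_isOpen hU hy
  exact congrArg (fun T => T (X y)) this.symm

variable {F : Type*} [NormedAddCommGroup F] [NormedSpace ℝ F]
  {V : M → Type*} [TopologicalSpace (TotalSpace F V)]
  [∀ x, AddCommGroup (V x)] [∀ x, Module ℝ (V x)] [∀ x : M, TopologicalSpace (V x)]
  [FiberBundle F V]

theorem SmoothSectionOn.mono {σ : Π x : M, V x} {U W : Set M}
    (h : SmoothSectionOn 𝓘(ℝ, E) F σ U) (hW : W ⊆ U) : SmoothSectionOn 𝓘(ℝ, E) F σ W :=
  ContMDiffOn.mono h hW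

theorem SmoothSectionOn.congr {σ τ : Π x : M, V x} {U : Set M}
    (h : SmoothSectionOn 𝓘(ℝ, E) F σ U) (he : ∀ y ∈ U, τ y = σ y) :
    SmoothSectionOn 𝓘(ℝ, E) F τ U :=
  ContMDiffOn.congr h fun y hy => by rw [he y hy]

theorem SmoothSectionOn.mdifferentiableAt {σ : Π x : M, V x} {U : Set M} {x : M}
    (h : SmoothSectionOn 𝓘(ℝ, E) F σ U) (hU : IsOpen U) (hx : x ∈ U) :
    MDifferentiableAt 𝓘(ℝ, E) (𝓘(ℝ, E).prod 𝓘(ℝ, F)) (fun y => TotalSpace.mk' F y (σ y)) x :=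
  (ContMDiffOn.contMDiffAt h (hU.mem_nhds hx)).mdifferentiableAt (by simp)

variable [∀ x, IsTopologicalAddGroup (V x)] [∀ x, ContinuousSMul ℝ (V x)]

namespace CovariantDerivative

variable (cov : CovariantDerivative 𝓘(ℝ, E) F V)

theorem congr_of_eqOn {σ τ : Π x : M, V x} {U : Set M} {x : M} (hU : IsOpen U) (hx : x ∈ U)
    (hσ : SmoothSectionOn 𝓘(ℝ, E) F σ U) (h : ∀ y ∈ U, τ y = σ y) : cov τ x = cov σ x :=
  cov.isCovariantDerivativeOnUniv.congr_of_eventuallyEq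
    ((hσ.congr h).mdifferentiableAt hU hx) (hσ.mdifferentiableAt hU hx)
    Filter.univ_mem (Filter.eventually_of_mem (hU.mem_nhds hx) h)

/-- Covariant derivatives of smooth sections along smooth vector fields are smooth. -/
def PreservesSmooth : Prop :=
  ∀ (U : Set M) (X : Π x : M, TangentSpace 𝓘(ℝ, E) x) (σ : Π x : M, V x), IsOpen U →
    SmoothSectionOn 𝓘(ℝ, E) E X U → SmoothSectionOn 𝓘(ℝ, E) F σ U →
    SmoothSectionOn 𝓘(ℝ, E) F (fun y => cov σ y (X y)) U

variable {cov} {U : Set M} {x : M} {σ τ : Π x : M, V x} {X Y : Π x : M, TangentSpace 𝓘(ℝ, E) x}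

theorem add_apply (hU : IsOpen U) (hx : x ∈ U) (hσ : SmoothSectionOn 𝓘(ℝ, E) F σ U)
    (hτ : SmoothSectionOn 𝓘(ℝ, E) F τ U) (v : TangentSpace 𝓘(ℝ, E) x) :
    cov (σ + τ) x v = cov σ x v + cov τ x v := by
  rw [cov.isCovariantDerivativeOnUniv.add (hσ.mdifferentiableAt hU hx)
    (hτ.mdifferentiableAt hU hx)]
  rfl

theorem smul_apply (hU : IsOpen U) (hx : x ∈ U) {f : M → ℝ}
    (hf : ContMDiffOn 𝓘(ℝ, E) 𝓘(ℝ) ∞ f U) (hσ : SmoothSectionOn 𝓘(ℝ, E) F σ U)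
    (v : TangentSpace 𝓘(ℝ, E) x) :
    cov (f • σ) x v = f x • cov σ x v + mvfderiv 𝓘(ℝ, E) f x v • σ x := by
  rw [cov.isCovariantDerivativeOnUniv.leibniz (hσ.mdifferentiableAt hU hx)
    ((hf.contMDiffAt (hU.mem_nhds hx)).mdifferentiableAt (by simp))]
  rfl

end CovariantDerivative

variable [VectorBundle ℝ F V]

theorem SmoothSectionOn.add {σ τ : Π x : M, V x} {U : Set M} (hσ : SmoothSectionOn 𝓘(ℝ, E) F σ U)
    (hτ : SmoothSectionOn 𝓘(ℝ, E) F τ U) : SmoothSectionOn 𝓘(ℝ, E) F (σ + τ) U :=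
  ContMDiffOn.add_section hσ hτ

theorem SmoothSectionOn.sub {σ τ : Π x : M, V x} {U : Set M} (hσ : SmoothSectionOn 𝓘(ℝ, E) F σ U)
    (hτ : SmoothSectionOn 𝓘(ℝ, E) F τ U) : SmoothSectionOn 𝓘(ℝ, E) F (σ - τ) U :=
  ContMDiffOn.sub_section hσ hτ

theorem SmoothSectionOn.smul {f : M → ℝ} {σ : Π x : M, V x} {U : Set M}
    (hf : ContMDiffOn 𝓘(ℝ, E) 𝓘(ℝ) ∞ f U) (hσ : SmoothSectionOn 𝓘(ℝ, E) F σ U) :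
    SmoothSectionOn 𝓘(ℝ, E) F (f • σ) U :=
  ContMDiffOn.smul_section hf hσ

theorem SmoothSectionOn.const_smul (c : ℝ) {σ : Π x : M, V x} {U : Set M}
    (hσ : SmoothSectionOn 𝓘(ℝ, E) F σ U) : SmoothSectionOn 𝓘(ℝ, E) F (c • σ) U :=
  ContMDiffOn.const_smul_section hσ

theorem smoothSectionOn_zero (U : Set M) : SmoothSectionOn 𝓘(ℝ, E) F (0 : Π x : M, V x) U :=
  (contMDiff_zeroSection ℝ V).contMDiffOn

theorem SmoothSectionOn.sum {ι : Type*} (s : Finset ι) {σ : ι → Π x : M, V x} {U : Set M}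
    (hσ : ∀ i ∈ s, SmoothSectionOn 𝓘(ℝ, E) F (σ i) U) :
    SmoothSectionOn 𝓘(ℝ, E) F (∑ i ∈ s, σ i) U :=
  (ContMDiffOn.sum_section (t := σ) hσ).congr fun y _ => by simp

namespace CovariantDerivative

variable {cov : CovariantDerivative 𝓘(ℝ, E) F V} {U : Set M} {x : M} {σ τ : Π x : M, V x}
  {X Y : Π x : M, TangentSpace 𝓘(ℝ, E) x}

theorem const_smul_apply (hU : IsOpen U) (hx : x ∈ U) (c : ℝ)
    (hσ : SmoothSectionOn 𝓘(ℝ, E) F σ U) (v : TangentSpace 𝓘(ℝ, E) x) :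
    cov (c • σ) x v = c • cov σ x v := by
  rw [cov.isCovariantDerivativeOnUniv.smul_const c (hσ.mdifferentiableAt hU hx)]
  rfl

theorem sum_apply {ι : Type*} (s : Finset ι) {σ : ι → Π x : M, V x} (hU : IsOpen U) (hx : x ∈ U)
    (hσ : ∀ i, SmoothSectionOn 𝓘(ℝ, E) F (σ i) U) (v : TangentSpace 𝓘(ℝ, E) x) :
    cov (∑ i ∈ s, σ i) x v = ∑ i ∈ s, cov (σ i) x v := by
  classical
  induction s using Finset.induction_on with
  | empty => simp
  | insert i s hi ih =>
    rw [Finset.sum_insert hi, Finset.sum_insert hi,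
      add_apply hU hx (hσ i) (SmoothSectionOn.sum s fun j _ => hσ j), ih]

theorem sum_smul_apply {ι : Type*} [Fintype ι] {f : ι → M → ℝ} {e : ι → Π x : M, V x}
    (hU : IsOpen U) (hx : x ∈ U) (hf : ∀ i, ContMDiffOn 𝓘(ℝ, E) 𝓘(ℝ) ∞ (f i) U)
    (he : ∀ i, SmoothSectionOn 𝓘(ℝ, E) F (e i) U) (v : TangentSpace 𝓘(ℝ, E) x) :
    cov (∑ i, f i • e i) x v
      = ∑ i, (f i x • cov (e i) x v + mvfderiv 𝓘(ℝ, E) (f i) x v • e i x) := by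
  rw [sum_apply _ hU hx (fun i => (he i).smul (hf i))]
  exact Finset.sum_congr rfl fun i _ => smul_apply hU hx (hf i) (he i) v

variable (hcov : cov.PreservesSmooth)
include hcov

theorem curvatureOp_congr (hU : IsOpen U) (hx : x ∈ U) (hX : SmoothSectionOn 𝓘(ℝ, E) E X U)
    (hY : SmoothSectionOn 𝓘(ℝ, E) E Y U) (hσ : SmoothSectionOn 𝓘(ℝ, E) F σ U)
    (h : ∀ y ∈ U, τ y = σ y) : cov.curvatureOp X Y τ x = cov.curvatureOp X Y σ x := by
  have key : ∀ {Z : Π x : M, TangentSpace 𝓘(ℝ, E) x}, SmoothSectionOn 𝓘(ℝ, E) E Z U →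
      cov (fun y => cov τ y (Z y)) x = cov (fun y => cov σ y (Z y)) x := fun {Z} hZ =>
    cov.congr_of_eqOn hU hx (hcov U Z σ hU hZ hσ)
      fun y hy => congrArg (fun T => T (Z y)) (cov.congr_of_eqOn hU hy hσ h)
  unfold curvatureOp
  rw [key hX, key hY, cov.congr_of_eqOn hU hx hσ h]

theorem curvatureOp_add (hU : IsOpen U) (hx : x ∈ U) (hX : SmoothSectionOn 𝓘(ℝ, E) E X U)
    (hY : SmoothSectionOn 𝓘(ℝ, E) E Y U) (hσ : SmoothSectionOn 𝓘(ℝ, E) F σ U)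
    (hτ : SmoothSectionOn 𝓘(ℝ, E) F τ U) :
    cov.curvatureOp X Y (σ + τ) x = cov.curvatureOp X Y σ x + cov.curvatureOp X Y τ x := by
  have key : ∀ {Z : Π x : M, TangentSpace 𝓘(ℝ, E) x}, SmoothSectionOn 𝓘(ℝ, E) E Z U →
      ∀ v, cov (fun y => cov (σ + τ) y (Z y)) x v
        = cov (fun y => cov σ y (Z y)) x v + cov (fun y => cov τ y (Z y)) x v := by
    intro Z hZ v
    rw [← add_apply hU hx (hcov U Z σ hU hZ hσ) (hcov U Z τ hU hZ hτ)]
    exact congrArg (fun T => T v) (cov.congr_of_eqOn hU hx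
      ((hcov U Z σ hU hZ hσ).add (hcov U Z τ hU hZ hτ))
      fun y hy => add_apply hU hy hσ hτ _)
  unfold curvatureOp
  rw [key hX, key hY, add_apply hU hx hσ hτ]
  abel

/-- The mixed terms `(Xf) ∇_Y σ` and `(Yf) ∇_X σ` cancel, and the second derivatives of `f` cancel
because `[X, Y] f = X(Yf) - Y(Xf)`. -/
theorem curvatureOp_smul [CompleteSpace E] {f : M → ℝ} (hU : IsOpen U) (hx : x ∈ U)
    (hX : SmoothSectionOn 𝓘(ℝ, E) E X U) (hY : SmoothSectionOn 𝓘(ℝ, E) E Y U)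
    (hf : ContMDiffOn 𝓘(ℝ, E) 𝓘(ℝ) ∞ f U) (hσ : SmoothSectionOn 𝓘(ℝ, E) F σ U) :
    cov.curvatureOp X Y (f • σ) x = f x • cov.curvatureOp X Y σ x := by
  have key : ∀ {Z : Π x : M, TangentSpace 𝓘(ℝ, E) x}, SmoothSectionOn 𝓘(ℝ, E) E Z U →
      ∀ v, cov (fun y => cov (f • σ) y (Z y)) x v
        = (f x • cov (fun y => cov σ y (Z y)) x v + mvfderiv 𝓘(ℝ, E) f x v • cov σ x (Z x))
          + (mvfderiv 𝓘(ℝ, E) f x (Z x) • cov σ x v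
            + mvfderiv 𝓘(ℝ, E) (fun y => mvfderiv 𝓘(ℝ, E) f y (Z y)) x v • σ x) := by
    intro Z hZ v
    have hZf := contMDiffOn_mvfderiv_apply hU hf hZ
    have hZσ := hcov U Z σ hU hZ hσ
    rw [← smul_apply hU hx hf hZσ, ← smul_apply hU hx hZf hσ,
      ← add_apply hU hx (hZσ.smul hf) (hσ.smul hZf)]
    exact congrArg (fun T => T v) (cov.congr_of_eqOn hU hx ((hZσ.smul hf).add (hσ.smul hZf))
      fun y hy => smul_apply hU hy hf hσ _)
  unfold curvatureOp
  rw [key hX, key hY, smul_apply hU hx hf hσ, mvfderiv_mlieBracket hU hx hf hX hY]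
  module

theorem curvatureOp_zero (hU : IsOpen U) (hx : x ∈ U) (hX : SmoothSectionOn 𝓘(ℝ, E) E X U)
    (hY : SmoothSectionOn 𝓘(ℝ, E) E Y U) : cov.curvatureOp X Y 0 x = 0 := by
  have := curvatureOp_add hcov hU hx hX hY (smoothSectionOn_zero U) (smoothSectionOn_zero U)
  simpa using this

theorem curvatureOp_sum_smul [CompleteSpace E] {ι : Type*} (s : Finset ι) {f : ι → M → ℝ}
    {e : ι → Π x : M, V x} (hU : IsOpen U) (hx : x ∈ U)
    (hX : SmoothSectionOn 𝓘(ℝ, E) E X U) (hY : SmoothSectionOn 𝓘(ℝ, E) E Y U)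
    (hf : ∀ i, ContMDiffOn 𝓘(ℝ, E) 𝓘(ℝ) ∞ (f i) U) (he : ∀ i, SmoothSectionOn 𝓘(ℝ, E) F (e i) U) :
    cov.curvatureOp X Y (∑ i ∈ s, f i • e i) x
      = ∑ i ∈ s, f i x • cov.curvatureOp X Y (e i) x := by
  classical
  induction s using Finset.induction_on with
  | empty => simpa using curvatureOp_zero hcov hU hx hX hY
  | insert i s hi ih =>
    rw [Finset.sum_insert hi, Finset.sum_insert hi, curvatureOp_add hcov hU hx hX hY
      ((he i).smul (hf i)) (SmoothSectionOn.sum s fun j _ => (he j).smul (hf j)), ih,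
      curvatureOp_smul hcov hU hx hX hY (hf i) (he i)]

/-- The curvature is tensorial in the section. -/
theorem curvatureOp_eq_of_eq [FiniteDimensional ℝ F] [ContMDiffVectorBundle ∞ F V 𝓘(ℝ, E)]
    [CompleteSpace E] {U' : Set M} (hU : IsOpen U) (hx : x ∈ U) (hX : SmoothSectionOn 𝓘(ℝ, E) E X U)
    (hY : SmoothSectionOn 𝓘(ℝ, E) E Y U) (hσ : SmoothSectionOn 𝓘(ℝ, E) F σ U)
    (hU' : IsOpen U') (hx' : x ∈ U')
    (hτ : SmoothSectionOn 𝓘(ℝ, E) F τ U') (h : τ x = σ x) :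
    cov.curvatureOp X Y τ x = cov.curvatureOp X Y σ x := by
  have : ContMDiffVectorBundle 1 F V 𝓘(ℝ, E) := .of_le (n := ∞) (WithTop.coe_le_coe.2 le_top)
  let t := trivializationAt F V x
  let b := finBasis ℝ F
  let W := U ∩ U' ∩ t.baseSet
  have hW : IsOpen W := (hU.inter hU').inter t.open_baseSet
  have hxW : x ∈ W := ⟨⟨hx, hx'⟩, mem_baseSet_trivializationAt F V x⟩
  have hWU : W ⊆ U := fun y hy => hy.1.1
  have hWU' : W ⊆ U' := fun y hy => hy.1.2
  -- In a local frame the coefficients of `ρ` leave the curvature as their values at `x`, so nothing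
  -- but `ρ x` enters.
  have key : ∀ {ρ : Π x : M, V x}, SmoothSectionOn 𝓘(ℝ, E) F ρ W →
      cov.curvatureOp X Y ρ x = ∑ i, t.localFrameCoeff 𝓘(ℝ, E) b i x (ρ x) •
        cov.curvatureOp X Y (t.localFrame b i) x := by
    intro ρ hρ
    rw [← curvatureOp_sum_smul hcov Finset.univ hW hxW (hX.mono hWU) (hY.mono hWU)
      (f := fun i y => t.localFrameCoeff 𝓘(ℝ, E) b i y (ρ y))
      (fun i => contMDiffOn_localFrameCoeff (e := t) b hW (fun y hy => hy.2) hρ i)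
      (fun i => (t.contMDiffOn_localFrame_baseSet ∞ b i).mono fun y hy => hy.2)]
    refine (curvatureOp_congr hcov hW hxW (hX.mono hWU) (hY.mono hWU) hρ fun y hy => ?_).symm
    rw [t.eq_sum_localFrameCoeff_smul (I := 𝓘(ℝ, E)) (s := ρ) (b := b) hy.2]
    simp
  rw [key (hτ.mono hWU'), key (hσ.mono hWU), h]

end CovariantDerivative

end Sections

/-! ### Frames of subbundles and smooth left inverses -/

section Frames

variable {E : Type*} [NormedAddCommGroup E] [NormedSpace ℝ E]
  {M : Type*} [TopologicalSpace M] [ChartedSpace E M] [IsManifold 𝓘(ℝ, E) ∞ M]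
  {F : Type*} [NormedAddCommGroup F] [NormedSpace ℝ F]
  {V : M → Type*} [TopologicalSpace (TotalSpace F V)]
  [∀ x, AddCommGroup (V x)] [∀ x, Module ℝ (V x)] [∀ x : M, TopologicalSpace (V x)]
  [FiberBundle F V] [VectorBundle ℝ F V]
  [∀ x, IsTopologicalAddGroup (V x)] [∀ x, ContinuousSMul ℝ (V x)]

theorem contMDiffOn_trivialization_section [ContMDiffVectorBundle ∞ F V 𝓘(ℝ, E)]
    {σ : Π x : M, V x} {U : Set M} (x₀ : M)
    (hσ : SmoothSectionOn 𝓘(ℝ, E) F σ U) (hU : IsOpen U)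
    (hb : U ⊆ (trivializationAt F V x₀).baseSet) :
    ContMDiffOn 𝓘(ℝ, E) 𝓘(ℝ, F) ∞ (fun y => (trivializationAt F V x₀ ⟨y, σ y⟩).2) U := by
  intro y hy
  exact (((trivializationAt F V x₀).contMDiffAt_section_iff (IB := 𝓘(ℝ, E)) (n := ∞) (s := σ) (hb hy)).1
    (ContMDiffOn.contMDiffAt hσ (hU.mem_nhds hy))).contMDiffWithinAt

variable (F V) in
theorem finiteDimensional_fiber [FiniteDimensional ℝ F] (x : M) : FiniteDimensional ℝ (V x) :=
  LinearEquiv.finiteDimensional ((trivializationAt F V x).linearEquivAt ℝ x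
    (mem_baseSet_trivializationAt F V x)).symm

theorem exists_smoothSectionOn_eq [ContMDiffVectorBundle ∞ F V 𝓘(ℝ, E)] {x : M} (w : V x) :
    ∃ (U : Set M) (σ : Π y : M, V y), IsOpen U ∧ x ∈ U ∧ SmoothSectionOn 𝓘(ℝ, E) F σ U ∧ σ x = w := by
  let t := trivializationAt F V x
  have hx : x ∈ t.baseSet := mem_baseSet_trivializationAt F V x
  refine ⟨t.baseSet, fun y => t.symmL ℝ y (t ⟨x, w⟩).2, t.open_baseSet, hx, ?_, ?_⟩
  · have h2 : ContMDiffOn 𝓘(ℝ, E) (𝓘(ℝ, E).prod 𝓘(ℝ, F)) ∞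
        (fun y => TotalSpace.mk' F (E := Bundle.Trivial M F) y (t ⟨x, w⟩).2) t.baseSet := fun y _ =>
      contMDiffWithinAt_totalSpace.2 ⟨contMDiffWithinAt_id, contMDiffWithinAt_const⟩
    exact (t.contMDiffOn_symmL (IB := 𝓘(ℝ, E)) (n := ∞)).clm_bundle_apply h2
  · have := t.symmL_continuousLinearMapAt (R := ℝ) hx w
    rwa [Trivialization.continuousLinearMapAt_apply, t.linearMapAt_apply, if_pos hx] at this

theorem isOpen_section_ne_zero {σ : Π x : M, V x} {U : Set M} (hU : IsOpen U)
    (hσ : SmoothSectionOn 𝓘(ℝ, E) F σ U) : IsOpen {y | y ∈ U ∧ σ y ≠ 0} := by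
  rw [isOpen_iff_mem_nhds]
  rintro x ⟨hx, hne⟩
  let t := trivializationAt F V x
  have hxt : x ∈ t.baseSet := mem_baseSet_trivializationAt F V x
  have hz : ∀ y ∈ t.baseSet, t.linearMapAt ℝ y (σ y) = (t ⟨y, σ y⟩).2 := fun y hy => by
    rw [t.linearMapAt_apply, if_pos hy]
  have hc : ContinuousAt (fun y => (t ⟨y, σ y⟩).2) x := by
    have h1 := (ContMDiffOn.contMDiffAt hσ (hU.mem_nhds hx)).continuousAt
    have h2 : ContinuousAt t (TotalSpace.mk' F x (σ x)) :=
      t.continuousAt (t.mem_source.2 hxt)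
    exact continuousAt_snd.comp (ContinuousAt.comp (f := fun y => TotalSpace.mk' F y (σ y)) h2 h1)
  have hn : (t ⟨x, σ x⟩).2 ≠ 0 := by
    rw [← hz x hxt]
    intro h0
    refine hne ?_
    have := t.symmₗ_linearMapAt (R := ℝ) hxt (σ x)
    rw [h0, map_zero] at this
    exact this.symm
  filter_upwards [hU.mem_nhds hx, t.open_baseSet.mem_nhds hxt, hc.eventually_ne hn] with y h1 h2 h3
  refine ⟨h1, fun h => h3 ?_⟩
  rw [← hz y h2, h, map_zero]

/-- The section with constant coefficients `c` with respect to the sections `e`. -/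
abbrev frameSum {r : ℕ} (e : Fin r → Π x : M, V x) (c : Fin r → ℝ) : Π x : M, V x :=
  ∑ j, c j • e j

theorem frameSum_apply {r : ℕ} (e : Fin r → Π x : M, V x) (c : Fin r → ℝ) (y : M) :
    frameSum e c y = ∑ j, c j • e j y := by
  simp

theorem smooth_frameSum {r : ℕ} {e : Fin r → Π x : M, V x} {U : Set M}
    (he : ∀ i, SmoothSectionOn 𝓘(ℝ, E) F (e i) U) (c : Fin r → ℝ) :
    SmoothSectionOn 𝓘(ℝ, E) F (frameSum e c) U :=
  SmoothSectionOn.sum _ fun i _ => (he i).const_smul (c i)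

variable (E F) in
/-- `L` is a smooth left inverse over the open set `U` of the family of linear maps
`c ↦ ∑ j, c j • e j`. -/
structure IsDualOn {r : ℕ} (e : Fin r → Π x : M, V x) (L : Π y, V y →ₗ[ℝ] (Fin r → ℝ))
    (U : Set M) : Prop where
  isOpen : IsOpen U
  smooth_frame : ∀ i, SmoothSectionOn 𝓘(ℝ, E) F (e i) U
  apply_frameSum : ∀ y ∈ U, ∀ c, L y (frameSum e c y) = c
  smooth : ∀ (W : Set M) (τ : Π x : M, V x), IsOpen W → W ⊆ U → SmoothSectionOn 𝓘(ℝ, E) F τ W →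
    ContMDiffOn 𝓘(ℝ, E) 𝓘(ℝ, Fin r → ℝ) ∞ (fun y => L y (τ y)) W

/-- A smooth left inverse exists near a point where the sections are linearly independent. -/
theorem exists_isDualOn [FiniteDimensional ℝ F] [ContMDiffVectorBundle ∞ F V 𝓘(ℝ, E)] {r : ℕ} {e : Fin r → Π x : M, V x} {U : Set M}
    {x₀ : M} (hU : IsOpen U) (hx : x₀ ∈ U) (he : ∀ i, SmoothSectionOn 𝓘(ℝ, E) F (e i) U)
    (hli : LinearIndependent ℝ fun i => e i x₀) :
    ∃ U' L, x₀ ∈ U' ∧ U' ⊆ U ∧ IsDualOn E F e L U' := by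
  let t := trivializationAt F V x₀
  have hxt : x₀ ∈ t.baseSet := mem_baseSet_trivializationAt F V x₀
  have hz : ∀ y ∈ t.baseSet, ∀ w, t.linearMapAt ℝ y w = (t ⟨y, w⟩).2 := fun y hy w => by
    rw [t.linearMapAt_apply, if_pos hy]
  have hli' : LinearIndependent ℝ fun i => t.linearMapAt ℝ x₀ (e i x₀) := by
    refine hli.map' _ (LinearMap.ker_eq_bot.2 ?_)
    exact Function.LeftInverse.injective (g := t.symmₗ ℝ x₀) (t.symmₗ_linearMapAt hxt)
  obtain ⟨P, hP⟩ : ∃ P : F →ₗ[ℝ] (Fin r → ℝ), ∀ c : Fin r → ℝ,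
      P (∑ i, c i • t.linearMapAt ℝ x₀ (e i x₀)) = c := by
    have hinj : Function.Injective (Fintype.linearCombination ℝ fun i => t.linearMapAt ℝ x₀ (e i x₀)) :=
      by
      rw [← LinearMap.ker_eq_bot, LinearMap.ker_eq_bot']
      intro c hc
      exact funext (Fintype.linearIndependent_iff.1 hli' c hc)
    obtain ⟨P, hP⟩ := LinearMap.exists_leftInverse_of_injective _ (LinearMap.ker_eq_bot.2 hinj)
    exact ⟨P, fun c => congrArg (fun T => T c) hP⟩
  let P' : F →L[ℝ] (Fin r → ℝ) := LinearMap.toContinuousLinearMap P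
  let S : Fin r → F →L[ℝ] ((Fin r → ℝ) →L[ℝ] (Fin r → ℝ)) := fun j =>
    (ContinuousLinearMap.smulRightL ℝ (Fin r → ℝ) (Fin r → ℝ) (ContinuousLinearMap.proj j)).comp P'
  -- `A y` is the frame at `y`, read in the trivialization and followed by the left inverse `P` of
  -- the frame at `x₀`. It is the identity at `x₀`, hence invertible nearby, and `A⁻¹ P` is the left
  -- inverse sought.
  let A : M → ((Fin r → ℝ) →L[ℝ] (Fin r → ℝ)) := fun y => ∑ j, S j (t ⟨y, e j y⟩).2
  have hAc : ∀ y ∈ t.baseSet, ∀ c, A y c = P' (t.linearMapAt ℝ y (frameSum e c y)) := by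
    intro y hy c
    simp only [A, S, frameSum_apply, map_sum, _root_.sum_apply, map_smul]
    simp only [hz y hy]
    rfl
  have hAs : ContMDiffOn 𝓘(ℝ, E) 𝓘(ℝ, (Fin r → ℝ) →L[ℝ] (Fin r → ℝ)) ∞ A (U ∩ t.baseSet) := by
    refine contMDiffOn_finsetSum fun j _ => ?_
    exact (S j).contMDiff.comp_contMDiffOn (contMDiffOn_trivialization_section x₀
      ((he j).mono inter_subset_left) (hU.inter t.open_baseSet) inter_subset_right)
  have hUo : IsOpen (U ∩ t.baseSet) := hU.inter t.open_baseSet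
  let U' := (U ∩ t.baseSet) ∩ A ⁻¹' {T | IsUnit T}
  have hU'o : IsOpen U' := hAs.continuousOn.isOpen_inter_preimage hUo Units.isOpen
  have hA0 : A x₀ = 1 := by
    ext1 c
    rw [hAc x₀ hxt, frameSum_apply, map_sum]
    simp only [map_smul]
    exact hP c
  refine ⟨U', fun y => ((Ring.inverse (A y)).comp P').toLinearMap.comp (t.linearMapAt ℝ y),
    ⟨⟨hx, hxt⟩, by simp [hA0]⟩, fun y hy => hy.1.1, hU'o, fun i => (he i).mono fun y hy => hy.1.1, ?_, ?_⟩
  · intro y hy c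
    have h1 : Ring.inverse (A y) (P' (t.linearMapAt ℝ y (frameSum e c y))) = c := by
      rw [← hAc y hy.1.2]
      exact congrArg (fun T => T c) (Ring.inverse_mul_cancel _ hy.2)
    exact h1
  · intro W τ hW hWU hτ
    have h1 : ContMDiffOn 𝓘(ℝ, E) 𝓘(ℝ, (Fin r → ℝ) →L[ℝ] (Fin r → ℝ)) ∞
        (fun y => Ring.inverse (A y)) W := by
      intro y hy
      obtain ⟨u, hu⟩ := (hWU hy).2
      have h2 : ContDiffAt ℝ ∞ Ring.inverse (A y) := hu ▸ contDiffAt_ringInverse ℝ u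
      exact h2.contMDiffAt.comp_contMDiffWithinAt y
        ((hAs.mono fun y hy => (hWU hy).1) y hy)
    have h3 := contMDiffOn_trivialization_section x₀ hτ hW fun y hy => (hWU hy).1.2
    refine (h1.clm_apply (P'.contMDiff.comp_contMDiffOn h3)).congr fun y hy => ?_
    exact congrArg (fun z => Ring.inverse (A y) (P' z)) (hz y (hWU hy).1.2 _)

namespace IsDualOn

variable {r : ℕ} {e : Fin r → Π x : M, V x} {L : Π y, V y →ₗ[ℝ] (Fin r → ℝ)} {U : Set M}

theorem mono (h : IsDualOn E F e L U) {W : Set M} (hW : IsOpen W) (hWU : W ⊆ U) :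
    IsDualOn E F e L W :=
  ⟨hW, fun i => (h.smooth_frame i).mono hWU, fun y hy => h.apply_frameSum y (hWU hy),
    fun W' τ h1 h2 => h.smooth W' τ h1 (h2.trans hWU)⟩

/-- The map `e ∘ L` is a projection onto the span of the frame. -/
theorem mem_span_iff (h : IsDualOn E F e L U) {y : M} (hy : y ∈ U) {w : V y} :
    w ∈ Submodule.span ℝ (range fun i => e i y) ↔ frameSum e (L y w) y = w := by
  rw [Submodule.mem_span_range_iff_exists_fun]
  have hf : ∀ c, frameSum e c y = ∑ i, c i • e i y := fun c => frameSum_apply e c y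
  constructor
  · rintro ⟨c, rfl⟩
    rw [← hf, h.apply_frameSum y hy]
  · exact fun hw => ⟨L y w, by rw [← hf, hw]⟩

theorem frameSum_mem_span (c : Fin r → ℝ) (y : M) :
    frameSum e c y ∈ Submodule.span ℝ (range fun i => e i y) := by
  rw [Submodule.mem_span_range_iff_exists_fun]
  exact ⟨c, (frameSum_apply e c y).symm⟩

theorem linearIndependent (h : IsDualOn E F e L U) {y : M} (hy : y ∈ U) :
    LinearIndependent ℝ fun i => e i y := by
  rw [Fintype.linearIndependent_iff]
  intro c hc i
  have := h.apply_frameSum y hy c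
  have h0 : frameSum e c y = 0 := (frameSum_apply e c y).trans hc
  rw [h0, map_zero] at this
  rw [← this]; rfl

/-- By `mem_span_iff` this is the set where the smooth section `e (L τ) - τ` does not vanish. -/
theorem isOpen_notMem_span (h : IsDualOn E F e L U) {τ : Π x : M, V x} {W : Set M} (hW : IsOpen W)
    (hWU : W ⊆ U) (hτ : SmoothSectionOn 𝓘(ℝ, E) F τ W) :
    IsOpen {y | y ∈ W ∧ τ y ∉ Submodule.span ℝ (range fun i => e i y)} := by
  have hs := h.smooth W τ hW hWU hτ
  have h1 : SmoothSectionOn 𝓘(ℝ, E) F (∑ j, (fun y => L y (τ y) j) • e j) W :=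
    SmoothSectionOn.sum _ fun j _ => ((h.smooth_frame j).mono hWU).smul
      (contMDiffOn_pi_space.1 hs j)
  have heq : {y | y ∈ W ∧ τ y ∉ Submodule.span ℝ (range fun i => e i y)}
      = {y | y ∈ W ∧ (∑ j, (fun y => L y (τ y) j) • e j - τ) y ≠ 0} := by
    ext y
    refine and_congr_right fun hy => not_congr ?_
    rw [h.mem_span_iff (hWU hy), Pi.sub_apply, sub_eq_zero]
    simp
  rw [heq]
  exact isOpen_section_ne_zero hW (h1.sub hτ)

end IsDualOn

end Frames

/-! ### The derived flag and the invariance of its terminal subset -/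

section FlagProperties

variable {E : Type*} [NormedAddCommGroup E] [NormedSpace ℝ E]
  {M : Type*} [TopologicalSpace M] [ChartedSpace E M] [IsManifold 𝓘(ℝ, E) ∞ M]
  {F : Type*} [NormedAddCommGroup F] [NormedSpace ℝ F]
  {V : M → Type*} [TopologicalSpace (TotalSpace F V)]
  [∀ x, AddCommGroup (V x)] [∀ x, Module ℝ (V x)] [∀ x : M, TopologicalSpace (V x)]
  [FiberBundle F V] [VectorBundle ℝ F V]
  [∀ x, IsTopologicalAddGroup (V x)] [∀ x, ContinuousSMul ℝ (V x)]

/-- The sets `S x` are linear subspaces of the fibres of `V`. -/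
def IsFibrewiseSubspace (S : Π x : M, Set (V x)) : Prop :=
  ∀ x, 0 ∈ S x ∧ ∀ (a b : ℝ), ∀ v ∈ S x, ∀ w ∈ S x, a • v + b • w ∈ S x

/-- The subspaces of a fibrewise subspace. -/
def IsFibrewiseSubspace.submodule {S : Π x : M, Set (V x)} (hS : IsFibrewiseSubspace S) (x : M) :
    Submodule ℝ (V x) where
  carrier := S x
  zero_mem' := (hS x).1
  add_mem' {v w} hv hw := by simpa using (hS x).2 1 1 v hv w hw
  smul_mem' c v hv := by simpa using (hS x).2 c 0 v hv v hv

theorem IsFibrewiseSubspace.sectionPart {S : Π x : M, Set (V x)} (hS : IsFibrewiseSubspace S) :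
    IsFibrewiseSubspace (sectionPart 𝓘(ℝ, E) F S) := by
  refine fun x => ⟨⟨univ, 0, isOpen_univ, mem_univ x, smoothSectionOn_zero _,
    fun y _ => (hS y).1, rfl⟩, ?_⟩
  rintro a b _ ⟨U, σ, hU, hx, hσ, hσS, rfl⟩ _ ⟨U', τ, hU', hx', hτ, hτS, rfl⟩
  exact ⟨U ∩ U', a • σ + b • τ, hU.inter hU', ⟨hx, hx'⟩,
    ((hσ.mono inter_subset_left).const_smul a).add ((hτ.mono inter_subset_right).const_smul b),
    fun y hy => (hS y).2 a b _ (hσS y hy.1) _ (hτS y hy.2), rfl⟩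

theorem sectionPart_subset (S : Π x : M, Set (V x)) (x : M) :
    sectionPart 𝓘(ℝ, E) F S x ⊆ S x := by
  rintro _ ⟨U, σ, -, hx, -, hS, rfl⟩
  exact hS x hx

/-- `𝒮` is idempotent: a section witnessing one of its values witnesses all of them. As every step
of the flag is of the form `𝒮(S)`, each of its elements extends to a section within that step. -/
theorem exists_section_of_mem_sectionPart {S : Π x : M, Set (V x)} {x : M} {w : V x}
    (hw : w ∈ sectionPart 𝓘(ℝ, E) F S x) :
    ∃ (U : Set M) (σ : Π x : M, V x), IsOpen U ∧ x ∈ U ∧ SmoothSectionOn 𝓘(ℝ, E) F σ U ∧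
      (∀ y ∈ U, σ y ∈ sectionPart 𝓘(ℝ, E) F S y) ∧ σ x = w := by
  obtain ⟨U, σ, hU, hx, hσ, hS, rfl⟩ := hw
  exact ⟨U, σ, hU, hx, hσ, fun y hy => ⟨U, σ, hU, hy, hσ, hS, rfl⟩, rfl⟩

namespace CovariantDerivative

variable {cov : CovariantDerivative 𝓘(ℝ, E) F V} {W : Π x : M, Set (V x)}

theorem isFibrewiseSubspace_secondFundamentalKernel {S : Π x : M, Set (V x)}
    (hS : IsFibrewiseSubspace S) : IsFibrewiseSubspace (cov.secondFundamentalKernel S) := by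
  refine fun x => ⟨⟨univ, 0, isOpen_univ, mem_univ x, smoothSectionOn_zero _,
    fun y _ => (hS y).1, rfl, fun v => by simpa using (hS x).1⟩, ?_⟩
  rintro a b _ ⟨U, σ, hU, hx, hσ, hσS, rfl, hσ'⟩ _ ⟨U', τ, hU', hx', hτ, hτS, rfl, hτ'⟩
  have h1 := (hσ.mono (inter_subset_left (t := U'))).const_smul a
  have h2 := (hτ.mono (inter_subset_right (s := U))).const_smul b
  refine ⟨U ∩ U', a • σ + b • τ, hU.inter hU', ⟨hx, hx'⟩, h1.add h2,
    fun y hy => (hS y).2 a b _ (hσS y hy.1) _ (hτS y hy.2), rfl, fun v => ?_⟩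
  rw [add_apply (hU.inter hU') ⟨hx, hx'⟩ h1 h2, const_smul_apply hU hx a hσ,
    const_smul_apply hU' hx' b hτ]
  exact (hS x).2 a b _ (hσ' v) _ (hτ' v)

variable [FiniteDimensional ℝ F] [ContMDiffVectorBundle ∞ F V 𝓘(ℝ, E)] [CompleteSpace E]

/-- By tensoriality `R(X, Y)w` may be computed with any extension of `w`, in particular with linear
combinations of chosen extensions. -/
theorem isFibrewiseSubspace_curvatureKernel (hcov : cov.PreservesSmooth) :
    IsFibrewiseSubspace cov.curvatureKernel := by
  refine fun x => ⟨?_, ?_⟩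
  · intro U X Y σ hU hx hX hY hσ h
    rw [curvatureOp_eq_of_eq hcov hU hx hX hY (smoothSectionOn_zero U) hU hx hσ h,
      curvatureOp_zero hcov hU hx hX hY]
  · intro a b v hv w hw U X Y σ hU hx hX hY hσ h
    obtain ⟨U₁, σ₁, hU₁, hx₁, hσ₁, rfl⟩ := exists_smoothSectionOn_eq (E := E) (F := F) v
    obtain ⟨U₂, σ₂, hU₂, hx₂, hσ₂, rfl⟩ := exists_smoothSectionOn_eq (E := E) (F := F) w
    let U' := U ∩ (U₁ ∩ U₂)
    have hU' : IsOpen U' := hU.inter (hU₁.inter hU₂)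
    have hx' : x ∈ U' := ⟨hx, hx₁, hx₂⟩
    have hUU : U' ⊆ U := fun y hy => hy.1
    replace hσ₁ : SmoothSectionOn 𝓘(ℝ, E) F σ₁ U' := hσ₁.mono fun y hy => hy.2.1
    replace hσ₂ : SmoothSectionOn 𝓘(ℝ, E) F σ₂ U' := hσ₂.mono fun y hy => hy.2.2
    have ha : ContMDiffOn 𝓘(ℝ, E) 𝓘(ℝ) ∞ (fun _ : M => a) U' := contMDiffOn_const
    have hb : ContMDiffOn 𝓘(ℝ, E) 𝓘(ℝ) ∞ (fun _ : M => b) U' := contMDiffOn_const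
    rw [curvatureOp_eq_of_eq hcov hU' hx' (hX.mono hUU) (hY.mono hUU)
      ((hσ₁.smul ha).add (hσ₂.smul hb)) hU hx hσ h,
      curvatureOp_add hcov hU' hx' (hX.mono hUU) (hY.mono hUU) (hσ₁.smul ha) (hσ₂.smul hb),
      curvatureOp_smul hcov hU' hx' (hX.mono hUU) (hY.mono hUU) ha hσ₁,
      curvatureOp_smul hcov hU' hx' (hX.mono hUU) (hY.mono hUU) hb hσ₂,
      hv U' X Y σ₁ hU' hx' (hX.mono hUU) (hY.mono hUU) hσ₁ rfl,
      hw U' X Y σ₂ hU' hx' (hX.mono hUU) (hY.mono hUU) hσ₂ rfl]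
    simp

theorem isFibrewiseSubspace_derivedFlag (hcov : cov.PreservesSmooth)
    (hW : IsFibrewiseSubspace W) (i : ℕ) : IsFibrewiseSubspace (cov.derivedFlag W i) := by
  induction i with
  | zero =>
    exact IsFibrewiseSubspace.sectionPart fun x => ⟨⟨(hW x).1,
      (isFibrewiseSubspace_curvatureKernel hcov x).1⟩, fun a b v hv w hw =>
      ⟨(hW x).2 a b v hv.1 w hw.1,
        (isFibrewiseSubspace_curvatureKernel hcov x).2 a b v hv.2 w hw.2⟩⟩
  | succ i ih => exact (isFibrewiseSubspace_secondFundamentalKernel ih).sectionPart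

theorem curvatureOp_eq_zero_of_parallel {U : Set M} {σ : Π x : M, V x}
    {X Y : Π x : M, TangentSpace 𝓘(ℝ, E) x} {x : M} (hU : IsOpen U) (hx : x ∈ U)
    (hpar : ∀ y ∈ U, cov σ y = 0) : cov.curvatureOp X Y σ x = 0 := by
  have key : ∀ Z : Π x : M, TangentSpace 𝓘(ℝ, E) x, cov (fun y => cov σ y (Z y)) x = 0 := by
    intro Z
    rw [cov.congr_of_eqOn hU hx (smoothSectionOn_zero U) fun y hy => by rw [hpar y hy]; rfl]
    simp
  unfold curvatureOp
  rw [key, key, hpar x hx]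
  simp

/-- A parallel section with values in `W` takes its values in the terminal subset. -/
theorem mem_terminalSubset_of_parallel (hcov : cov.PreservesSmooth)
    (hW : IsFibrewiseSubspace W) {U : Set M} {σ : Π x : M, V x} (hU : IsOpen U)
    (hσ : SmoothSectionOn 𝓘(ℝ, E) F σ U) (hpar : ∀ y ∈ U, cov σ y = 0)
    (hσW : ∀ y ∈ U, σ y ∈ W y) {x : M} (hx : x ∈ U) : σ x ∈ cov.terminalSubset W x := by
  refine mem_iInter.2 fun i => ?_
  suffices ∀ y ∈ U, σ y ∈ cov.derivedFlag W i y from this x hx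
  induction i with
  | zero =>
    refine fun y hy => ⟨U, σ, hU, hy, hσ, fun z hz => ⟨hσW z hz, ?_⟩, rfl⟩
    intro U' X Y τ hU' hz' hX hY hτ h
    rw [← curvatureOp_eq_of_eq hcov hU' hz' hX hY hτ hU hz hσ h.symm]
    exact curvatureOp_eq_zero_of_parallel hU hz hpar
  | succ i ih =>
    refine fun y hy => ⟨U, σ, hU, hy, hσ, fun z hz => ⟨U, σ, hU, hz, hσ, ih, rfl, fun v => ?_⟩, rfl⟩
    rw [hpar z hz]
    exact (isFibrewiseSubspace_derivedFlag hcov hW i z).1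

theorem terminalSubset_subset (x : M) : cov.terminalSubset W x ⊆ W x := by
  intro w hw
  have h := sectionPart_subset _ x (mem_iInter.1 hw 0)
  exact h.1

theorem terminalSubset_subset_curvatureKernel (x : M) :
    cov.terminalSubset W x ⊆ cov.curvatureKernel x := by
  intro w hw
  have h := sectionPart_subset _ x (mem_iInter.1 hw 0)
  exact h.2

/-- Descending chains of subspaces of a finite-dimensional fibre are stationary. The index depends
on `x`, as the ranks of the steps may jump. -/
theorem exists_derivedFlag_subset_terminalSubset (hcov : cov.PreservesSmooth)
    (hW : IsFibrewiseSubspace W) (x : M) :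
    ∃ k, cov.derivedFlag W k x ⊆ cov.terminalSubset W x := by
  have : FiniteDimensional ℝ (V x) := finiteDimensional_fiber F V x
  let p : ℕ →o (Submodule ℝ (V x))ᵒᵈ :=
    ⟨fun i => OrderDual.toDual ((isFibrewiseSubspace_derivedFlag hcov hW i).submodule x),
      monotone_nat_of_le_succ fun i => cov.derivedFlag_succ_subset W i x⟩
  obtain ⟨k, hk⟩ := IsArtinian.monotone_stabilizes p
  refine ⟨k, fun w hw => mem_iInter.2 fun i => ?_⟩
  rcases le_total k i with h | h
  · have : w ∈ OrderDual.ofDual (p i) := by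
      rw [← hk i h]
      exact hw
    exact this
  · exact p.monotone h hw

/-- A terminal subset which is a subbundle is preserved by the connection. -/
theorem mem_span_of_terminalSubset_eq [FiniteDimensional ℝ E] [T2Space M]
    (hcov : cov.PreservesSmooth) (hW : IsFibrewiseSubspace W) {r : ℕ} {e : Fin r → Π x : M, V x}
    {L : Π y, V y →ₗ[ℝ] (Fin r → ℝ)} {U : Set M} (hL : IsDualOn E F e L U)
    (hspan : ∀ y ∈ U, cov.terminalSubset W y = (Submodule.span ℝ (range fun i => e i y) : Set (V y)))
    {x : M} (hx : x ∈ U) (i : Fin r) (v : TangentSpace 𝓘(ℝ, E) x) :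
    cov (e i) x v ∈ Submodule.span ℝ (range fun j => e j x) := by
  have : LocallyCompactSpace M := Manifold.locallyCompact_of_finiteDimensional 𝓘(ℝ, E)
  by_contra hcon
  let X := coordField x (mvfderiv 𝓘(ℝ, E) (extChartAt 𝓘(ℝ, E) x) x v)
  have hxs : x ∈ (chartAt E x).source := mem_chart_source E x
  have hXx : X x = v := coordField_mvfderiv_extChartAt x hxs v
  let U₁ := U ∩ (chartAt E x).source
  have hU₁ : IsOpen U₁ := hL.isOpen.inter (chartAt E x).open_source
  have hτ : SmoothSectionOn 𝓘(ℝ, E) F (fun y => cov (e i) y (X y)) U₁ :=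
    hcov U₁ X (e i) hU₁ ((smooth_coordField x _).mono inter_subset_right)
      ((hL.smooth_frame i).mono inter_subset_left)
  let O := {y | y ∈ U₁ ∧ cov (e i) y (X y) ∉ Submodule.span ℝ (range fun j => e j y)}
  have hO : IsOpen O := hL.isOpen_notMem_span hU₁ inter_subset_left hτ
  have hxO : x ∈ O := ⟨⟨hx, hxs⟩, by rwa [hXx]⟩
  -- The points at which the `k`-th step is still larger than the terminal subset. This set is open:
  -- a vector outside the span extends to a section of the `k`-th step, which stays outside the span
  -- nearby.
  let D : ℕ → Set M := fun k => {y | y ∈ U ∧ ∃ w ∈ cov.derivedFlag W k y,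
    w ∉ Submodule.span ℝ (range fun j => e j y)}
  have hD : ∀ k, IsOpen (D k) := by
    intro k
    rw [isOpen_iff_mem_nhds]
    rintro y ⟨hy, w, hw, hws⟩
    obtain ⟨U', σ, hU', hy', hσ, hσk, rfl⟩ : ∃ (U' : Set M) (σ : Π x : M, V x), IsOpen U' ∧ y ∈ U' ∧
        SmoothSectionOn 𝓘(ℝ, E) F σ U' ∧ (∀ z ∈ U', σ z ∈ cov.derivedFlag W k z) ∧ σ y = w := by
      cases k <;> exact exists_section_of_mem_sectionPart hw
    have := hL.isOpen_notMem_span (hL.isOpen.inter hU') inter_subset_left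
      (hσ.mono inter_subset_right)
    filter_upwards [this.mem_nhds ⟨⟨hy, hy'⟩, hws⟩] with z hz
    exact ⟨hz.1.1, σ z, hσk z hz.1.2, hz.2⟩
  -- The closed sets `(D k)ᶜ` cover `M`, so by Baire their interiors are dense. Hence near some
  -- point `z` of the open set `O` of counterexamples a single step `k` of the flag equals the span.
  have hdense : Dense (⋃ k, interior (D k)ᶜ) := by
    refine dense_iUnion_interior_of_closed (fun k => (hD k).isClosed_compl) ?_
    refine eq_univ_of_forall fun y => mem_iUnion.2 ?_
    by_cases hy : y ∈ U
    · obtain ⟨k, hk⟩ := exists_derivedFlag_subset_terminalSubset hcov hW (cov := cov) y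
      refine ⟨k, ?_⟩
      rintro ⟨-, w, hw, hws⟩
      refine hws ?_
      have := hk hw
      rwa [hspan y hy] at this
    · exact ⟨0, fun h => hy h.1⟩
  obtain ⟨z, hzO, hz⟩ := hdense.inter_open_nonempty O hO ⟨x, hxO⟩
  obtain ⟨k, hzk⟩ := mem_iUnion.1 hz
  have hsub : ∀ y ∈ U, y ∈ interior (D k)ᶜ → ∀ w ∈ cov.derivedFlag W k y,
      w ∈ Submodule.span ℝ (range fun j => e j y) := by
    intro y hy hyk w hw
    by_contra hws
    exact interior_subset hyk ⟨hy, w, hw, hws⟩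
  have hzU : z ∈ U := hzO.1.1
  have hei : e i z ∈ cov.terminalSubset W z := by
    rw [hspan z hzU]
    exact Submodule.subset_span ⟨i, rfl⟩
  -- As `e i z` also lies in step `k + 1`, it belongs to the kernel of the second fundamental form
  -- of step `k`, which near `z` is the span.
  obtain ⟨U', σ, hU', hzU', hσ, hσk, hσz, hσv⟩ :=
    sectionPart_subset _ z (mem_iInter.1 hei (k + 1))
  let N := (U ∩ interior (D k)ᶜ) ∩ U'
  have hN : IsOpen N := (hL.isOpen.inter isOpen_interior).inter hU'
  have hzN : z ∈ N := ⟨⟨hzU, hzk⟩, hzU'⟩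
  have hNU : N ⊆ U := fun y hy => hy.1.1
  have hc := contMDiffOn_pi_space.1 (hL.smooth N σ hN hNU (hσ.mono inter_subset_right))
  have hsum : ∀ y ∈ N, σ y = (∑ j, (fun y => L y (σ y) j) • e j) y := by
    intro y hy
    have := (hL.mem_span_iff (hNU hy)).1 (hsub y hy.1.1 hy.1.2 _ (hσk y hy.2))
    refine (this.symm.trans (frameSum_apply ..)).trans ?_
    simp only [Finset.sum_apply, Pi.smul_apply']
  have hLz : L z (σ z) = Pi.single i 1 := by
    rw [hσz, ← hL.apply_frameSum z hzU (Pi.single i 1)]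
    congr 1
    simp [Pi.single_apply, ite_smul]
  refine hzO.2 ?_
  -- Since `σ` is a combination of the frame near `z` with value `e i z` at `z`, the derivatives of
  -- `σ` and of `e i` at `z` differ by an element of the span. This is the tensoriality of the
  -- second fundamental form.
  have h1 : cov σ z (X z) = cov (e i) z (X z)
      + ∑ j, mvfderiv 𝓘(ℝ, E) (fun y => L y (σ y) j) z (X z) • e j z := by
    rw [cov.congr_of_eqOn hN hzN (SmoothSectionOn.sum _ fun j _ =>
        ((hL.smooth_frame j).mono hNU).smul (hc j)) hsum,
      sum_smul_apply hN hzN hc fun j => (hL.smooth_frame j).mono hNU, Finset.sum_add_distrib,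
      hLz]
    simp [Pi.single_apply, ite_smul]
  rw [eq_sub_of_add_eq h1.symm]
  refine Submodule.sub_mem _ (hsub z hzU hzk _ (hσv _)) (Submodule.sum_mem _ fun j _ =>
    Submodule.smul_mem _ _ (Submodule.subset_span ⟨j, rfl⟩))

end CovariantDerivative

end FlagProperties

/-! ### The connection form of an invariant subbundle and its flatness -/

section ConnectionForm

set_option maxSynthPendingDepth 3

variable {E : Type*} [NormedAddCommGroup E] [NormedSpace ℝ E] [FiniteDimensional ℝ E]
  {M : Type*} [TopologicalSpace M] [ChartedSpace E M] [IsManifold 𝓘(ℝ, E) ∞ M]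
  {F : Type*} [NormedAddCommGroup F] [NormedSpace ℝ F]
  {V : M → Type*} [TopologicalSpace (TotalSpace F V)]
  [∀ x, AddCommGroup (V x)] [∀ x, Module ℝ (V x)] [∀ x : M, TopologicalSpace (V x)]
  [FiberBundle F V] [VectorBundle ℝ F V]
  [∀ x, IsTopologicalAddGroup (V x)] [∀ x, ContinuousSMul ℝ (V x)]

namespace CovariantDerivative

variable (cov : CovariantDerivative 𝓘(ℝ, E) F V) {r : ℕ} (e : Fin r → Π x : M, V x)
  (L : Π y, V y →ₗ[ℝ] (Fin r → ℝ)) (x₀ : M)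

/-- The matrix of the connection with respect to the frame `e` with left inverse `L`, in the
coordinates of the chart at `x₀`. -/
noncomputable def connectionForm (z : E) : E →L[ℝ] (Fin r → ℝ) →L[ℝ] (Fin r → ℝ) :=
  ∑ a, ∑ j, (LinearMap.toContinuousLinearMap ((finBasis ℝ E).coord a)).smulRight
    ((ContinuousLinearMap.proj (R := ℝ) (φ := fun _ : Fin r => ℝ) j).smulRight
      (inChart x₀ (fun y => L y (cov (e j) y (coordField x₀ (finBasis ℝ E a) y))) z))

/-- Linearity in `u` removes the basis of `E`, which serves the definition only to make smoothness
visible. -/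
theorem connectionForm_apply (z u : E) (c : Fin r → ℝ) :
    cov.connectionForm e L x₀ z u c = ∑ j, c j • L ((extChartAt 𝓘(ℝ, E) x₀).symm z)
      (cov (e j) ((extChartAt 𝓘(ℝ, E) x₀).symm z)
        (coordField x₀ u ((extChartAt 𝓘(ℝ, E) x₀).symm z))) := by
  let y := (extChartAt 𝓘(ℝ, E) x₀).symm z
  let T : Fin r → E →ₗ[ℝ] (Fin r → ℝ) := fun j =>
    { toFun := fun u => L y (cov (e j) y (coordField x₀ u y))
      map_add' := fun u v => by rw [coordField_add, map_add, map_add]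
      map_smul' := fun c u => by rw [coordField_smul, map_smul, map_smul]; rfl }
  have hT : ∀ j, T j u = ∑ a, (finBasis ℝ E).repr u a • T j (finBasis ℝ E a) := fun j => by
    conv_lhs => rw [← (finBasis ℝ E).sum_repr u, map_sum]
    simp only [map_smul]
  have h1 : cov.connectionForm e L x₀ z u c
      = ∑ a, ∑ j, (finBasis ℝ E).repr u a • c j • T j (finBasis ℝ E a) := by
    simp only [connectionForm, _root_.sum_apply]
    rfl
  rw [h1, Finset.sum_comm]
  refine Finset.sum_congr rfl fun j _ => ?_
  change _ = c j • T j u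
  rw [hT, Finset.smul_sum]
  exact Finset.sum_congr rfl fun a _ => smul_comm _ _ _

variable {cov e L x₀} {U : Set M}

theorem contDiffOn_connectionForm (hcov : cov.PreservesSmooth) (hL : IsDualOn E F e L U)
    (hU : U ⊆ (chartAt E x₀).source) :
    ContDiffOn ℝ ∞ (cov.connectionForm e L x₀)
      ((extChartAt 𝓘(ℝ, E) x₀).target ∩ (extChartAt 𝓘(ℝ, E) x₀).symm ⁻¹' U) := by
  unfold connectionForm
  refine ContDiffOn.sum fun a _ => ContDiffOn.sum fun j _ => ?_
  have h := contDiffOn_inChart (x₀ := x₀) (hL.smooth U _ hL.isOpen subset_rfl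
    (hcov U _ _ hL.isOpen ((smooth_coordField x₀ (finBasis ℝ E a)).mono hU) (hL.smooth_frame j)))
  exact contDiffOn_const.smulRight (contDiffOn_const.smulRight h)

variable (hL : IsDualOn E F e L U) (hU : U ⊆ (chartAt E x₀).source)
  (hmem : ∀ y ∈ U, ∀ i v, cov (e i) y v ∈ Submodule.span ℝ (range fun j => e j y))

include hL hU hmem

/-- By `hmem` the derivatives of the frame lie in its span, so nothing is lost on applying `L`. -/
theorem sum_smul_cov_eq_frameSum {y : M} (hy : y ∈ U) (u : E) (c : Fin r → ℝ) :
    ∑ j, c j • cov (e j) y (coordField x₀ u y)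
      = frameSum e (cov.connectionForm e L x₀ (extChartAt 𝓘(ℝ, E) x₀ y) u c) y := by
  have hy' : y ∈ (extChartAt 𝓘(ℝ, E) x₀).source := by
    rw [extChartAt_source]; exact hU hy
  rw [connectionForm_apply, (extChartAt 𝓘(ℝ, E) x₀).left_inv hy']
  simp only [← map_smul, ← map_sum]
  refine ((hL.mem_span_iff hy).1 (Submodule.sum_mem _ fun j _ => ?_)).symm
  exact hmem y hy j _

/-- The Leibniz rule, `∇(e f) = e (df + Ω f)`: the section `e f` is parallel if and only if `df = -Ω
f`. -/
theorem cov_sum_smul_eq_frameSum {W : Set M} (hW : IsOpen W) (hWU : W ⊆ U) {f : M → Fin r → ℝ}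
    (hf : ContMDiffOn 𝓘(ℝ, E) 𝓘(ℝ, Fin r → ℝ) ∞ f W) {y : M} (hy : y ∈ W) (u : E) :
    cov (∑ j, (fun y => f y j) • e j) y (coordField x₀ u y)
      = frameSum e (mvfderiv 𝓘(ℝ, E) f y (coordField x₀ u y)
        + cov.connectionForm e L x₀ (extChartAt 𝓘(ℝ, E) x₀ y) u (f y)) y := by
  have hfj : ∀ j, ContMDiffOn 𝓘(ℝ, E) 𝓘(ℝ) ∞ (fun y => f y j) W := contMDiffOn_pi_space.1 hf
  have hd : ∀ j, mvfderiv 𝓘(ℝ, E) (fun y => f y j) y (coordField x₀ u y)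
      = mvfderiv 𝓘(ℝ, E) f y (coordField x₀ u y) j := by
    intro j
    rw [mvfderiv_coordField x₀ (hU (hWU hy))
      (((hfj j).contMDiffAt (hW.mem_nhds hy)).mdifferentiableAt (by simp)),
      mvfderiv_coordField x₀ (hU (hWU hy))
        ((hf.contMDiffAt (hW.mem_nhds hy)).mdifferentiableAt (by simp))]
    have hdiff := mdifferentiableAt_inChart (hU (hWU hy))
      ((hf.contMDiffAt (hW.mem_nhds hy)).mdifferentiableAt (by simp))
    have := (hasFDerivAt_pi'.1 hdiff.hasFDerivAt j).fderiv
    exact congrArg (fun T => T u) this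
  rw [sum_smul_apply hW hy hfj (fun j => (hL.smooth_frame j).mono hWU), Finset.sum_add_distrib,
    sum_smul_cov_eq_frameSum hL hU hmem (hWU hy), frameSum_apply, frameSum_apply,
    ← Finset.sum_add_distrib]
  refine Finset.sum_congr rfl fun j _ => ?_
  rw [hd, Pi.add_apply, add_smul, add_comm]

-- Coordinate fields commute, so the curvature on `e i` is a commutator of covariant derivatives,
-- and its coefficients form the `i`-th column of `dΩ + Ω ∧ Ω`.
set_option synthInstance.maxHeartbeats 200000 in
theorem connectionForm_flat (hcov : cov.PreservesSmooth)
    (hcurv : ∀ y ∈ U, ∀ i u v, cov.curvatureOp (coordField x₀ u) (coordField x₀ v) (e i) y = 0)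
    {z : E} (hz : z ∈ (extChartAt 𝓘(ℝ, E) x₀).target ∩ (extChartAt 𝓘(ℝ, E) x₀).symm ⁻¹' U)
    (u v : E) :
    fderiv ℝ (cov.connectionForm e L x₀) z u v - fderiv ℝ (cov.connectionForm e L x₀) z v u
      + (cov.connectionForm e L x₀ z u).comp (cov.connectionForm e L x₀ z v)
      - (cov.connectionForm e L x₀ z v).comp (cov.connectionForm e L x₀ z u) = 0 := by
  set φ := extChartAt 𝓘(ℝ, E) x₀ with hφ
  set Ω := cov.connectionForm e L x₀ with hΩ
  set Z := φ.target ∩ φ.symm ⁻¹' U with hZ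
  have hZo : IsOpen Z := isOpen_inChart hL.isOpen x₀
  have hΩs : ContDiffOn ℝ ∞ Ω Z := contDiffOn_connectionForm hcov hL hU
  obtain ⟨y, hy, rfl⟩ : ∃ y, y ∈ U ∧ φ y = z := ⟨φ.symm z, hz.2, φ.right_inv hz.1⟩
  have hUe : ∀ {y}, y ∈ U → y ∈ φ.source := fun {y} hy => by
    rw [hφ, extChartAt_source]; exact hU hy
  suffices ∀ i, (fderiv ℝ Ω (φ y) u v - fderiv ℝ Ω (φ y) v u + (Ω (φ y) u).comp (Ω (φ y) v)
      - (Ω (φ y) v).comp (Ω (φ y) u)) (Pi.single i 1) = 0 by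
    refine ContinuousLinearMap.coe_injective (LinearMap.pi_ext' fun i => LinearMap.ext_ring ?_)
    exact this i
  intro i
  -- The coefficients of the derivative of `e i` along the coordinate field of `v`; differentiating
  -- once more is then a case of `cov_sum_smul_eq_frameSum`.
  let f : E → M → Fin r → ℝ := fun v y => Ω (φ y) v (Pi.single i 1)
  have hfs : ∀ v, ContMDiffOn 𝓘(ℝ, E) 𝓘(ℝ, Fin r → ℝ) ∞ (f v) U := by
    intro v
    have h1 : ContDiffOn ℝ ∞ (fun z => Ω z v (Pi.single i 1)) Z :=
      (hΩs.clm_apply contDiffOn_const).clm_apply contDiffOn_const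
    exact h1.contMDiffOn.comp (contMDiffOn_extChartAt.mono hU) fun y hy => mem_inChart (hU hy) hy
  have hfe : ∀ v, ∀ y ∈ U, cov (e i) y (coordField x₀ v y) = (∑ j, (fun y => f v y j) • e j) y := by
    intro v y hy
    have h1 := sum_smul_cov_eq_frameSum hL hU hmem hy v (Pi.single i 1)
    have h2 : ∑ j, (Pi.single i 1 : Fin r → ℝ) j • cov (e j) y (coordField x₀ v y)
        = cov (e i) y (coordField x₀ v y) := by
      simp [Pi.single_apply, ite_smul]
    rw [← h2, h1, frameSum_apply, Finset.sum_apply]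
    rfl
  have hfd : ∀ u v, mvfderiv 𝓘(ℝ, E) (f v) y (coordField x₀ u y)
      = fderiv ℝ Ω (φ y) u v (Pi.single i 1) := by
    intro u v
    rw [mvfderiv_coordField x₀ (hU hy)
      (((hfs v).contMDiffAt (hL.isOpen.mem_nhds hy)).mdifferentiableAt (by simp))]
    have h1 : inChart x₀ (f v) =ᶠ[𝓝 (φ y)] fun z => Ω z v (Pi.single i 1) := by
      filter_upwards [hZo.mem_nhds (mem_inChart (hU hy) hy)] with z hz
      simp only [inChart, Function.comp_apply, f]
      rw [← hφ, φ.right_inv hz.1]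
    have h2 : HasFDerivAt Ω (fderiv ℝ Ω (φ y)) (φ y) :=
      ((hΩs.contDiffAt (hZo.mem_nhds (mem_inChart (hU hy) hy))).differentiableAt
        (by simp)).hasFDerivAt
    have h3 := (h2.clm_apply (hasFDerivAt_const v _)).clm_apply
      (hasFDerivAt_const (Pi.single i (1 : ℝ)) _)
    rw [← hφ, h1.fderiv_eq, h3.fderiv]
    simp
  have hcc : ∀ u v, cov (fun y => cov (e i) y (coordField x₀ v y)) y (coordField x₀ u y)
      = frameSum e (fderiv ℝ Ω (φ y) u v (Pi.single i 1)
        + Ω (φ y) u (Ω (φ y) v (Pi.single i 1))) y := by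
    intro u v
    have h1 := cov_sum_smul_eq_frameSum hL hU hmem hL.isOpen subset_rfl (hfs v) hy u
    rw [hfd] at h1
    rw [← h1]
    exact congrArg (fun T => T (coordField x₀ u y)) (cov.congr_of_eqOn hL.isOpen hy
      (SmoothSectionOn.sum _ fun j _ => (hL.smooth_frame j).smul
        (contMDiffOn_pi_space.1 (hfs v) j)) (hfe v))
  have h := hcurv y hy i u v
  rw [curvatureOp, hcc, hcc, mlieBracket_coordField x₀ u v (hU hy), map_zero, sub_zero] at h
  have h' := congrArg (L y) h
  rw [map_sub, hL.apply_frameSum y hy, hL.apply_frameSum y hy, map_zero] at h'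
  rw [← h']
  simp only [_root_.sub_apply, _root_.add_apply,
    ContinuousLinearMap.comp_apply]
  abel

end CovariantDerivative

end ConnectionForm

/-! ### Local parallel frames and global parallel sections -/

section ParallelSections

variable {E : Type*} [NormedAddCommGroup E] [NormedSpace ℝ E]
  {M : Type*} [TopologicalSpace M] [ChartedSpace E M] [IsManifold 𝓘(ℝ, E) ∞ M]
  {G : Type*} [NormedAddCommGroup G] [NormedSpace ℝ G]

theorem eventually_eq_of_mvfderiv_eq_zero {f : M → G} {U : Set M} (hU : IsOpen U)
    (hf : ContMDiffOn 𝓘(ℝ, E) 𝓘(ℝ, G) ∞ f U)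
    (h : ∀ y ∈ U, ∀ v, mvfderiv 𝓘(ℝ, E) f y v = 0) {x : M} (hx : x ∈ U) :
    ∀ᶠ y in 𝓝 x, f y = f x := by
  have hxs : x ∈ (chartAt E x).source := mem_chart_source E x
  set φ := extChartAt 𝓘(ℝ, E) x with hφ
  obtain ⟨ε, hε, hball⟩ := Metric.isOpen_iff.1 (isOpen_inChart hU x) _ (mem_inChart hxs hx)
  have hball' : Metric.ball (φ x) ε ⊆ φ.target ∩ φ.symm ⁻¹' U := hball
  have hsrc : ∀ z ∈ φ.target, φ.symm z ∈ (chartAt E x).source := fun z hz => by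
    have := φ.map_target hz
    rwa [hφ, extChartAt_source] at this
  have hmd : ∀ z ∈ Metric.ball (φ x) ε, MDifferentiableAt 𝓘(ℝ, E) 𝓘(ℝ, G) f (φ.symm z) :=
    fun z hz => (hf.contMDiffAt (hU.mem_nhds (hball' hz).2)).mdifferentiableAt (by simp)
  have hd : DifferentiableOn ℝ (inChart x f) (Metric.ball (φ x) ε) := fun z hz => by
    have := mdifferentiableAt_inChart (hsrc z (hball' hz).1) (hmd z hz)
    rw [← hφ, φ.right_inv (hball' hz).1] at this
    exact this.differentiableWithinAt
  have hd0 : EqOn (fderiv ℝ (inChart x f)) 0 (Metric.ball (φ x) ε) := fun z hz => by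
    ext v
    have := mvfderiv_coordField x (hsrc z (hball' hz).1) (hmd z hz) v
    rw [h _ (hball' hz).2, ← hφ, φ.right_inv (hball' hz).1] at this
    exact this.symm
  have hnhds : φ ⁻¹' Metric.ball (φ x) ε ∈ 𝓝 x :=
    (continuousAt_extChartAt (I := 𝓘(ℝ, E)) x).preimage_mem_nhds (Metric.ball_mem_nhds _ hε)
  filter_upwards [hnhds, extChartAt_source_mem_nhds (I := 𝓘(ℝ, E)) x] with y hy hys
  have := Metric.isOpen_ball.is_const_of_fderiv_eq_zero (convex_ball _ _).isPreconnected hd hd0 hy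
    (Metric.mem_ball_self hε)
  rwa [inChart, Function.comp_apply, Function.comp_apply, ← hφ, φ.left_inv hys,
    φ.left_inv (mem_extChartAt_source x)] at this

variable [FiniteDimensional ℝ E]
  {F : Type*} [NormedAddCommGroup F] [NormedSpace ℝ F]
  {V : M → Type*} [TopologicalSpace (TotalSpace F V)]
  [∀ x, AddCommGroup (V x)] [∀ x, Module ℝ (V x)] [∀ x : M, TopologicalSpace (V x)]
  [FiberBundle F V] [VectorBundle ℝ F V]
  [∀ x, IsTopologicalAddGroup (V x)] [∀ x, ContinuousSMul ℝ (V x)]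

namespace CovariantDerivative

variable {cov : CovariantDerivative 𝓘(ℝ, E) F V} {W : Π x : M, Set (V x)}

/-- The coefficients of a parallel section with respect to a parallel frame are locally constant. -/
theorem eventually_coeff_eq {r : ℕ} {e : Fin r → Π x : M, V x} {L : Π y, V y →ₗ[ℝ] (Fin r → ℝ)}
    {U : Set M} (hL : IsDualOn E F e L U) (hpar : ∀ i, ∀ y ∈ U, cov (e i) y = 0)
    {σ : Π x : M, V x} {U' : Set M} (hU' : IsOpen U') (hUU : U' ⊆ U)
    (hσ : SmoothSectionOn 𝓘(ℝ, E) F σ U') (hσpar : ∀ y ∈ U', cov σ y = 0)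
    (hmem : ∀ y ∈ U', σ y ∈ Submodule.span ℝ (range fun j => e j y)) {x : M} (hx : x ∈ U') :
    ∀ᶠ y in 𝓝 x, L y (σ y) = L x (σ x) := by
  have hs := hL.smooth U' σ hU' hUU hσ
  have hsj := contMDiffOn_pi_space.1 hs
  have key : ∀ j, ∀ᶠ y in 𝓝 x, L y (σ y) j = L x (σ x) j := by
    intro j
    refine eventually_eq_of_mvfderiv_eq_zero hU' (hsj j) (fun y hy v => ?_) hx
    have hsum : ∀ z ∈ U', σ z = (∑ j, (fun y => L y (σ y) j) • e j) z := fun z hz =>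
      ((hL.mem_span_iff (hUU hz)).1 (hmem z hz)).symm.trans
        ((frameSum_apply ..).trans (by simp only [Finset.sum_apply, Pi.smul_apply']))
    have he : ∀ j, SmoothSectionOn 𝓘(ℝ, E) F (e j) U' := fun j => (hL.smooth_frame j).mono hUU
    have h1 := congrArg (fun T => T v) (cov.congr_of_eqOn hU' hy
      (SmoothSectionOn.sum Finset.univ fun j _ => (he j).smul (hsj j)) hsum)
    simp only [hσpar y hy, sum_smul_apply hU' hy hsj he, hpar _ y (hUU hy)] at h1
    have h2 : frameSum e (fun j => mvfderiv 𝓘(ℝ, E) (fun y => L y (σ y) j) y v) y = 0 := by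
      rw [frameSum_apply]
      simpa using h1.symm
    have h3 := hL.apply_frameSum y (hUU hy) fun j => mvfderiv 𝓘(ℝ, E) (fun y => L y (σ y) j) y v
    rw [h2, map_zero] at h3
    exact (congrFun h3 j).symm
  filter_upwards [Filter.eventually_all.2 key] with y hy
  exact funext hy

/-- The coefficients are a solution of `df = -Ω f` in the chart, with initial value `c`, given by
`exists_solution_of_flat`. -/
theorem exists_parallel_through [FiniteDimensional ℝ F] [ContMDiffVectorBundle ∞ F V 𝓘(ℝ, E)]
    (hcov : cov.PreservesSmooth) {r : ℕ} {e : Fin r → Π x : M, V x}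
    {L : Π y, V y →ₗ[ℝ] (Fin r → ℝ)} {U : Set M} (hL : IsDualOn E F e L U)
    (hmem : ∀ y ∈ U, ∀ i v, cov (e i) y v ∈ Submodule.span ℝ (range fun j => e j y)) {x : M}
    (hx : x ∈ U) (hU : U ⊆ (chartAt E x).source)
    (hcurv : ∀ y ∈ U, ∀ i u v, cov.curvatureOp (coordField x u) (coordField x v) (e i) y = 0)
    (c : Fin r → ℝ) :
    ∃ (U' : Set M) (σ : Π x : M, V x), IsOpen U' ∧ x ∈ U' ∧ U' ⊆ U ∧
      SmoothSectionOn 𝓘(ℝ, E) F σ U' ∧ (∀ y ∈ U', cov σ y = 0) ∧ σ x = frameSum e c x ∧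
      ∀ y, σ y ∈ Submodule.span ℝ (range fun j => e j y) := by
  obtain ⟨Z, f, hZ, hxZ, hZU, hfx, hf, hfd⟩ := exists_solution_of_flat
    (isOpen_inChart hL.isOpen x) (mem_inChart (hU hx) hx) (contDiffOn_connectionForm hcov hL hU)
    (fun z hz u v => connectionForm_flat hL hU hmem hcov hcurv hz u v) c
  set φ := extChartAt 𝓘(ℝ, E) x with hφ
  let U' := φ.source ∩ φ ⁻¹' Z
  have hU' : IsOpen U' :=
    (continuousOn_extChartAt (I := 𝓘(ℝ, E)) x).isOpen_inter_preimage (isOpen_extChartAt_source x) hZ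
  have hUU : U' ⊆ U := fun y hy => by
    have := (hZU hy.2).2
    rwa [mem_preimage, φ.left_inv hy.1] at this
  have hg : ContMDiffOn 𝓘(ℝ, E) 𝓘(ℝ, Fin r → ℝ) ∞ (f ∘ φ) U' :=
    hf.contMDiffOn.comp (contMDiffOn_extChartAt.mono (hUU.trans hU)) fun y hy => hy.2
  have he : ∀ j, SmoothSectionOn 𝓘(ℝ, E) F (e j) U' := fun j => (hL.smooth_frame j).mono hUU
  have hval : ∀ y, (∑ j, (fun y => (f ∘ φ) y j) • e j) y = frameSum e (f (φ y)) y := fun y => by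
    rw [frameSum_apply, Finset.sum_apply]
    rfl
  refine ⟨U', ∑ j, (fun y => (f ∘ φ) y j) • e j, hU', ⟨mem_extChartAt_source x, hxZ⟩, hUU,
    SmoothSectionOn.sum _ fun j _ => (he j).smul (contMDiffOn_pi_space.1 hg j), fun y hy => ?_, ?_,
    fun y => ?_⟩
  · ext w
    rw [← coordField_mvfderiv_extChartAt x (hU (hUU hy)) w,
      cov_sum_smul_eq_frameSum hL hU hmem hU' hUU hg hy,
      mvfderiv_coordField x (hU (hUU hy))
        ((hg.contMDiffAt (hU'.mem_nhds hy)).mdifferentiableAt (by simp))]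
    have hev : inChart x (f ∘ φ) =ᶠ[𝓝 (φ y)] f := by
      filter_upwards [hZ.mem_nhds hy.2] with z hz
      simp only [inChart, Function.comp_apply]
      rw [← hφ, φ.right_inv (hZU hz).1]
    rw [← hφ, hev.fderiv_eq, (hfd _ hy.2).fderiv]
    simp
  · rw [hval, hfx]
  · rw [hval]
    exact IsDualOn.frameSum_mem_span _ _

variable [FiniteDimensional ℝ F] [ContMDiffVectorBundle ∞ F V 𝓘(ℝ, E)] [T2Space M]

/-- The parallel sections through the vectors `e i x` stay in the span of `e` and are independent
near `x`; equality of dimensions makes them a frame of the terminal subset. -/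
theorem exists_parallel_frame (hcov : cov.PreservesSmooth) (hW : IsFibrewiseSubspace W) {x : M}
    (hreg : IsSubbundleAt 𝓘(ℝ, E) F (cov.terminalSubset W) x) :
    ∃ (r : ℕ) (U : Set M) (s : Fin r → Π x : M, V x) (L : Π y, V y →ₗ[ℝ] (Fin r → ℝ)), x ∈ U ∧
      IsDualOn E F s L U ∧ (∀ i, ∀ y ∈ U, cov (s i) y = 0) ∧
      ∀ y ∈ U, cov.terminalSubset W y = (Submodule.span ℝ (range fun i => s i y) : Set (V y)) := by
  have : CompleteSpace E := FiniteDimensional.complete ℝ E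
  obtain ⟨U₀, r, e, hU₀, hx₀, he, hspan⟩ := hreg
  obtain ⟨U₁, L₁, hx₁, hU₁, hL₁⟩ := exists_isDualOn hU₀ hx₀ he (hspan x hx₀).1
  let U := U₁ ∩ (chartAt E x).source
  have hUo : IsOpen U := hL₁.isOpen.inter (chartAt E x).open_source
  have hx : x ∈ U := ⟨hx₁, mem_chart_source E x⟩
  have hL := hL₁.mono hUo inter_subset_left
  have hspan' : ∀ y ∈ U, cov.terminalSubset W y
      = (Submodule.span ℝ (range fun i => e i y) : Set (V y)) := fun y hy => (hspan y (hU₁ hy.1)).2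
  have hmem : ∀ y ∈ U, ∀ i v, cov (e i) y v ∈ Submodule.span ℝ (range fun j => e j y) :=
    fun y hy i v => mem_span_of_terminalSubset_eq hcov hW hL hspan' hy i v
  have hcurv : ∀ y ∈ U, ∀ i u v,
      cov.curvatureOp (coordField x u) (coordField x v) (e i) y = 0 := by
    intro y hy i u v
    have h1 : e i y ∈ cov.terminalSubset W y := by
      rw [hspan' y hy]
      exact Submodule.subset_span ⟨i, rfl⟩
    exact terminalSubset_subset_curvatureKernel y h1 U _ _ (e i) hUo hy
      ((smooth_coordField x u).mono inter_subset_right)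
      ((smooth_coordField x v).mono inter_subset_right) (hL.smooth_frame i) rfl
  choose U₂ s hU₂ hx₂ hU₂U hs hspar hsx hsmem using fun i => exists_parallel_through hcov hL hmem hx
    inter_subset_right hcurv (Pi.single i 1)
  have hsx' : ∀ i, s i x = e i x := fun i => by
    rw [hsx, frameSum_apply]
    simp [Pi.single_apply, ite_smul]
  obtain ⟨U₃, L₃, hx₃, hU₃, hL₃⟩ := exists_isDualOn (U := U ∩ ⋂ i, U₂ i) (e := s)
    (hUo.inter (isOpen_iInter_of_finite hU₂)) ⟨hx, mem_iInter.2 hx₂⟩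
    (fun i => (hs i).mono fun y hy => mem_iInter.1 hy.2 i)
    (by simpa only [hsx'] using (hspan x hx₀).1)
  refine ⟨r, U₃, s, L₃, hx₃, hL₃, fun i y hy => hspar i y (mem_iInter.1 (hU₃ hy).2 i),
    fun y hy => ?_⟩
  rw [hspan' y (hU₃ hy).1]
  congr 1
  have : Module.Finite ℝ (Submodule.span ℝ (range fun i => e i y)) :=
    FiniteDimensional.span_of_finite ℝ (finite_range _)
  refine (Submodule.eq_of_le_of_finrank_eq (Submodule.span_le.2 ?_) ?_).symm
  · rintro _ ⟨i, rfl⟩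
    exact hsmem i y
  · rw [finrank_span_eq_card (hL₃.linearIndependent hy),
      finrank_span_eq_card (hL.linearIndependent (hU₃ hy).1)]

/-- The rank is locally constant and `M` is connected. A common `r` provides the single model fibre
`Fin r → ℝ` of the local system. -/
theorem exists_parallel_frame_of_rank [PreconnectedSpace M] [Nonempty M] (hcov : cov.PreservesSmooth)
    (hW : IsFibrewiseSubspace W)
    (hreg : ∀ x, IsSubbundleAt 𝓘(ℝ, E) F (cov.terminalSubset W) x) :
    ∃ r : ℕ, (∀ x, finrank ℝ (Submodule.span ℝ (cov.terminalSubset W x)) = r) ∧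
    ∀ x, ∃ (U : Set M) (s : Fin r → Π x : M, V x) (L : Π y, V y →ₗ[ℝ] (Fin r → ℝ)), x ∈ U ∧
      IsDualOn E F s L U ∧ (∀ i, ∀ y ∈ U, cov (s i) y = 0) ∧
      ∀ y ∈ U, cov.terminalSubset W y = (Submodule.span ℝ (range fun i => s i y) : Set (V y)) := by
  let ρ : M → ℕ := fun x => finrank ℝ (Submodule.span ℝ (cov.terminalSubset W x))
  choose k U s L hxU hL hpar hspan using fun x => exists_parallel_frame hcov hW (hreg x)
  have hρ : ∀ x, ∀ y ∈ U x, ρ y = k x := by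
    intro x y hy
    simp only [ρ]
    rw [hspan x y hy, Submodule.span_span, finrank_span_eq_card ((hL x).linearIndependent hy)]
    exact Fintype.card_fin _
  have hlc : IsLocallyConstant ρ := by
    rw [IsLocallyConstant.iff_eventually_eq]
    intro x
    filter_upwards [(hL x).isOpen.mem_nhds (hxU x)] with y hy
    rw [hρ x y hy, hρ x x (hxU x)]
  have x₀ : M := Classical.arbitrary M
  refine ⟨ρ x₀, fun x => hlc.apply_eq_of_preconnectedSpace x x₀, fun x => ?_⟩
  have : k x = ρ x₀ := by
    rw [← hρ x x (hxU x)]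
    exact hlc.apply_eq_of_preconnectedSpace x x₀
  rw [← this]
  exact ⟨U x, s x, L x, hxU x, hL x, hpar x, hspan x⟩

variable (cov W) in
/-- A global smooth parallel section with values in the terminal subset. -/
structure IsGlobalParallel (σ : Π x : M, V x) : Prop where
  smooth : SmoothSectionOn 𝓘(ℝ, E) F σ univ
  parallel : ∀ y, cov σ y = 0
  mem : ∀ y, σ y ∈ cov.terminalSubset W y

/-- The zero set is closed, and it is open because the coefficients with respect to a local parallel
frame are locally constant. -/
theorem IsGlobalParallel.eq_zero [PreconnectedSpace M] {σ : Π x : M, V x}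
    (h : cov.IsGlobalParallel W σ) (hcov : cov.PreservesSmooth) (hW : IsFibrewiseSubspace W)
    (hreg : ∀ x, IsSubbundleAt 𝓘(ℝ, E) F (cov.terminalSubset W) x) {x : M} (hx : σ x = 0) (y : M) :
    σ y = 0 := by
  have hclosed : IsClosed {y | σ y = 0} := by
    have := isOpen_section_ne_zero isOpen_univ h.smooth
    rw [← isOpen_compl_iff]
    convert this using 1
    ext y
    simp
  have hopen : IsOpen {y | σ y = 0} := by
    rw [isOpen_iff_mem_nhds]
    intro y (hy : σ y = 0)
    obtain ⟨r, U, s, L, hyU, hL, hpar, hspan⟩ := exists_parallel_frame hcov hW (hreg y)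
    have hmem : ∀ z ∈ U, σ z ∈ Submodule.span ℝ (range fun j => s j z) := fun z hz => by
      have := h.mem z
      rwa [hspan z hz] at this
    filter_upwards [hL.isOpen.mem_nhds hyU, eventually_coeff_eq hL hpar hL.isOpen subset_rfl
      (h.smooth.mono (subset_univ _)) (fun z _ => h.parallel z) hmem hyU] with z hz hz'
    have := (hL.mem_span_iff hz).1 (hmem z hz)
    rw [hz', hy, map_zero, frameSum_apply] at this
    simpa using this.symm
  have huniv := IsClopen.eq_univ ⟨hclosed, hopen⟩ ⟨x, hx⟩
  have : y ∈ {y | σ y = 0} := huniv ▸ mem_univ y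
  exact this

/-- On a simply connected manifold every element of a regular terminal subset extends to a global
parallel section. -/
theorem exists_isGlobalParallel [SimplyConnectedSpace M] (hcov : cov.PreservesSmooth)
    (hW : IsFibrewiseSubspace W)
    (hreg : ∀ x, IsSubbundleAt 𝓘(ℝ, E) F (cov.terminalSubset W) x) {x : M} {w : V x}
    (hw : w ∈ cov.terminalSubset W x) : ∃ σ, cov.IsGlobalParallel W σ ∧ σ x = w := by
  classical
  have : LocallyPathConnectedSpace M := ChartedSpace.locallyPathConnectedSpace E M
  obtain ⟨r, -, hframe⟩ := exists_parallel_frame_of_rank hcov hW hreg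
  choose U s L hxU hL hpar hspan using hframe
  have hmem : ∀ i, ∀ y ∈ U i, ∀ k, frameSum (s i) k y ∈ cov.terminalSubset W y := by
    intro i y hy k
    rw [hspan i y hy]
    exact IsDualOn.frameSum_mem_span _ _
  have hz : ∀ y, (0 : V y) ∈ cov.terminalSubset W y := by
    intro y
    rw [hspan y y (hxU y)]
    exact Submodule.zero_mem _
  let φ : M → ∀ y, (Fin r → ℝ) → cov.terminalSubset W y := fun i y k =>
    if hy : y ∈ U i then ⟨frameSum (s i) k y, hmem i y hy k⟩ else ⟨0, hz y⟩
  have hφ : ∀ i, ∀ y ∈ U i, ∀ k, (φ i y k : V y) = frameSum (s i) k y := fun i y hy k => by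
    simp only [φ, dif_pos hy]
  have hmem' : ∀ i, ∀ y ∈ U i, ∀ t ∈ cov.terminalSubset W y,
      t ∈ Submodule.span ℝ (range fun j => s i j y) := fun i y hy t ht => by
    rwa [hspan i y hy] at ht
  -- The fibres are those of the terminal subset, with coordinates given by the parallel frames.
  -- Coordinate changes are locally constant by `eventually_coeff_eq`.
  obtain ⟨σ, hσ, hσloc⟩ := exists_section_of_localSystem (K := Fin r → ℝ)
    (T := fun y => cov.terminalSubset W y) U (fun i => (hL i).isOpen) hxU
    (fun i y t => L i y t) φ
    (fun i y hy t => Subtype.ext <| by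
      rw [hφ i y hy]
      exact ((hL i).mem_span_iff hy).1 (hmem' i y hy t t.2))
    (fun i y hy k => by
      rw [hφ i y hy, (hL i).apply_frameSum y hy])
    (fun i j y hy k => by
      have hU : IsOpen (U i ∩ U j) := (hL i).isOpen.inter (hL j).isOpen
      filter_upwards [hU.mem_nhds hy, eventually_coeff_eq (hL j) (hpar j) hU inter_subset_right
        ((smooth_frameSum (hL i).smooth_frame k).mono inter_subset_left)
        (fun z hz => by
          ext v
          rw [frameSum, sum_apply _ (hL i).isOpen hz.1
            (fun m => ((hL i).smooth_frame m).const_smul (k m))]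
          simp only [const_smul_apply (hL i).isOpen hz.1 _ ((hL i).smooth_frame _),
            hpar i _ z hz.1]
          simp)
        (fun z hz => hmem' j z hz.2 _ (hmem i z hz.1 k)) hy] with z hz hz'
      rw [hφ i z hz.1, hφ i y hy.1, hz'])
    x ⟨w, hw⟩
  -- Near every point the section has constant coefficients in a parallel frame, which makes it both
  -- smooth and parallel.
  have hloc : ∀ y, ∃ N : Set M, ∃ k, IsOpen N ∧ y ∈ N ∧ N ⊆ U y ∧
      ∀ z ∈ N, (σ z : V z) = frameSum (s y) k z := by
    intro y
    obtain ⟨N, hN, hNo, hyN⟩ := mem_nhds_iff.1 (Filter.inter_mem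
      ((hL y).isOpen.mem_nhds (hxU y)) (hσloc y y (hxU y)))
    refine ⟨N, L y y (σ y), hNo, hyN, fun z hz => (hN hz).1, fun z hz => ?_⟩
    have h1 := ((hL y).mem_span_iff (hN hz).1).1 (hmem' y z (hN hz).1 _ (σ z).2)
    have h2 : L y z (σ z) = L y y (σ y) := (hN hz).2
    rw [← h2, h1]
  refine ⟨fun y => σ y, ⟨fun y _ => ?_, fun y => ?_, fun y => (σ y).2⟩, congrArg Subtype.val hσ⟩
  · obtain ⟨N, k, hN, hy, hNU, h⟩ := hloc y
    have := ((smooth_frameSum (hL y).smooth_frame k).mono hNU).congr h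
    exact (ContMDiffOn.contMDiffAt this (hN.mem_nhds hy)).contMDiffWithinAt
  · obtain ⟨N, k, hN, hy, hNU, h⟩ := hloc y
    have hk : ∀ i, SmoothSectionOn 𝓘(ℝ, E) F (k i • s y i) N := fun i =>
      (((hL y).smooth_frame i).mono hNU).const_smul (k i)
    rw [cov.congr_of_eqOn hN hy (SmoothSectionOn.sum _ fun i _ => hk i) h]
    ext v
    rw [sum_apply _ hN hy hk]
    simp only [const_smul_apply (hL y).isOpen (hxU y) _ ((hL y).smooth_frame _),
      hpar y _ y (hxU y)]
    simp

end CovariantDerivative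

end ParallelSections

/-! ### Smoothness of the induced connection on bilinear forms -/

section InducedConnection

variable {E : Type*} [NormedAddCommGroup E] [NormedSpace ℝ E] [FiniteDimensional ℝ E]
  {M : Type*} [TopologicalSpace M] [ChartedSpace E M] [IsManifold 𝓘(ℝ, E) ∞ M]

/-- A smooth covariant derivative is smooth on local sections. -/
theorem CovariantDerivative.ContMDiffCovariantDerivative.preservesSmooth [T2Space M]
    {F : Type*} [NormedAddCommGroup F] [NormedSpace ℝ F]
    {V : M → Type*} [TopologicalSpace (TotalSpace F V)]
    [∀ x, AddCommGroup (V x)] [∀ x, Module ℝ (V x)] [∀ x : M, TopologicalSpace (V x)]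
    [FiberBundle F V] [VectorBundle ℝ F V] [ContMDiffVectorBundle ∞ F V 𝓘(ℝ, E)]
    [∀ x, IsTopologicalAddGroup (V x)] [∀ x, ContinuousSMul ℝ (V x)]
    {cov : CovariantDerivative 𝓘(ℝ, E) F V} (h : cov.ContMDiffCovariantDerivative ∞) :
    cov.PreservesSmooth := by
  intro U X σ hU hX hσ x hx
  -- The hypothesis is applied to sections smooth on all of `M`. A bump function supported in `U`
  -- and equal to one near `x` makes `σ` global without changing its derivative near `x`.
  obtain ⟨ψ, hψU, -⟩ := (SmoothBumpFunction.nhds_basis_support (I := 𝓘(ℝ, E))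
    (hU.mem_nhds hx)).mem_iff.1 (hU.mem_nhds hx)
  have hψ : ContMDiff 𝓘(ℝ, E) 𝓘(ℝ) ∞ ψ := ψ.contMDiff
  have hτ : ContMDiff 𝓘(ℝ, E) (𝓘(ℝ, E).prod 𝓘(ℝ, F)) ∞
      (fun y => TotalSpace.mk' F y (((ψ : M → ℝ) • σ) y)) :=
    ContMDiffOn.smul_section_of_tsupport hψ.contMDiffOn hU hψU hσ
  have h1 := h.contMDiff.contMDiff (σ := (ψ : M → ℝ) • σ) (hτ.contMDiffOn)
  have h2 : SmoothSectionOn 𝓘(ℝ, E) F (fun y => cov ((ψ : M → ℝ) • σ) y (X y)) U :=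
    (h1.mono (subset_univ U)).clm_bundle_apply hX
  obtain ⟨N, hN, hNo, hxN⟩ := mem_nhds_iff.1 (Filter.inter_mem (hU.mem_nhds hx) ψ.eventuallyEq_one)
  have heq : ∀ y ∈ N, cov σ y (X y) = cov ((ψ : M → ℝ) • σ) y (X y) := by
    intro y hy
    refine congrArg (fun T => T (X y)) (cov.congr_of_eqOn hNo hy
      (hσ.mono fun z hz => (hN hz).1) fun z hz => ?_).symm
    have : ψ z = 1 := (hN hz).2
    rw [Pi.smul_apply', this, one_smul]
  have h3 := (h2.mono fun z hz => (hN hz).1).congr heq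
  exact (ContMDiffOn.contMDiffAt h3 (hNo.mem_nhds hxN)).contMDiffWithinAt

theorem contMDiffOn_bilin_apply {h : Π x : M, TangentBilin 𝓘(ℝ, E) x} {U : Set M}
    (hh : SmoothSectionOn 𝓘(ℝ, E) (E →L[ℝ] E →L[ℝ] ℝ) h U)
    {X Y : Π x : M, TangentSpace 𝓘(ℝ, E) x} (hX : SmoothSectionOn 𝓘(ℝ, E) E X U)
    (hY : SmoothSectionOn 𝓘(ℝ, E) E Y U) :
    ContMDiffOn 𝓘(ℝ, E) 𝓘(ℝ) ∞ (fun y => h y (X y) (Y y)) U := by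
  have : ContMDiffOn 𝓘(ℝ, E) (𝓘(ℝ, E).prod 𝓘(ℝ)) ∞
      (fun m ↦ TotalSpace.mk' ℝ (E := Bundle.Trivial M ℝ) m (h m (X m) (Y m))) U := by
    exact ContMDiffOn.clm_bundle_apply₂ (F₁ := E) (F₂ := E) hh hX hY
  intro y hy
  exact (contMDiffWithinAt_totalSpace.1 (this y hy)).2

/-- A bilinear form depends smoothly on the point if its coefficients in the charts do. -/
theorem smoothSectionOn_bilin {h : Π x : M, TangentBilin 𝓘(ℝ, E) x} {U : Set M} (hU : IsOpen U)
    (hh : ∀ x₀ u v, ContMDiffOn 𝓘(ℝ, E) 𝓘(ℝ) ∞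
      (fun y => h y (coordField x₀ u y) (coordField x₀ v y)) (U ∩ (chartAt E x₀).source)) :
    SmoothSectionOn 𝓘(ℝ, E) (E →L[ℝ] E →L[ℝ] ℝ) h U := by
  intro x hx
  refine ContMDiffAt.contMDiffWithinAt ?_
  rw [contMDiffAt_hom_bundle]
  refine ⟨contMDiffAt_id, ?_⟩
  have hUx : IsOpen (U ∩ (chartAt E x).source) := hU.inter (chartAt E x).open_source
  have hxU : x ∈ U ∩ (chartAt E x).source := ⟨hx, mem_chart_source E x⟩
  set φ := extChartAt 𝓘(ℝ, E) x with hφ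
  let H : M → E →L[ℝ] E →L[ℝ] ℝ := fun y => ContinuousLinearMap.inCoordinates E
    (TangentSpace 𝓘(ℝ, E)) (E →L[ℝ] ℝ) (fun x => TangentSpace 𝓘(ℝ, E) x →L[ℝ] ℝ) x y x y (h y)
  change ContMDiffAt 𝓘(ℝ, E) 𝓘(ℝ, E →L[ℝ] E →L[ℝ] ℝ) ∞ H x
  have hH : ∀ y ∈ U ∩ (chartAt E x).source, ∀ u v,
      H y u v = h y (coordField x u y) (coordField x v y) := by
    intro y hy u v
    have := inCoordinates_apply_eq₂ (𝕜 := ℝ) (F₁ := E) (E₁ := TangentSpace 𝓘(ℝ, E)) (F₂ := E)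
      (E₂ := TangentSpace 𝓘(ℝ, E)) (F₃ := ℝ) (E₃ := Bundle.Trivial M ℝ) (x₀ := x) (x := y) (ϕ := h y)
      (v := u) (w := v) hy.2 hy.2 (mem_univ y)
    refine this.trans ?_
    have hb : y ∈ (trivializationAt E (TangentSpace 𝓘(ℝ, E)) x).baseSet := hy.2
    simp [coordField, Trivialization.symmL_apply _ hb]
  have hHc : ContDiffOn ℝ ∞ (inChart x H)
      (φ.target ∩ φ.symm ⁻¹' (U ∩ (chartAt E x).source)) := by
    refine contDiffOn_clm_apply.2 fun u => contDiffOn_clm_apply.2 fun v => ?_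
    refine (contDiffOn_inChart (x₀ := x) (hh x u v)).congr fun z hz => ?_
    exact hH _ hz.2 u v
  have hc : ContMDiffOn 𝓘(ℝ, E) 𝓘(ℝ, E →L[ℝ] E →L[ℝ] ℝ) ∞ (inChart x H ∘ φ)
      (U ∩ (chartAt E x).source) :=
    hHc.contMDiffOn.comp (contMDiffOn_extChartAt.mono inter_subset_right)
      fun y hy => mem_inChart hy.2 hy
  refine (hc.contMDiffAt (hUx.mem_nhds hxU)).congr_of_eventuallyEq ?_
  filter_upwards [hUx.mem_nhds hxU] with y hy
  have hy' : y ∈ φ.source := by rw [hφ, extChartAt_source]; exact hy.2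
  simp only [inChart, Function.comp_apply]
  rw [← hφ, φ.left_inv hy']

variable {cov : CovariantDerivative 𝓘(ℝ, E) E (TangentSpace 𝓘(ℝ, E) : M → Type _)}

theorem CovariantDerivative.PreservesSmooth.bilin (hcov : cov.PreservesSmooth) :
    cov.bilin.PreservesSmooth := by
  intro U X h hU hX hh
  refine smoothSectionOn_bilin hU fun x₀ u v => ?_
  let U' := U ∩ (chartAt E x₀).source
  have hU' : IsOpen U' := hU.inter (chartAt E x₀).open_source
  have hu : ∀ u, SmoothSectionOn 𝓘(ℝ, E) E (coordField x₀ u) U' := fun u =>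
    (smooth_coordField x₀ u).mono inter_subset_right
  have hX' := hX.mono (inter_subset_left (s := U) (t := (chartAt E x₀).source))
  have hh' := hh.mono (inter_subset_left (s := U) (t := (chartAt E x₀).source))
  have h1 := contMDiffOn_mvfderiv_apply hU' (contMDiffOn_bilin_apply hh' (hu u) (hu v)) hX'
  have h2 := contMDiffOn_bilin_apply hh' (hcov U' X _ hU' hX' (hu u)) (hu v)
  have h3 := contMDiffOn_bilin_apply hh' (hu u) (hcov U' X _ hU' hX' (hu v))
  refine ((h1.sub h2).sub h3).congr fun y hy => ?_
  exact cov.bilin_apply (SmoothSectionOn.mdifferentiableAt hh' hU' hy) (X y)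
    ((hu u).mdifferentiableAt hU' hy) ((hu v).mdifferentiableAt hU' hy)

theorem isFibrewiseSubspace_symmetricForms :
    IsFibrewiseSubspace (symmetricForms (M := M) 𝓘(ℝ, E)) := by
  refine fun x => ⟨fun v w => rfl, fun a b h hh k hk v w => ?_⟩
  change a * h v w + b * k v w = a * h w v + b * k w v
  rw [hh v w, hk v w]

end InducedConnection

/-! ### Parallel transport and positivity of parallel forms -/

section ParallelForms

set_option maxSynthPendingDepth 3

variable {E : Type*} [NormedAddCommGroup E] [NormedSpace ℝ E] [FiniteDimensional ℝ E]
  {M : Type*} [TopologicalSpace M] [ChartedSpace E M] [IsManifold 𝓘(ℝ, E) ∞ M]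

/-- The coordinate frame of the chart at `x₀`. -/
noncomputable abbrev coordFrame (x₀ : M) (j : Fin (finrank ℝ E)) :
    Π y : M, TangentSpace 𝓘(ℝ, E) y := coordField x₀ (finBasis ℝ E j)

/-- The coefficients of a tangent vector with respect to the coordinate frame. -/
noncomputable def coordCoeff (x₀ y : M) :
    TangentSpace 𝓘(ℝ, E) y →ₗ[ℝ] (Fin (finrank ℝ E) → ℝ) :=
  (finBasis ℝ E).equivFun.toLinearMap.comp
    (mvfderiv 𝓘(ℝ, E) (extChartAt 𝓘(ℝ, E) x₀) y).toLinearMap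

theorem frameSum_coordFrame (x₀ : M) (c : Fin (finrank ℝ E) → ℝ) (y : M) :
    frameSum (coordFrame (E := E) x₀) c y = coordField x₀ ((finBasis ℝ E).equivFun.symm c) y := by
  rw [frameSum_apply, Basis.equivFun_symm_apply, coordField, map_sum]
  simp only [map_smul]
  rfl

theorem isDualOn_coordFrame (x₀ : M) :
    IsDualOn E E (coordFrame (E := E) x₀) (coordCoeff x₀) (chartAt E x₀).source where
  isOpen := (chartAt E x₀).open_source
  smooth_frame i := smooth_coordField x₀ _
  apply_frameSum y hy c := by
    rw [frameSum_coordFrame]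
    have := mvfderiv_extChartAt_coordField x₀ ((finBasis ℝ E).equivFun.symm c) hy
    refine (congrArg (finBasis ℝ E).equivFun this).trans ?_
    exact LinearEquiv.apply_symm_apply _ _
  smooth W τ hW hWU hτ := by
    have h1 := contMDiffOn_mvfderiv_apply hW (contMDiffOn_extChartAt.mono hWU) hτ
    exact ((LinearMap.toContinuousLinearMap
      (finBasis ℝ E).equivFun.toLinearMap).contMDiff.comp_contMDiffOn h1)

theorem mem_span_coordFrame (x₀ : M) {y : M} (hy : y ∈ (chartAt E x₀).source)
    (w : TangentSpace 𝓘(ℝ, E) y) :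
    w ∈ Submodule.span ℝ (range fun j => coordFrame x₀ j y) := by
  rw [← coordField_mvfderiv_extChartAt x₀ hy w,
    ← (finBasis ℝ E).equivFun.symm_apply_apply (mvfderiv 𝓘(ℝ, E) (extChartAt 𝓘(ℝ, E) x₀) y w),
    ← frameSum_coordFrame]
  exact IsDualOn.frameSum_mem_span _ _

/-- The matrix of a field of bilinear forms with respect to the coordinate frame. -/
noncomputable def gramForm (h : Π x : M, TangentBilin 𝓘(ℝ, E) x) (x₀ : M) (z : E) :
    (Fin (finrank ℝ E) → ℝ) →L[ℝ] (Fin (finrank ℝ E) → ℝ) →L[ℝ] ℝ :=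
  ∑ i, ∑ j, inChart x₀ (fun y => h y (coordFrame x₀ i y) (coordFrame x₀ j y)) z •
    (ContinuousLinearMap.proj (R := ℝ) (φ := fun _ : Fin (finrank ℝ E) => ℝ) i).smulRight
      (ContinuousLinearMap.proj (R := ℝ) (φ := fun _ : Fin (finrank ℝ E) => ℝ) j)

theorem gramForm_apply (h : Π x : M, TangentBilin 𝓘(ℝ, E) x) (x₀ : M) (z : E)
    (c d : Fin (finrank ℝ E) → ℝ) :
    gramForm h x₀ z c d
      = inChart x₀ (fun y => h y (frameSum (coordFrame (E := E) x₀) c y) (frameSum (coordFrame (E := E) x₀) d y)) z := by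
  simp only [inChart, Function.comp_apply, frameSum_apply]
  let y := (extChartAt 𝓘(ℝ, E) x₀).symm z
  let B : E →L[ℝ] E →L[ℝ] ℝ := h y
  let f : Fin (finrank ℝ E) → E := fun j => coordFrame x₀ j y
  change _ = B (∑ j, c j • f j) (∑ j, d j • f j)
  have h1 : gramForm h x₀ z c d = ∑ i, ∑ j, B (f i) (f j) * (c i * d j) := by
    simp only [gramForm, _root_.sum_apply]
    rfl
  simp only [h1, map_sum, map_smul, _root_.sum_apply, _root_.smul_apply, smul_eq_mul,
    Finset.mul_sum]
  rw [Finset.sum_comm]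
  refine Finset.sum_congr rfl fun i _ => Finset.sum_congr rfl fun j _ => ?_
  ring

theorem contDiffOn_gramForm {h : Π x : M, TangentBilin 𝓘(ℝ, E) x}
    (hh : SmoothSectionOn 𝓘(ℝ, E) (E →L[ℝ] E →L[ℝ] ℝ) h univ) (x₀ : M) :
    ContDiffOn ℝ ∞ (gramForm h x₀) ((extChartAt 𝓘(ℝ, E) x₀).target ∩
      (extChartAt 𝓘(ℝ, E) x₀).symm ⁻¹' (chartAt E x₀).source) := by
  unfold gramForm
  refine ContDiffOn.sum fun i _ => ContDiffOn.sum fun j _ => ?_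
  exact (contDiffOn_inChart (contMDiffOn_bilin_apply (hh.mono (subset_univ _))
    (smooth_coordField x₀ _) (smooth_coordField x₀ _))).smul contDiffOn_const

variable {cov : CovariantDerivative 𝓘(ℝ, E) E (TangentSpace 𝓘(ℝ, E) : M → Type _)}

namespace CovariantDerivative

/-- The equation `∇h = 0` in coordinates. Consequently `h(v, v)` has zero derivative along solutions
of `v' = -Ω v`. -/
theorem fderiv_gramForm {h : Π x : M, TangentBilin 𝓘(ℝ, E) x}
    (hh : SmoothSectionOn 𝓘(ℝ, E) (E →L[ℝ] E →L[ℝ] ℝ) h univ) (hpar : ∀ y, cov.bilin h y = 0)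
    (x₀ : M) {z : E} (hz : z ∈ (extChartAt 𝓘(ℝ, E) x₀).target) (u : E)
    (c d : Fin (finrank ℝ E) → ℝ) :
    fderiv ℝ (gramForm h x₀) z u c d
      = gramForm h x₀ z (cov.connectionForm (coordFrame (E := E) x₀) (coordCoeff x₀) x₀ z u c) d
        + gramForm h x₀ z c (cov.connectionForm (coordFrame (E := E) x₀) (coordCoeff x₀) x₀ z u d) := by
  set φ := extChartAt 𝓘(ℝ, E) x₀ with hφ
  obtain ⟨y, hy, rfl⟩ : ∃ y, y ∈ (chartAt E x₀).source ∧ φ y = z := by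
    refine ⟨φ.symm z, ?_, φ.right_inv hz⟩
    have := φ.map_target hz
    rwa [hφ, extChartAt_source] at this
  have hy' : y ∈ φ.source := by rwa [hφ, extChartAt_source]
  have hS : IsOpen (chartAt E x₀).source := (chartAt E x₀).open_source
  have hL := isDualOn_coordFrame (E := E) x₀
  have hs : ∀ c, SmoothSectionOn 𝓘(ℝ, E) E (frameSum (coordFrame (E := E) x₀) c) (chartAt E x₀).source :=
    fun c => smooth_frameSum hL.smooth_frame c
  have hcov : ∀ c, cov (frameSum (coordFrame (E := E) x₀) c) y (coordField x₀ u y) = frameSum (coordFrame (E := E) x₀)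
      (cov.connectionForm (coordFrame (E := E) x₀) (coordCoeff x₀) x₀ (φ y) u c) y := by
    intro c
    rw [← sum_smul_cov_eq_frameSum hL subset_rfl (fun y hy i v => mem_span_coordFrame x₀ hy _) hy,
      frameSum, sum_apply _ hS hy fun j => (hL.smooth_frame j).const_smul (c j)]
    exact Finset.sum_congr rfl fun j _ => const_smul_apply hS hy _ (hL.smooth_frame j) _
  have hval : ∀ c d, gramForm h x₀ (φ y) c d
      = h y (frameSum (coordFrame (E := E) x₀) c y) (frameSum (coordFrame (E := E) x₀) d y) := by
    intro c d
    rw [gramForm_apply, inChart, Function.comp_apply, ← hφ, φ.left_inv hy']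
  have hhs := hh.mono (subset_univ (chartAt E x₀).source)
  have hf := contMDiffOn_bilin_apply hhs (hs c) (hs d)
  have hd : DifferentiableAt ℝ (gramForm h x₀) (φ y) :=
    ((contDiffOn_gramForm hh x₀).contDiffAt ((isOpen_inChart hS x₀).mem_nhds
      (mem_inChart hy hy))).differentiableAt (by simp)
  have h1 : fderiv ℝ (gramForm h x₀) (φ y) u c d
      = fderiv ℝ (fun z => gramForm h x₀ z c d) (φ y) u := by
    have := (hd.hasFDerivAt.clm_apply (hasFDerivAt_const c _)).clm_apply (hasFDerivAt_const d _)
    rw [this.fderiv]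
    simp
  have h2 : (fun z => gramForm h x₀ z c d) = inChart x₀ (fun y =>
      h y (frameSum (coordFrame (E := E) x₀) c y) (frameSum (coordFrame (E := E) x₀) d y)) :=
    funext fun z => gramForm_apply h x₀ z c d
  have h3 := cov.bilin_apply (hhs.mdifferentiableAt hS hy) (coordField x₀ u y)
    ((hs c).mdifferentiableAt hS hy) ((hs d).mdifferentiableAt hS hy)
  rw [mvfderiv_coordField x₀ hy ((hf.contMDiffAt (hS.mem_nhds hy)).mdifferentiableAt (by simp)),
    hcov, hcov, hpar] at h3
  rw [h1, h2, hval, hval]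
  change (0 : ℝ) = _ at h3
  linarith

/-- Near every point, the values of a parallel bilinear form on nonzero vectors do not depend on
the base point. -/
theorem exists_nhds_apply_self_eq (hcov : cov.PreservesSmooth)
    {h : Π x : M, TangentBilin 𝓘(ℝ, E) x}
    (hh : SmoothSectionOn 𝓘(ℝ, E) (E →L[ℝ] E →L[ℝ] ℝ) h univ) (hpar : ∀ y, cov.bilin h y = 0)
    (x : M) :
    ∃ N ∈ 𝓝 x, ∀ y ∈ N, ∀ z ∈ N, ∀ a : TangentSpace 𝓘(ℝ, E) y, a ≠ 0 →
      ∃ b : TangentSpace 𝓘(ℝ, E) z, b ≠ 0 ∧ h z b b = h y a a := by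
  have hS : IsOpen (chartAt E x).source := (chartAt E x).open_source
  have hxs : x ∈ (chartAt E x).source := mem_chart_source E x
  set φ := extChartAt 𝓘(ℝ, E) x with hφ
  have hL := isDualOn_coordFrame (E := E) x
  set Ω := cov.connectionForm (coordFrame (E := E) x) (coordCoeff x) x with hΩ
  set Z := φ.target ∩ φ.symm ⁻¹' (chartAt E x).source with hZ
  have hZo : IsOpen Z := isOpen_inChart hS x
  have hxZ : φ x ∈ Z := mem_inChart hxs hxs
  have hΩc : ContinuousOn Ω Z := (contDiffOn_connectionForm hcov hL subset_rfl).continuousOn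
  set C := ‖Ω (φ x)‖ + 1 with hC
  have hC0 : 0 < C := by positivity
  have hev : ∀ᶠ z in 𝓝 (φ x), z ∈ Z ∧ ‖Ω z‖ < C := by
    filter_upwards [hZo.mem_nhds hxZ, (hΩc.continuousAt (hZo.mem_nhds hxZ)).norm.eventually_lt_const
      (lt_add_one _)] with z h1 h2
    exact ⟨h1, h2⟩
  obtain ⟨ε, hε, hball⟩ := Metric.eventually_nhds_iff_ball.1 hev
  -- Two points of the ball differ by at most `2ρ`, so the transport equation between them has
  -- coefficients of norm at most `C * 2ρ ≤ 1 / 4`.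
  let ρ := min ε (1 / (8 * C))
  have hρ : 0 < ρ := lt_min hε (by positivity)
  have hball' : ∀ z ∈ Metric.ball (φ x) ρ, z ∈ Z ∧ ‖Ω z‖ < C := fun z hz =>
    hball z (Metric.ball_subset_ball (min_le_left _ _) hz)
  refine ⟨φ.source ∩ φ ⁻¹' Metric.ball (φ x) ρ, Filter.inter_mem (extChartAt_source_mem_nhds x)
    ((continuousAt_extChartAt x).preimage_mem_nhds (Metric.ball_mem_nhds _ hρ)), ?_⟩
  rintro y ⟨hys, hyb⟩ z ⟨hzs, hzb⟩ a ha
  have hys' : y ∈ (chartAt E x).source := by rwa [hφ, extChartAt_source] at hys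
  have hzs' : z ∈ (chartAt E x).source := by rwa [hφ, extChartAt_source] at hzs
  let w := φ z - φ y
  let γ : ℝ → E := fun t => φ y + t • w
  have hγ : ∀ t ∈ Icc (0 : ℝ) 1, γ t ∈ Metric.ball (φ x) ρ := fun t ht =>
    (convex_ball (φ x) ρ).add_smul_sub_mem hyb hzb ht
  have hw : ‖w‖ ≤ 2 * ρ := by
    have h1 := Metric.mem_ball.1 hyb
    have h2 := Metric.mem_ball.1 hzb
    have h3 := dist_triangle_right (φ z) (φ y) (φ x)
    rw [dist_eq_norm] at h3
    change ‖φ z - φ y‖ ≤ _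
    linarith
  have hγ' : ∀ t, HasDerivAt γ w t := fun t => by
    have h1 := ((hasDerivAt_id t).smul_const w).const_add (φ y)
    rw [one_smul] at h1
    exact h1
  have hγc : Continuous γ := by fun_prop
  -- Parallel transport of `a` along the straight segment from `y` to `z` in the chart, written in
  -- the coordinate frame.
  let A : ℝ → (Fin (finrank ℝ E) → ℝ) →L[ℝ] (Fin (finrank ℝ E) → ℝ) := fun t => -Ω (γ t) w
  have hA : ContinuousOn A (Icc 0 1) := by
    have h1 : ContinuousOn (fun t => Ω (γ t)) (Icc 0 1) :=
      hΩc.comp hγc.continuousOn fun t ht => (hball' _ (hγ t ht)).1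
    exact (h1.clm_apply continuousOn_const).neg
  have hAb : ∀ t ∈ Icc (0 : ℝ) 1, ‖A t‖ ≤ 1 / 4 := by
    intro t ht
    have h1 : ‖Ω (γ t) w‖ ≤ C * (2 * ρ) := by
      refine ((Ω (γ t)).le_opNorm w).trans ?_
      exact mul_le_mul (hball' _ (hγ t ht)).2.le hw (norm_nonneg _) hC0.le
    have h2 : C * (2 * ρ) ≤ 1 / 4 := by
      calc C * (2 * ρ) ≤ C * (2 * (1 / (8 * C))) := by
            have : ρ ≤ 1 / (8 * C) := min_le_right _ _
            gcongr
        _ = 1 / 4 := by field_simp; norm_num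
    calc ‖A t‖ = ‖Ω (γ t) w‖ := norm_neg _
      _ ≤ 1 / 4 := h1.trans h2
  obtain ⟨v, hv0, hv, hvb⟩ := exists_linearODE_solution A hA hAb (coordCoeff x y a)
  -- The value of `h` on the transported vector; it is constant by `fderiv_gramForm`.
  let Q : ℝ → ℝ := fun t => gramForm h x (γ t) (v t) (v t)
  have hQ : ∀ t ∈ Icc (0 : ℝ) 1, HasDerivWithinAt Q 0 (Icc 0 1) t := by
    intro t ht
    have hzt := (hball' _ (hγ t ht)).1
    have h1 : HasFDerivAt (gramForm h x) (fderiv ℝ (gramForm h x) (γ t)) (γ t) :=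
      (((contDiffOn_gramForm hh x).contDiffAt (hZo.mem_nhds hzt)).differentiableAt
        (by simp)).hasFDerivAt
    have h2 := (h1.comp_hasDerivAt t (hγ' t)).hasDerivWithinAt (s := Icc 0 1)
    have h3 := (h2.clm_apply (hv t ht)).clm_apply (hv t ht)
    refine h3.congr_deriv ?_
    have h4 := fderiv_gramForm hh hpar x hzt.1 w (v t) (v t)
    simp only [A, _root_.add_apply, _root_.neg_apply, map_neg, Function.comp_apply]
    rw [h4]
    ring
  have hconst : Q 1 = Q 0 := by
    refine constant_of_derivWithin_zero (fun t ht => (hQ t ht).differentiableWithinAt)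
      (fun t ht => ?_) 1 (right_mem_Icc.2 zero_le_one)
    exact (hQ t (Ico_subset_Icc_self ht)).derivWithin
      (uniqueDiffOn_Icc zero_lt_one t (Ico_subset_Icc_self ht))
  have hγ0 : γ 0 = φ y := by simp [γ]
  have hγ1 : γ 1 = φ z := by simp [γ, w]
  have hya : frameSum (coordFrame (E := E) x) (coordCoeff x y a) y = a :=
    (hL.mem_span_iff hys').1 (mem_span_coordFrame x hys' a)
  have ha' : coordCoeff x y a ≠ 0 := by
    intro h0
    rw [h0, frameSum_apply] at hya
    exact ha (by simpa using hya.symm)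
  -- The transported vector is nonzero, because its coefficients differ from those of `a ≠ 0` by at
  -- most half the norm of the latter.
  refine ⟨frameSum (coordFrame (E := E) x) (v 1) z, fun h0 => ?_, ?_⟩
  · have h1 := hL.apply_frameSum z hzs' (v 1)
    rw [h0, map_zero] at h1
    have h2 := hvb 1 (right_mem_Icc.2 zero_le_one)
    rw [← h1, zero_sub, norm_neg] at h2
    have h3 := norm_pos_iff.2 ha'
    linarith
  · simp only [Q] at hconst
    rw [hγ0, hγ1, hv0, gramForm_apply, gramForm_apply] at hconst
    simp only [inChart, Function.comp_apply] at hconst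
    rw [← hφ, φ.left_inv hys, φ.left_inv hzs, hya] at hconst
    exact hconst

/-- A parallel bilinear form which is positive definite at one point is positive definite. -/
theorem pos_of_parallel [PreconnectedSpace M] (hcov : cov.PreservesSmooth)
    {h : Π x : M, TangentBilin 𝓘(ℝ, E) x}
    (hh : SmoothSectionOn 𝓘(ℝ, E) (E →L[ℝ] E →L[ℝ] ℝ) h univ) (hpar : ∀ y, cov.bilin h y = 0)
    {x : M} (hx : ∀ v, v ≠ 0 → 0 < h x v v) (y : M) : ∀ v, v ≠ 0 → 0 < h y v v := by
  have hloc : ∀ y, ∃ N ∈ 𝓝 y, ∀ z ∈ N, ∀ z' ∈ N,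
      (∀ v, v ≠ 0 → 0 < h z v v) → ∀ v, v ≠ 0 → 0 < h z' v v := by
    intro y
    obtain ⟨N, hN, h1⟩ := exists_nhds_apply_self_eq hcov hh hpar y
    refine ⟨N, hN, fun z hz z' hz' hpos v hv => ?_⟩
    obtain ⟨b, hb, hbv⟩ := h1 z' hz' z hz v hv
    rw [← hbv]
    exact hpos b hb
  have hclopen : IsClopen {y | ∀ v, v ≠ 0 → 0 < h y v v} := by
    refine ⟨isOpen_compl_iff.1 (isOpen_iff_mem_nhds.2 fun y hy => ?_),
      isOpen_iff_mem_nhds.2 fun y hy => ?_⟩ <;> obtain ⟨N, hN, h1⟩ := hloc y <;>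
      filter_upwards [hN] with z hz
    · exact fun hz' => hy (h1 z hz y (mem_of_mem_nhds hN) hz')
    · exact h1 y (mem_of_mem_nhds hN) z hz hy
  have : y ∈ {y | ∀ v, v ≠ 0 → 0 < h y v v} := hclopen.eq_univ ⟨x, hx⟩ ▸ mem_univ y
  exact this

end CovariantDerivative

end ParallelForms

/-! ### Bases of positive definite forms -/

section PositiveForms

set_option synthInstance.maxHeartbeats 200000 in
/-- A small perturbation of a positive definite bilinear form is positive definite. -/
theorem exists_pos_add_smul {E : Type*} [NormedAddCommGroup E] [NormedSpace ℝ E]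
    [FiniteDimensional ℝ E] {B : E →L[ℝ] E →L[ℝ] ℝ} (hB : ∀ v, v ≠ 0 → 0 < B v v)
    (B' : E →L[ℝ] E →L[ℝ] ℝ) : ∃ ε : ℝ, 0 < ε ∧ ∀ v, v ≠ 0 → 0 < B v v + ε * B' v v := by
  rcases subsingleton_or_nontrivial E with hE | hE
  · exact ⟨1, one_pos, fun v hv => absurd (Subsingleton.elim v 0) hv⟩
  have : ProperSpace E := FiniteDimensional.proper ℝ E
  obtain ⟨w, hw, hmin⟩ := (isCompact_sphere (0 : E) 1).exists_isMinOn
    (NormedSpace.sphere_nonempty.2 zero_le_one)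
    (f := fun v => B v v) (by fun_prop)
  have hw0 : w ≠ 0 := ne_zero_of_mem_unit_sphere ⟨w, hw⟩
  have hm : 0 < B w w := hB w hw0
  -- `B w w` is the minimum of `B` on the unit sphere, so `B v v ≥ B w w * ‖v‖ ^ 2`, whereas `B' v v
  -- ≥ -‖B'‖ * ‖v‖ ^ 2`.
  refine ⟨B w w / (‖B'‖ + 1), by positivity, fun v hv => ?_⟩
  have hv' : 0 < ‖v‖ := norm_pos_iff.2 hv
  have h1 : B w w * (‖v‖ * ‖v‖) ≤ B v v := by
    have h2 : B w w ≤ B (‖v‖⁻¹ • v) (‖v‖⁻¹ • v) := hmin (by simp [norm_smul, hv'.ne'])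
    simp only [map_smul, _root_.smul_apply, smul_eq_mul] at h2
    calc B w w * (‖v‖ * ‖v‖) ≤ ‖v‖⁻¹ * (‖v‖⁻¹ * B v v) * (‖v‖ * ‖v‖) := by gcongr
      _ = B v v := by field_simp
  have h3 : -(‖B'‖ * ‖v‖ * ‖v‖) ≤ B' v v := by
    have := B'.le_opNorm₂ v v
    rw [Real.norm_eq_abs] at this
    exact (abs_le.1 this).1
  have h4 : B w w / (‖B'‖ + 1) * (‖B'‖ * ‖v‖ * ‖v‖) < B w w * (‖v‖ * ‖v‖) := by
    have h5 : B w w / (‖B'‖ + 1) * (‖B'‖ * ‖v‖ * ‖v‖)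
        = B w w * (‖v‖ * ‖v‖) * (‖B'‖ / (‖B'‖ + 1)) := by
      field_simp
    rw [h5]
    refine mul_lt_of_lt_one_right (by positivity) ?_
    rw [div_lt_one (by positivity)]
    linarith
  have h6 : B w w / (‖B'‖ + 1) * -(‖B'‖ * ‖v‖ * ‖v‖) ≤ B w w / (‖B'‖ + 1) * B' v v := by
    gcongr
  linarith

/-- A subspace which contains a point of `D` at which `D` is absorbing is spanned by elements of
`D`. -/
theorem exists_linearIndependent_mem {N : Type*} [AddCommGroup N] [Module ℝ N]
    [FiniteDimensional ℝ N] (P : Submodule ℝ N) {D : Set N} {b₀ : N} (hP : b₀ ∈ P) (hD : b₀ ∈ D)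
    (habs : ∀ b, ∃ ε : ℝ, 0 < ε ∧ b₀ + ε • b ∈ D) {r : ℕ} (hr : finrank ℝ P = r) :
    ∃ b : Fin r → N, LinearIndependent ℝ b ∧ ∀ i, b i ∈ P ∧ b i ∈ D := by
  have hspan : Submodule.span ℝ (P ∩ D) = P := by
    refine le_antisymm (Submodule.span_le.2 fun b hb => hb.1) fun b hb => ?_
    obtain ⟨ε, hε, hpos⟩ := habs b
    have h1 : b₀ + ε • b ∈ (P ∩ D : Set N) := ⟨P.add_mem hP (P.smul_mem ε hb), hpos⟩
    -- Any element of `P` is a multiple of a difference of two elements of `P ∩ D`, so `P ∩ D` spans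
    -- `P` and contains a basis.
    have h2 : b = ε⁻¹ • ((b₀ + ε • b) - b₀) := by
      rw [add_sub_cancel_left, smul_smul, inv_mul_cancel₀ hε.ne', one_smul]
    rw [h2]
    exact Submodule.smul_mem _ _ (Submodule.sub_mem _ (Submodule.subset_span h1)
      (Submodule.subset_span ⟨hP, hD⟩))
  obtain ⟨s, hsD, hs, hli⟩ := exists_linearIndependent ℝ (P ∩ D : Set N)
  have : Fintype s := hli.setFinite.fintype
  have hcard : Fintype.card s = r := by
    rw [← hr, ← hspan, ← hs, finrank_span_set_eq_card hli, Set.toFinset_card]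
  let f : Fin r ≃ s := (Fintype.equivFinOfCardEq hcard).symm
  exact ⟨fun i => f i, hli.comp f f.injective, fun i => hsD (f i).2⟩

end PositiveForms

/-! ### Global parallel metrics -/

theorem CovariantDerivative.IsGlobalParallel.frameSum
    {E : Type*} [NormedAddCommGroup E] [NormedSpace ℝ E] [FiniteDimensional ℝ E]
    {M : Type*} [TopologicalSpace M] [ChartedSpace E M] [IsManifold 𝓘(ℝ, E) ∞ M]
    {F : Type*} [NormedAddCommGroup F] [NormedSpace ℝ F]
    {V : M → Type*} [TopologicalSpace (TotalSpace F V)]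
    [∀ x, AddCommGroup (V x)] [∀ x, Module ℝ (V x)] [∀ x : M, TopologicalSpace (V x)]
    [FiberBundle F V] [VectorBundle ℝ F V]
    [∀ x, IsTopologicalAddGroup (V x)] [∀ x, ContinuousSMul ℝ (V x)]
    [FiniteDimensional ℝ F] [ContMDiffVectorBundle ∞ F V 𝓘(ℝ, E)]
    {cov : CovariantDerivative 𝓘(ℝ, E) F V} {W : Π x : M, Set (V x)} (hcov : cov.PreservesSmooth)
    (hW : IsFibrewiseSubspace W) {r : ℕ} {σ : Fin r → Π x : M, V x}
    (hσ : ∀ i, cov.IsGlobalParallel W (σ i)) (c : Fin r → ℝ) :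
    cov.IsGlobalParallel W (_root_.frameSum σ c) where
  smooth := smooth_frameSum (fun i => (hσ i).smooth) c
  parallel y := by
    ext v
    rw [_root_.frameSum, sum_apply _ isOpen_univ (mem_univ y)
      fun i => (hσ i).smooth.const_smul (c i)]
    simp only [const_smul_apply isOpen_univ (mem_univ y) _ (hσ _).smooth, (hσ _).parallel y]
    simp
  mem y := by
    have : CompleteSpace E := FiniteDimensional.complete ℝ E
    refine mem_iInter.2 fun k => ?_
    have hk := isFibrewiseSubspace_derivedFlag hcov hW k
    have : _root_.frameSum σ c y ∈ hk.submodule y := by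
      rw [frameSum_apply]
      exact Submodule.sum_mem _ fun i _ => Submodule.smul_mem _ _ (mem_iInter.1 ((hσ i).mem y) k)
    exact this

theorem proposition4
    {E : Type*} [NormedAddCommGroup E] [NormedSpace ℝ E] [FiniteDimensional ℝ E]
    {M : Type*} [TopologicalSpace M] [T2Space M] [SecondCountableTopology M]
    [ChartedSpace E M] [IsManifold 𝓘(ℝ, E) ∞ M] [SimplyConnectedSpace M]
    (cov : CovariantDerivative 𝓘(ℝ, E) E (TangentSpace 𝓘(ℝ, E) : M → Type _))
    (hsmooth : cov.ContMDiffCovariantDerivative ∞)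
    (hreg : cov.IsRegular) (hloc : cov.IsLocallyMetric) :
    cov.IsMetric ∧
      ∃ r : ℕ, (∀ x : M, finrank ℝ (Submodule.span ℝ (cov.maximalFlatSubset x)) = r) ∧
        ∃ g : Fin r → Π x : M, TangentBilin 𝓘(ℝ, E) x,
          (∀ i, cov.IsParallelMetricOn (g i) univ) ∧
          ∀ x : M, LinearIndependent ℝ (fun i => g i x) := by
  have : CompleteSpace E := FiniteDimensional.complete ℝ E
  have hcov : cov.PreservesSmooth := hsmooth.preservesSmooth
  have hW := isFibrewiseSubspace_symmetricForms (E := E) (M := M)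
  have hreg' : ∀ x, IsSubbundleAt 𝓘(ℝ, E) (E →L[ℝ] E →L[ℝ] ℝ)
    (cov.bilin.terminalSubset (symmetricForms 𝓘(ℝ, E))) x := hreg
  obtain ⟨r, hr, -⟩ := CovariantDerivative.exists_parallel_frame_of_rank hcov.bilin hW hreg'
  have x₀ : M := Classical.arbitrary M
  obtain ⟨U, g₀, hU, hx₀, hg₀⟩ := hloc x₀
  have hg₀mem : g₀ x₀ ∈ cov.maximalFlatSubset x₀ :=
    CovariantDerivative.mem_terminalSubset_of_parallel hcov.bilin hW hU hg₀.smooth hg₀.parallel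
      hg₀.symm hx₀
  -- The parallel extension is symmetric because the terminal subset consists of symmetric forms,
  -- and positive definite because it is so at `x₀`.
  have hextend : ∀ b ∈ cov.maximalFlatSubset x₀, (∀ v, v ≠ 0 → 0 < b v v) →
      ∃ σ, cov.bilin.IsGlobalParallel (symmetricForms 𝓘(ℝ, E)) σ ∧ σ x₀ = b ∧
        cov.IsParallelMetricOn σ univ := by
    intro b hb hpos
    obtain ⟨σ, hσ, rfl⟩ := CovariantDerivative.exists_isGlobalParallel hcov.bilin hW hreg' hb
    exact ⟨σ, hσ, rfl, hσ.smooth,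
      fun x _ => CovariantDerivative.terminalSubset_subset x (hσ.mem x),
      fun x _ => CovariantDerivative.pos_of_parallel hcov hσ.smooth hσ.parallel hpos x,
      fun x _ => hσ.parallel x⟩
  obtain ⟨g, -, -, hg⟩ := hextend _ hg₀mem (hg₀.pos x₀ hx₀)
  refine ⟨⟨g, hg⟩, r, hr, ?_⟩
  have : FiniteDimensional ℝ (TangentBilin 𝓘(ℝ, E) x₀) :=
    finiteDimensional_fiber (E →L[ℝ] E →L[ℝ] ℝ) (fun x : M => TangentBilin 𝓘(ℝ, E) x) x₀
  -- The local metric at `x₀` is a positive definite element of the fibre of the terminal subset,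
  -- and positive definiteness survives small perturbations; so the fibre has a basis of positive
  -- definite forms.
  obtain ⟨b, hbli, hb⟩ := exists_linearIndependent_mem
    (Submodule.span ℝ (cov.maximalFlatSubset x₀)) (D := {b | ∀ v, v ≠ 0 → 0 < b v v})
    (Submodule.subset_span hg₀mem) (hg₀.pos x₀ hx₀)
    (fun b => exists_pos_add_smul (E := E) (hg₀.pos x₀ hx₀) b) (hr x₀)
  -- By regularity the terminal subset at `x₀` is a linear subspace, hence its own span.
  have hbmem : ∀ i, b i ∈ cov.maximalFlatSubset x₀ := by
    intro i
    obtain ⟨_, k, e, -, hx, -, he⟩ := hreg x₀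
    have h1 := (he x₀ hx).2
    have h2 : b i ∈ Submodule.span ℝ (cov.maximalFlatSubset x₀) := (hb i).1
    rw [h1, Submodule.span_span] at h2
    rw [h1]
    exact h2
  choose σ hσ hσx hσg using fun i => hextend (b i) (hbmem i) (hb i).2
  refine ⟨σ, hσg, fun x => Fintype.linearIndependent_iff.2 fun c hc => ?_⟩
  -- A linear relation at `x` is a zero of a global parallel section, which then vanishes
  -- identically; so the relation holds at `x₀`, where the forms are independent.
  have h1 : frameSum σ c x = 0 := (frameSum_apply σ c x).trans hc
  have h2 := (CovariantDerivative.IsGlobalParallel.frameSum hcov.bilin hW hσ c).eq_zero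
    hcov.bilin hW hreg' h1 x₀
  rw [frameSum_apply] at h2
  simp only [hσx] at h2
  exact Fintype.linearIndependent_iff.1 hbli c h2
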